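/- **Setting.** Let $d\ge 1$, $D=[0,1]^d$, $\rho>0$ and $0<\lambda\le\rho^2$. A kernel $k$ on $\mathbb R^d$ is *decomposable* if $k\le 1$ and $k(x,y)=\int_{\mathbb R^d}\cos(\omega^\top(x-y))\prod_{j=1}^d p_j(\omega_j)\,d\omega$ for some nonnegative integrable $p_1,\dots,p_d:\mathbb R\to\mathbb R$. A feature map $\Phi:\mathbb R^d\to\mathbb R^m$ is an *$\varepsilon$-uniform approximation* of $k$ if $|k(x,y)-\Phi(x)^\top\Phi(y)|\le\varepsilon$ for all $x,y\in D$. *Quadrature Fourier features* with $\bar m$ nodes $\omega_{j,i}$ and weights $w_{j,i}\ge 0$ in each coordinate $j$ are the $m=2\bar m^{\,d}$ features $\sqrt{\prod_j w_{j,i_j}}\,\cos(\sum_j\omega_{j,i_j}x_j)$ and $\sqrt{\prod_j w_{j,i_j}}\,\sin(\sum_j\omega_{j,i_j}x_j)$, where $i\in\{1,\dots,\bar m\}^d$. For the Gaussian spectral density $p(\omega)=\prod_j\frac{\nu_j}{\sqrt{2\pi}}e^{-\omega_j^2\nu_j^2/2}$ with $\nu_j>0$ (the squared exponential kernel), the QFF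 are those with $\omega_{j,i}=z_i/\nu_j$ and $w_{j,i}=\frac{\bar m!}{\bar m^2\,\mathrm{He}_{\bar m-1}(z_i)^2}$, where $z_1<\dots<z_{\bar m}$ are the zeros of the probabilists' Hermite polynomial $\mathrm{He}_{\bar m}$. Throughout, $\bar m=\lceil 6\log T\rceil$, i.e. $m\approx 2(6\log T)^d$. The *maximum information gain* is $\gamma_T=\sup_A\,[H(y_A)-H(y_A\mid f_A)]$ over sets $A\subset D$ of $T$ distinct points, where $H$ is differential entropy, $y_A=f_A+\epsilon_A$, $f_A\sim N(0,(k(a,a'))_{a,a'\in A})$, and $\epsilon_A\sim N(0,\rho^2I)$ is independent of $f_A$. **Algorithm.** Let $f$ lie in the RKHS $\mathcal H_k(D)$ with $\|f\|_k\le B$. In round $t=1,\dots,T$ a nonempty set $\mathcal D_t\subseteq D$ and perturbations $H_t\in\mathbb R^{m\times m}$, $h_t\in\mathbb R^m$, with $H_t$ almost surely positive semidefinite, are revealed. Put $$V_t=\sum_{\tau<t}\Phi(x_\tau)\Phi(x_\tau)^\top+H_t+\lambda I,\qquad \tilde\theta_t=V_t^{-1}\Big(\sum_{\tau<t}y_\tau\Phi(x_\tau)+h_t\Big).$$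 The algorithm plays $x_t\in\arg\max_{x\in\mathcal D_t}\ \tilde\theta_t^\top\Phi(x)+\beta_t^{1/2}\rho\|\Phi(x)\|_{V_t^{-1}}$, where $$\beta_t^{1/2}=B\sqrt{\tfrac{\lambda_{\max}}{\rho^2}+1}+\frac{tB\varepsilon}{\rho\sqrt{\lambda_{\min}}}+\frac{\kappa}{\rho}+\sqrt{\log\det\tfrac{V_t}{\lambda+\lambda_{\min}}+2\log\tfrac2\zeta},$$ and then observes $y_t=f(x_t)+\eta_t$. Here $\eta_t$ is $\mathcal F_t$-measurable and $x_t,H_t,h_t$ are $\mathcal F_{t-1}$-measurable for some filtration, and given $\mathcal F_{t-1}$ the noise is $\rho$-sub-Gaussian: $\mathbb E[e^{s\eta_t}\mid\mathcal F_{t-1}]\le e^{\rho^2s^2/2}$ for all $s\in\mathbb R$. The constants $0<\lambda_{\min}\le\lambda_{\max}$ and $\kappa$ are *$\delta$-accurate* if with probability at least $1-\delta$, for all $t\le T$, $H_t$ is invertible, $\|H_t\|\le\lambda_{\max}$, $\|H_t^{-1}\|\le1/\lambda_{\min}$ and $\|h_t\|_{H_t^{-1}}\le\kappa$. The regret is $\mathfrak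 R(T)=\sum_{t=1}^T\big(\sup_{x\in\mathcal D_t}f(x)-f(x_t)\big)$. **Statement.** There is a constant $C>0$, depending only on $d,\rho,\lambda$, such that the following holds. For every decomposable kernel $k$ and all $B,\lambda_0,A>0$ there is $T_0$ (depending on these and on $d,\rho,\lambda$) such that, for all $T\ge T_0$: 1. If $k$ has Gaussian spectral density with parameters $\nu_1,\dots,\nu_d>0$, its QFF $\Phi$ with $\bar m=\lceil6\log T\rceil$ nodes per coordinate is an $A\,T^{-6}$-uniform approximation of $k$. Moreover, for every $\varepsilon\le A\,T^{-6}$ for which $\Phi$ is an $\varepsilon$-uniform approximation of $k$, every $\zeta\in(0,1)$, every $f$ with $\|f\|_k\le B$, all decision sets, and all perturbations with $(\zeta/2T)$-accurate constants $\lambda_{\max},\lambda_{\min},\kappa$ with $\lambda_{\min}\ge\lambda_0$, the algorithm run with $\Phi$ and $\varepsilon$ satisfies, with probability at least $1-\zeta$, $$\mathfrak R(T)\le C\sqrt{T\gamma_T}\left(\frac{B\sqrt{\lambda_{\max}}}{\rho}+\sqrt{\log\tfrac1\zeta+(\log T^6)^{d+1}}+\frac{\kappa}{\rho}\right).$$ 2.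 For an arbitrary decomposable kernel $k$, the same regret bound holds for any quadrature Fourier features with $\bar m=\lceil 6\log T\rceil$ nodes per coordinate and nonnegative weights, and every $\varepsilon\le A\,T^{-6}$ for which they are an $\varepsilon$-uniform approximation of $k$. -/

import Mathlib

open MeasureTheory ProbabilityTheory

universe u v

noncomputable section

/-! ### Stationary kernels with a decomposable Fourier transform -/

/-- The action domain `[0, 1]^d`. -/
abbrev UnitCube (d : ℕ) : Type := Set.Icc (0 : Fin d → ℝ) 1

/-- `k` is a stationary kernel on `ℝ^d`, bounded by `1`, whose Fourier transform (spectral density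
in Bochner's theorem) is the product `p(ω) = ∏ j, p_j(ω_j)`. -/
structure HasProductSpectralDensity {d : ℕ} (k : (Fin d → ℝ) → (Fin d → ℝ) → ℝ)
    (p : Fin d → ℝ → ℝ) : Prop where
  nonneg : ∀ j ω, 0 ≤ p j ω
  integrable : ∀ j, Integrable (p j)
  eq_integral : ∀ x y,
    k x y = ∫ ω : Fin d → ℝ, Real.cos (∑ j, ω j * (x j - y j)) * ∏ j, p j (ω j)
  le_one : ∀ x y, k x y ≤ 1

/-- The one-dimensional factors of the normalised Gaussian spectral density
`p(ω) ∝ exp (-∑ j, ω_j² ν_j² / 2)`; its kernel is the squared exponential kernel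
`exp (-∑ j, (x_j - y_j)² / (2 ν_j²))`. -/
def gaussianSpectralDensity {d : ℕ} (ν : Fin d → ℝ) (j : Fin d) (ω : ℝ) : ℝ :=
  ν j / √(2 * Real.pi) * Real.exp (-(ω ^ 2 * ν j ^ 2 / 2))

/-- The Hilbert function space `ℋ` on `[0, 1]^d` is the RKHS of the kernel `k`. -/
def IsRKHSOf {d : ℕ} (ℋ : Type v) [NormedAddCommGroup ℋ] [InnerProductSpace ℝ ℋ]
    [CompleteSpace ℋ] [RKHS ℝ ℋ (UnitCube d) ℝ] (k : (Fin d → ℝ) → (Fin d → ℝ) → ℝ) : Prop :=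
  ∀ x y : UnitCube d, RKHS.kernel ℋ x y 1 = k x y

/-- `sup_{x, y ∈ [0,1]^d} |k(x, y) - Φ(x)ᵀ Φ(y)| ≤ ε`. -/
def UniformlyApproximates {d : ℕ} {n : Type} [Fintype n] (Φ : (Fin d → ℝ) → n → ℝ)
    (k : (Fin d → ℝ) → (Fin d → ℝ) → ℝ) (ε : ℝ) : Prop :=
  ∀ x y : UnitCube d, |k x y - Φ x ⬝ᵥ Φ y| ≤ ε

/-! ### Quadrature Fourier features -/

/-- Index set of the features built from `M` nodes per coordinate: one cosine and one sine for each
point of the Cartesian product grid, hence `2 * M ^ d` features. -/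
abbrev QFFIndex (d M : ℕ) : Type := (Fin d → Fin M) ⊕ (Fin d → Fin M)

/-- Fourier features of a product quadrature rule which has, in coordinate `j`, the frequencies
`node j i` and the weights `weight j i`. -/
def quadratureFeatures {d M : ℕ} (node weight : Fin d → Fin M → ℝ) (x : Fin d → ℝ) :
    QFFIndex d M → ℝ :=
  Sum.elim
    (fun i => √(∏ j, weight j (i j)) * Real.cos (∑ j, node j (i j) * x j))
    (fun i => √(∏ j, weight j (i j)) * Real.sin (∑ j, node j (i j) * x j))

/-- The `i`-th smallest zero of the `M`-th (probabilists') Hermite polynomial. -/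
def hermiteNode (M : ℕ) (i : Fin M) : ℝ :=
  ((((Polynomial.hermite M).map (Int.castRingHom ℝ)).roots).sort (· ≤ ·)).getD i 0

/-- The Gauss-Hermite weight of that zero for the standard normal law,
`M! / (M² He_{M-1}(z)²)`. With the physicists' polynomials `H_n(u) = 2^(n/2) He_n(√2 u)` and
`z = √2 u` it is `(1/√π) * 2^(M-1) M! √π / (M² H_{M-1}(u)²)`. -/
def hermiteWeight (M : ℕ) (i : Fin M) : ℝ :=
  (M.factorial : ℝ) /
    ((M : ℝ) ^ 2 * (Polynomial.aeval (hermiteNode M i) (Polynomial.hermite (M - 1))) ^ 2)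

/-- Quadrature Fourier features with `M` Gauss-Hermite nodes per coordinate for the Gaussian
spectral density with parameters `ν`: frequencies `z / ν_j`. -/
def qff {d : ℕ} (ν : Fin d → ℝ) (M : ℕ) : (Fin d → ℝ) → QFFIndex d M → ℝ :=
  quadratureFeatures (fun j i => hermiteNode M i / ν j) (fun _ i => hermiteWeight M i)

/-! ### Maximum information gain -/

/-- Differential entropy `-∫ log (dμ/dx) dμ`. -/
def differentialEntropy {ι : Type} [Fintype ι] (μ : Measure (EuclideanSpace ℝ ι)) : ℝ :=
  -∫ z, Real.log (μ.rnDeriv volume z).toReal ∂μ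

/-- `H(y_A) - H(y_A | f)` for the points `A = (a_1, …, a_T)`, where `y_A = f_A + ε_A`,
`f_A ∼ N(0, K_A)` and, independently, `ε_A ∼ N(0, ρ² I)`. -/
def infoGain {d T : ℕ} (k : (Fin d → ℝ) → (Fin d → ℝ) → ℝ) (ρ : ℝ)
    (a : Fin T → UnitCube d) : ℝ :=
  let K : Matrix (Fin T) (Fin T) ℝ := Matrix.of fun i j => k (a i) (a j)
  let N : Matrix (Fin T) (Fin T) ℝ := ρ ^ 2 • 1
  differentialEntropy (multivariateGaussian 0 (K + N)) -
    ∫ z, differentialEntropy (multivariateGaussian z N) ∂(multivariateGaussian 0 K)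

/-- `γ_T`, the supremum of the information gain over sets of `T` distinct points. -/
def maxInfoGain {d : ℕ} (k : (Fin d → ℝ) → (Fin d → ℝ) → ℝ) (ρ : ℝ) (T : ℕ) : ℝ :=
  sSup {g | ∃ a : Fin T → UnitCube d, Function.Injective a ∧ g = infoGain k ρ a}

/-! ### Approximate GP-UCB with noisy features -/

/-- Numerical inputs of the algorithm: noise level `ρ`, regulariser `lam`, norm bound `B`,
approximation accuracy `ε`, spectral constants of the perturbations, failure probability `ζ`. -/
structure UCBParams where
  ρ : ℝ
  lam : ℝ
  B : ℝ
  ε : ℝ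
  lamMin : ℝ
  lamMax : ℝ
  κ : ℝ
  ζ : ℝ

section Algorithm

variable {d : ℕ} {n : Type} [Fintype n] [DecidableEq n]

/-- `‖w‖_S = √(wᵀ S w)`. -/
def ellNorm (S : Matrix n n ℝ) (w : n → ℝ) : ℝ := √(w ⬝ᵥ (S.mulVec w))

/-- `V_t = ∑_{τ < t} Φ(x_τ) Φ(x_τ)ᵀ + H_t + λ I`; rounds are numbered from `1`. -/
def ucbV (Φ : (Fin d → ℝ) → n → ℝ) (lam : ℝ) (x : ℕ → UnitCube d) (H : ℕ → Matrix n n ℝ)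
    (t : ℕ) : Matrix n n ℝ :=
  (∑ τ ∈ Finset.Ico 1 t, Matrix.vecMulVec (Φ (x τ)) (Φ (x τ))) + H t + lam • 1

/-- `θ̃_t = V_t⁻¹ (∑_{τ < t} y_τ Φ(x_τ) + h_t)`. -/
def ucbTheta (Φ : (Fin d → ℝ) → n → ℝ) (lam : ℝ) (x : ℕ → UnitCube d) (y : ℕ → ℝ)
    (H : ℕ → Matrix n n ℝ) (h : ℕ → n → ℝ) (t : ℕ) : n → ℝ :=
  (ucbV Φ lam x H t)⁻¹.mulVec ((∑ τ ∈ Finset.Ico 1 t, y τ • Φ (x τ)) + h t)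

/-- The exploration multiplier `β_t^{1/2}`. -/
def ucbBetaSqrt (par : UCBParams) (Φ : (Fin d → ℝ) → n → ℝ) (x : ℕ → UnitCube d)
    (H : ℕ → Matrix n n ℝ) (t : ℕ) : ℝ :=
  par.B * √(par.lamMax / par.ρ ^ 2 + 1)
    + t * par.B * par.ε / (par.ρ * √par.lamMin)
    + par.κ / par.ρ
    + √(Real.log ((par.lam + par.lamMin)⁻¹ • ucbV Φ par.lam x H t).det
        + 2 * Real.log (2 / par.ζ))

/-- The index `μ̃_t(a) + β_t^{1/2} σ̃_t(a)`, with `μ̃_t(a) = ⟨θ̃_t, Φ(a)⟩` and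
`σ̃_t(a) = ρ ‖Φ(a)‖_{V_t⁻¹}`. -/
def ucbIndex (par : UCBParams) (Φ : (Fin d → ℝ) → n → ℝ) (x : ℕ → UnitCube d) (y : ℕ → ℝ)
    (H : ℕ → Matrix n n ℝ) (h : ℕ → n → ℝ) (t : ℕ) (a : UnitCube d) : ℝ :=
  ucbTheta Φ par.lam x y H h t ⬝ᵥ Φ a
    + ucbBetaSqrt par Φ x H t * (par.ρ * ellNorm (ucbV Φ par.lam x H t)⁻¹ (Φ a))

/-- The constants `lamMin`, `lamMax`, `κ` are `δ`-accurate for the perturbations `H_t`, `h_t`: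
outside an event of probability at most `δ`, for all `t ∈ {1, …, T}`, `H_t` is invertible,
`‖H_t‖ ≤ lamMax`, `‖H_t⁻¹‖ ≤ 1 / lamMin` (spectral norms) and `‖h_t‖_{H_t⁻¹} ≤ κ`. -/
def AreAccurate {Ω : Type u} [MeasurableSpace Ω] (P : Measure Ω) (T : ℕ)
    (H : ℕ → Ω → Matrix n n ℝ) (h : ℕ → Ω → n → ℝ) (lamMin lamMax κ δ : ℝ) : Prop :=
  0 < lamMin ∧ lamMin ≤ lamMax ∧
    P {ω | ¬ ∀ t ∈ Finset.Icc 1 T, IsUnit (H t ω).det ∧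
      ‖Matrix.toEuclideanCLM (𝕜 := ℝ) (H t ω)‖ ≤ lamMax ∧
      ‖Matrix.toEuclideanCLM (𝕜 := ℝ) (H t ω)⁻¹‖ ≤ 1 / lamMin ∧
      ellNorm (H t ω)⁻¹ (h t ω) ≤ κ} ≤ ENNReal.ofReal δ

/-- A `T`-round run of the algorithm on the reward function `f`: decision sets `𝒟_t`, actions `x_t`,
reward noise `η_t` (so `y_t = f(x_t) + η_t`), perturbations `H_t`, `h_t`. The σ-algebra `ℱ_{t-1}`
is the information available when `x_t` is chosen. -/
structure IsGPUCBRun {Ω : Type u} [mΩ : MeasurableSpace Ω] (P : Measure Ω)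
    (ℱ : Filtration ℕ mΩ) (par : UCBParams) (Φ : (Fin d → ℝ) → n → ℝ) (f : UnitCube d → ℝ)
    (T : ℕ) (𝒟 : ℕ → Ω → Set (UnitCube d)) (x : ℕ → Ω → UnitCube d) (η : ℕ → Ω → ℝ)
    (H : ℕ → Ω → Matrix n n ℝ) (h : ℕ → Ω → n → ℝ) : Prop where
  measurable_action : ∀ t ∈ Finset.Icc 1 T, Measurable[ℱ (t - 1)] (x t)
  measurable_H : ∀ t ∈ Finset.Icc 1 T, ∀ i j, Measurable[ℱ (t - 1)] fun ω => H t ω i j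
  measurable_h : ∀ t ∈ Finset.Icc 1 T, ∀ i, Measurable[ℱ (t - 1)] fun ω => h t ω i
  measurable_noise : ∀ t ∈ Finset.Icc 1 T, Measurable[ℱ t] (η t)
  integrable_exp_noise : ∀ t ∈ Finset.Icc 1 T, ∀ s : ℝ,
    Integrable (fun ω => Real.exp (s * η t ω)) P
  /-- The noise is conditionally centred `ρ`-sub-Gaussian. -/
  subgaussian_noise : ∀ t ∈ Finset.Icc 1 T, ∀ s : ℝ,
    P[fun ω => Real.exp (s * η t ω) | ℱ (t - 1)] ≤ᵐ[P]
      fun _ => Real.exp (par.ρ ^ 2 * s ^ 2 / 2)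
  posSemidef_H : ∀ᵐ ω ∂P, ∀ t ∈ Finset.Icc 1 T, (H t ω).PosSemidef
  action_mem : ∀ᵐ ω ∂P, ∀ t ∈ Finset.Icc 1 T, x t ω ∈ 𝒟 t ω
  action_argmax : ∀ᵐ ω ∂P, ∀ t ∈ Finset.Icc 1 T,
    IsMaxOn (ucbIndex par Φ (fun τ => x τ ω) (fun τ => f (x τ ω) + η τ ω)
      (fun τ => H τ ω) (fun τ => h τ ω) t) (𝒟 t ω) (x t ω)

end Algorithm

/-- `∑_{t = 1}^T (sup_{a ∈ 𝒟_t} f(a) - f(x_t))`. -/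
def cumulativeRegret {d : ℕ} {Ω : Type u} (f : UnitCube d → ℝ) (T : ℕ)
    (𝒟 : ℕ → Ω → Set (UnitCube d)) (x : ℕ → Ω → UnitCube d) (ω : Ω) : ℝ :=
  ∑ t ∈ Finset.Icc 1 T, (sSup (f '' 𝒟 t ω) - f (x t ω))

/-- The number `⌈6 log T⌉` of quadrature nodes per coordinate. -/
def numNodes (T : ℕ) : ℕ := ⌈6 * Real.log T⌉₊

/-- With constant `C`, every `T`-round run of the algorithm with features `Φ`, on every `f` with
`‖f‖_k ≤ B`, every choice of decision sets, and every choice of perturbations with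
`ζ/(2T)`-accurate constants `lamMin ≥ lam₀`, `lamMax`, `κ`, obeys the regret bound with
probability at least `1 - ζ`. -/
def RegretGuarantee {d : ℕ} {n : Type} [Fintype n] [DecidableEq n]
    (C ρ lam B lam₀ ε : ℝ) (k : (Fin d → ℝ) → (Fin d → ℝ) → ℝ) (T : ℕ)
    (Φ : (Fin d → ℝ) → n → ℝ) : Prop :=
  ∀ (ℋ : Type v) [NormedAddCommGroup ℋ] [InnerProductSpace ℝ ℋ] [CompleteSpace ℋ]
    [RKHS ℝ ℋ (UnitCube d) ℝ], IsRKHSOf ℋ k → ∀ f : ℋ, ‖f‖ ≤ B →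
  ∀ (Ω : Type u) [mΩ : MeasurableSpace Ω] (P : Measure Ω) [IsProbabilityMeasure P]
    (ℱ : Filtration ℕ mΩ) (lamMin lamMax κ ζ : ℝ)
    (𝒟 : ℕ → Ω → Set (UnitCube d)) (x : ℕ → Ω → UnitCube d) (η : ℕ → Ω → ℝ)
    (H : ℕ → Ω → Matrix n n ℝ) (h : ℕ → Ω → n → ℝ),
    0 < ζ → ζ < 1 → lam₀ ≤ lamMin →
    AreAccurate P T H h lamMin lamMax κ (ζ / (2 * T)) →
    IsGPUCBRun P ℱ ⟨ρ, lam, B, ε, lamMin, lamMax, κ, ζ⟩ Φ f T 𝒟 x η H h →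
    P {ω | ¬ cumulativeRegret f T 𝒟 x ω ≤
        C * (√(T * maxInfoGain k ρ T) *
          (B * √lamMax / ρ + √(Real.log (1 / ζ) + Real.log ((T : ℝ) ^ 6) ^ (d + 1)) + κ / ρ))}
      ≤ ENNReal.ofReal ζ

end

/-! ### Quadratic forms of positive definite matrices -/

section QuadraticForms

open Matrix

variable {n : Type*} [Fintype n]

/-! With probability at least 1 - ζ the perturbations obey their bounds and the noise obeys a
self-normalized inequality (`measure_not_selfNormalized_le`); the rest is deterministic. On that
event, any θ of norm at most B that nearly interpolates f at the points played is close to the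
estimate in the V_t-norm: within ρ β_t^{1/2} plus a misspecification error
(`abs_sub_ucbTheta_dotProduct_le`). Such a θ exists for any finite set of points, by ridge
regression on the features (`exists_weights_of_features`). The noise event does not mention θ, so θ
may be chosen afresh for each round and each competing action. Optimism then bounds the regret of a
round by twice the width at x_t plus an error proportional to √ε (`instantaneous_regret_le`).

Cauchy-Schwarz reduces the sum of the widths to the elliptical potential, a log-determinant. It is
moved from feature space to the T × T Gram matrix, compared there with the kernel matrix, and
recognised as twice an information gain (`infoGain_eq_log_det`, `sum_sq_ellNorm_le`). The algorithm
may repeat points while γ_T ranges over distinct ones; continuity closes this gap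
(`log_det_le_maxInfoGain`).

The multiplier is governed by the number of features, of order (log T)^d, times a logarithm; this
gives (log T⁶)^(d+1) (`ucbBetaSqrt_le`). The additive errors are absorbed because γ_T ≥ 1 for large
T if k(0,0) > 0. If k(0,0) = 0, every function of the RKHS vanishes and so does the regret.

For Gaussian spectral densities, Gauss-Hermite quadrature integrates polynomials of degree below 2M
exactly, so its characteristic function differs from exp(-δ²/2) only by two Taylor remainders of
size (δ²/2)^M / M! (`norm_hermiteCharFun_sub_le`). With M ≥ 6 log T the factorial beats every
geometric factor, including e^M ≥ T⁶. -/

theorem Matrix.PosSemidef.quadForm_nonneg {S : Matrix n n ℝ} (hS : S.PosSemidef) (a : n → ℝ) :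
    0 ≤ a ⬝ᵥ S *ᵥ a := by
  simpa using hS.dotProduct_mulVec_nonneg a

theorem Matrix.posSemidef_of_quadForm_nonneg {S : Matrix n n ℝ} (hS : S.IsSymm)
    (h : ∀ a, 0 ≤ a ⬝ᵥ S *ᵥ a) : S.PosSemidef := by
  refine .of_dotProduct_mulVec_nonneg (by simpa [IsHermitian, IsSymm] using hS) fun a => ?_
  simpa using h a

theorem Matrix.IsHermitian.dotProduct_mulVec_comm {S : Matrix n n ℝ} (hS : S.IsHermitian)
    (a b : n → ℝ) : a ⬝ᵥ S *ᵥ b = b ⬝ᵥ S *ᵥ a := by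
  rw [dotProduct_mulVec, ← mulVec_transpose, dotProduct_comm]
  congr 2

/-- Cauchy-Schwarz: the form at a + t b is a nonnegative quadratic in t, so its discriminant is at
most zero. -/
theorem Matrix.PosSemidef.sq_dotProduct_mulVec_le {S : Matrix n n ℝ} (hS : S.PosSemidef)
    (a b : n → ℝ) : (a ⬝ᵥ S *ᵥ b) ^ 2 ≤ (a ⬝ᵥ S *ᵥ a) * (b ⬝ᵥ S *ᵥ b) := by
  have key : ∀ t : ℝ, 0 ≤ (b ⬝ᵥ S *ᵥ b) * (t * t) + (2 * (a ⬝ᵥ S *ᵥ b)) * t + a ⬝ᵥ S *ᵥ a := by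
    intro t
    have h := hS.quadForm_nonneg (a + t • b)
    simp only [mulVec_add, mulVec_smul, dotProduct_add, add_dotProduct, smul_dotProduct,
      dotProduct_smul, smul_eq_mul, hS.1.dotProduct_mulVec_comm b a] at h
    linarith
  have h := discrim_le_zero key
  rw [discrim] at h
  nlinarith

theorem Matrix.posSemidef_vecMulVec_self (a : n → ℝ) : (vecMulVec a a).PosSemidef := by
  simpa using posSemidef_vecMulVec_self_star a

theorem Matrix.dotProduct_vecMulVec_mulVec (a b : n → ℝ) :
    a ⬝ᵥ vecMulVec b b *ᵥ a = (b ⬝ᵥ a) ^ 2 := by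
  rw [vecMulVec_mulVec]
  simp [dotProduct_comm a b, sq]

theorem Matrix.dotProduct_self_nonneg' (a : n → ℝ) : 0 ≤ a ⬝ᵥ a :=
  Finset.sum_nonneg fun i _ => mul_self_nonneg (a i)

theorem Matrix.PosDef.add_vecMulVec {W : Matrix n n ℝ} (hW : W.PosDef) (a : n → ℝ) :
    (W + vecMulVec a a).PosDef :=
  hW.add_posSemidef (posSemidef_vecMulVec_self a)

variable [DecidableEq n]

theorem Matrix.posDef_smul_one {m : Type*} [DecidableEq m] {c : ℝ} (hc : 0 < c) :
    (c • (1 : Matrix m m ℝ)).PosDef :=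
  PosDef.one.smul hc

theorem Matrix.PosDef.mulVec_inv_mulVec {W : Matrix n n ℝ} (hW : W.PosDef) (a : n → ℝ) :
    W *ᵥ (W⁻¹ *ᵥ a) = a := by
  rw [mulVec_mulVec, mul_nonsing_inv _ hW.det_pos.ne'.isUnit, one_mulVec]

theorem Matrix.PosDef.inv_mulVec_mulVec {W : Matrix n n ℝ} (hW : W.PosDef) (a : n → ℝ) :
    W⁻¹ *ᵥ (W *ᵥ a) = a := by
  rw [mulVec_mulVec, nonsing_inv_mul _ hW.det_pos.ne'.isUnit, one_mulVec]

theorem Matrix.PosDef.quadForm_inv_nonneg {W : Matrix n n ℝ} (hW : W.PosDef) (a : n → ℝ) :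
    0 ≤ a ⬝ᵥ W⁻¹ *ᵥ a :=
  hW.inv.posSemidef.quadForm_nonneg a

/-- Duality of the norms of W and W⁻¹: Cauchy-Schwarz for W, applied to a and W⁻¹ b. -/
theorem Matrix.PosDef.sq_dotProduct_le {W : Matrix n n ℝ} (hW : W.PosDef) (a b : n → ℝ) :
    (a ⬝ᵥ b) ^ 2 ≤ (a ⬝ᵥ W *ᵥ a) * (b ⬝ᵥ W⁻¹ *ᵥ b) := by
  have h := hW.posSemidef.sq_dotProduct_mulVec_le a (W⁻¹ *ᵥ b)
  rwa [hW.mulVec_inv_mulVec, dotProduct_comm (W⁻¹ *ᵥ b) b] at h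

/-- The quadratic form of the inverse is antitone in the Loewner order. -/
theorem Matrix.PosDef.quadForm_inv_antitone {W V : Matrix n n ℝ} (hW : W.PosDef) (hV : V.PosDef)
    (h : (V - W).PosSemidef) (a : n → ℝ) : a ⬝ᵥ V⁻¹ *ᵥ a ≤ a ⬝ᵥ W⁻¹ *ᵥ a := by
  -- Duality gives (b · a)² ≤ (bᵀ W b)(aᵀ W⁻¹ a), and bᵀ W b ≤ bᵀ V b = b · a; it remains to divide
  -- by b · a.
  set b := V⁻¹ *ᵥ a
  have h1 := hW.sq_dotProduct_le b a
  have h2 : b ⬝ᵥ W *ᵥ b ≤ b ⬝ᵥ a := by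
    have h3 := h.quadForm_nonneg b
    rw [sub_mulVec, dotProduct_sub, hV.mulVec_inv_mulVec a] at h3
    linarith
  have h4 : 0 ≤ a ⬝ᵥ b := hV.quadForm_inv_nonneg a
  have h5 := hW.quadForm_inv_nonneg a
  rw [dotProduct_comm b a] at h1 h2
  rcases h4.eq_or_lt with h6 | h6
  · rw [← h6]; exact h5
  · have := h1.trans (mul_le_mul_of_nonneg_right h2 h5)
    nlinarith

theorem Matrix.PosSemidef.one_le_det_one_add {P : Matrix n n ℝ} (hP : P.PosSemidef) :
    1 ≤ (1 + P).det := by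
  have h1 := hP.1.spectral_theorem
  set U : Matrix n n ℝ := (hP.1.eigenvectorUnitary : Matrix n n ℝ)
  have hU : U * star U = 1 := Unitary.coe_mul_star_self hP.1.eigenvectorUnitary
  have h2 : 1 + P = U * (diagonal fun i => 1 + hP.1.eigenvalues i) * star U := by
    have : (diagonal fun i => 1 + hP.1.eigenvalues i) = 1 + diagonal hP.1.eigenvalues := by
      rw [← diagonal_one, diagonal_add]
    rw [this, mul_add, add_mul, mul_one, hU]
    conv_lhs => rw [h1]
    simp [Unitary.conjStarAlgAut_apply, U]
  rw [h2, det_mul_right_comm, hU, one_mul, det_diagonal]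
  exact Finset.one_le_prod fun i => by simpa using hP.eigenvalues_nonneg i

/-- Write W = Bᴴ B with B invertible and pull B out on both sides: W + P is congruent to 1 plus a
semidefinite matrix, whose determinant is at least 1. -/
theorem Matrix.PosDef.det_le_det_add {W P : Matrix n n ℝ} (hW : W.PosDef) (hP : P.PosSemidef) :
    W.det ≤ (W + P).det := by
  obtain ⟨B, hB⟩ : ∃ B : Matrix n n ℝ, W = Bᴴ * B := by
    open scoped MatrixOrder in
    exact CStarAlgebra.nonneg_iff_eq_star_mul_self.mp hW.posSemidef.nonneg
  have hdet : W.det = B.det ^ 2 := by rw [hB, det_mul, det_conjTranspose]; simp [sq]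
  have hu : IsUnit B.det := by
    refine isUnit_iff_ne_zero.2 fun h => hW.det_pos.ne' ?_
    rw [hdet, h]; simp
  have h1 : W + P = Bᴴ * (1 + (B⁻¹)ᴴ * P * B⁻¹) * B := by
    rw [mul_add, add_mul, mul_one, ← hB]
    congr 1
    calc P = (B⁻¹ * B)ᴴ * P * (B⁻¹ * B) := by rw [nonsing_inv_mul _ hu]; simp
      _ = _ := by rw [conjTranspose_mul]; simp only [Matrix.mul_assoc]
  have h2 : (W + P).det = W.det * (1 + (B⁻¹)ᴴ * P * B⁻¹).det := by
    rw [h1, det_mul, det_mul, hdet, det_conjTranspose]; simp; ring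
  rw [h2]
  exact le_mul_of_one_le_right hW.det_pos.le (hP.conjTranspose_mul_mul_same _).one_le_det_one_add

theorem Matrix.PosDef.det_mono {W V : Matrix n n ℝ} (hW : W.PosDef) (h : (V - W).PosSemidef) :
    W.det ≤ V.det := by
  simpa using hW.det_le_det_add h

theorem Matrix.PosDef.log_det_mono {W V : Matrix n n ℝ} (hW : W.PosDef) (h : (V - W).PosSemidef) :
    Real.log W.det ≤ Real.log V.det :=
  Real.log_le_log hW.det_pos (hW.det_mono h)

theorem Matrix.PosDef.det_add_vecMulVec {W : Matrix n n ℝ} (hW : W.PosDef) (a : n → ℝ) :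
    (W + vecMulVec a a).det = W.det * (1 + a ⬝ᵥ W⁻¹ *ᵥ a) := by
  have h := det_add_replicateCol_mul_replicateRow (ι := Unit) hW.det_pos.ne'.isUnit a a
  have h2 : replicateCol Unit a * replicateRow Unit a = vecMulVec a a := by
    ext i j; simp [mul_apply, vecMulVec_apply]
  rw [h2] at h
  rw [h]
  congr 1
  simp [det_unique, mul_apply, dotProduct, mulVec, Finset.sum_mul, Finset.mul_sum]
  rw [Finset.sum_comm]
  simp [mul_assoc]

/-- Rank one update of the quadratic form of the inverse (Sherman-Morrison). -/
theorem Matrix.PosDef.quadForm_inv_add_vecMulVec {W : Matrix n n ℝ} (hW : W.PosDef)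
    (a z : n → ℝ) :
    z ⬝ᵥ (W + vecMulVec a a)⁻¹ *ᵥ z =
      z ⬝ᵥ W⁻¹ *ᵥ z - (a ⬝ᵥ W⁻¹ *ᵥ z) ^ 2 / (1 + a ⬝ᵥ W⁻¹ *ᵥ a) := by
  have hu : 1 + a ⬝ᵥ W⁻¹ *ᵥ a ≠ 0 := by have := hW.quadForm_inv_nonneg a; positivity
  -- The Sherman-Morrison candidate for the solution of (W + a aᵀ) y = z, checked by multiplying
  -- out.
  set y := W⁻¹ *ᵥ z - ((a ⬝ᵥ W⁻¹ *ᵥ z) / (1 + a ⬝ᵥ W⁻¹ *ᵥ a)) • (W⁻¹ *ᵥ a) with hy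
  have h1 : (W + vecMulVec a a) *ᵥ y = z := by
    rw [hy, add_mulVec, mulVec_sub, mulVec_smul, hW.mulVec_inv_mulVec, hW.mulVec_inv_mulVec,
      vecMulVec_mulVec]
    ext i
    simp [dotProduct_sub, dotProduct_smul]
    field_simp
    ring
  have h2 : (W + vecMulVec a a)⁻¹ *ᵥ z = y := by
    rw [← h1, (hW.add_vecMulVec a).inv_mulVec_mulVec]
  rw [h2, hy, dotProduct_sub, dotProduct_smul, hW.inv.1.dotProduct_mulVec_comm z a, smul_eq_mul]
  ring

theorem Matrix.quadForm_inv_smul_one {c : ℝ} (hc : 0 < c) (a : n → ℝ) :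
    a ⬝ᵥ (c • (1 : Matrix n n ℝ))⁻¹ *ᵥ a = (a ⬝ᵥ a) / c := by
  have h : (c • (1 : Matrix n n ℝ))⁻¹ *ᵥ a = c⁻¹ • a := by
    have := (posDef_smul_one (m := n) hc).inv_mulVec_mulVec (c⁻¹ • a)
    rw [smul_mulVec, one_mulVec, smul_smul, mul_inv_cancel₀ hc.ne', one_smul] at this
    exact this
  rw [h, dotProduct_smul, smul_eq_mul]
  field_simp

/-- A quadratic form bounded below by `c ‖·‖²` has inverse form bounded above by `‖·‖² / c`. -/
theorem Matrix.PosDef.quadForm_inv_le_div {V : Matrix n n ℝ} (hV : V.PosDef) {c : ℝ} (hc : 0 < c)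
    (h : (V - c • 1).PosSemidef) (a : n → ℝ) : a ⬝ᵥ V⁻¹ *ᵥ a ≤ (a ⬝ᵥ a) / c := by
  rw [← quadForm_inv_smul_one hc]
  exact (posDef_smul_one hc).quadForm_inv_antitone hV h a

end QuadraticForms

/-! ### The seminorms `ellNorm` -/

section EllNorm

open Matrix

variable {n : Type} [Fintype n]

theorem ellNorm_nonneg (S : Matrix n n ℝ) (a : n → ℝ) : 0 ≤ ellNorm S a := Real.sqrt_nonneg _

theorem sq_ellNorm {S : Matrix n n ℝ} (hS : S.PosSemidef) (a : n → ℝ) :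
    ellNorm S a ^ 2 = a ⬝ᵥ S *ᵥ a :=
  Real.sq_sqrt (hS.quadForm_nonneg a)

theorem ellNorm_add_le {S : Matrix n n ℝ} (hS : S.PosSemidef) (a b : n → ℝ) :
    ellNorm S (a + b) ≤ ellNorm S a + ellNorm S b := by
  refine Real.sqrt_le_iff.2 ⟨add_nonneg (ellNorm_nonneg _ _) (ellNorm_nonneg _ _), ?_⟩
  have h1 : a ⬝ᵥ S *ᵥ b ≤ ellNorm S a * ellNorm S b := by
    rw [ellNorm, ellNorm, ← Real.sqrt_mul (hS.quadForm_nonneg a)]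
    exact Real.le_sqrt_of_sq_le (hS.sq_dotProduct_mulVec_le a b)
  rw [add_sq, sq_ellNorm hS, sq_ellNorm hS, mulVec_add, dotProduct_add, add_dotProduct,
    add_dotProduct, hS.1.dotProduct_mulVec_comm b a]
  linarith

theorem ellNorm_smul (S : Matrix n n ℝ) (c : ℝ) (a : n → ℝ) :
    ellNorm S (c • a) = |c| * ellNorm S a := by
  rw [ellNorm, ellNorm, mulVec_smul, dotProduct_smul, smul_dotProduct, smul_smul, smul_eq_mul,
    ← sq, Real.sqrt_mul (sq_nonneg c), Real.sqrt_sq_eq_abs]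

theorem ellNorm_zero (S : Matrix n n ℝ) : ellNorm S (0 : n → ℝ) = 0 := by simp [ellNorm]

theorem ellNorm_neg (S : Matrix n n ℝ) (a : n → ℝ) : ellNorm S (-a) = ellNorm S a := by
  simpa using ellNorm_smul S (-1) a

theorem ellNorm_sum_le {S : Matrix n n ℝ} (hS : S.PosSemidef) {ι : Type*} (s : Finset ι)
    (a : ι → n → ℝ) : ellNorm S (∑ i ∈ s, a i) ≤ ∑ i ∈ s, ellNorm S (a i) := by
  classical
  induction s using Finset.induction_on with
  | empty => simp [ellNorm_zero]
  | insert i s hi ih =>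
    rw [Finset.sum_insert hi, Finset.sum_insert hi]
    exact (ellNorm_add_le hS _ _).trans (by gcongr)

variable [DecidableEq n]

theorem abs_dotProduct_le_ellNorm {W : Matrix n n ℝ} (hW : W.PosDef) (a b : n → ℝ) :
    |a ⬝ᵥ b| ≤ ellNorm W a * ellNorm W⁻¹ b := by
  rw [ellNorm, ellNorm, ← Real.sqrt_mul (hW.posSemidef.quadForm_nonneg a)]
  exact Real.abs_le_sqrt (hW.sq_dotProduct_le a b)

theorem ellNorm_inv_antitone {W V : Matrix n n ℝ} (hW : W.PosDef) (hV : V.PosDef)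
    (h : (V - W).PosSemidef) (a : n → ℝ) : ellNorm V⁻¹ a ≤ ellNorm W⁻¹ a :=
  Real.sqrt_le_sqrt (hW.quadForm_inv_antitone hV h a)

theorem ellNorm_inv_mulVec {W : Matrix n n ℝ} (hW : W.PosDef) (a : n → ℝ) :
    ellNorm W⁻¹ (W *ᵥ a) = ellNorm W a := by
  rw [ellNorm, ellNorm, hW.inv_mulVec_mulVec, dotProduct_comm]

end EllNorm

/-! ### Interpolating a function by features at finitely many points -/

section Interpolation

open Matrix

variable {n : Type*} [Fintype n] {N : ℕ}

theorem sq_sum_abs_le_card_mul (c : Fin N → ℝ) : (∑ i, |c i|) ^ 2 ≤ N * (c ⬝ᵥ c) := by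
  have h := sq_sum_le_card_mul_sum_sq (s := (Finset.univ : Finset (Fin N))) (f := fun i => |c i|)
  simpa [dotProduct, sq] using h

/-- Since (∑ |c_i|)² ≤ N ‖c‖², an entrywise error ε costs at most N ε in the Loewner order. -/
theorem quadForm_le_of_abs_le {E : Matrix (Fin N) (Fin N) ℝ} {ε : ℝ} (h : ∀ i j, |E i j| ≤ ε)
    (c : Fin N → ℝ) (hε : 0 ≤ ε) : |c ⬝ᵥ E *ᵥ c| ≤ N * ε * (c ⬝ᵥ c) := by
  calc |c ⬝ᵥ E *ᵥ c| = |∑ i, ∑ j, c i * (E i j * c j)| := by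
        simp [dotProduct, mulVec, Finset.mul_sum]
    _ ≤ ∑ i, ∑ j, |c i| * |c j| * ε := by
        refine (Finset.abs_sum_le_sum_abs _ _).trans (Finset.sum_le_sum fun i _ => ?_)
        refine (Finset.abs_sum_le_sum_abs _ _).trans (Finset.sum_le_sum fun j _ => ?_)
        rw [abs_mul, abs_mul]
        have := mul_le_mul_of_nonneg_left (h i j) (mul_nonneg (abs_nonneg (c i)) (abs_nonneg (c j)))
        linarith
    _ = (∑ i, |c i|) ^ 2 * ε := by
        rw [sq, Finset.sum_mul_sum, Finset.sum_mul]
        simp_rw [Finset.sum_mul]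
    _ ≤ N * ε * (c ⬝ᵥ c) := by
        have := mul_le_mul_of_nonneg_right (sq_sum_abs_le_card_mul c) hε
        linarith

/-- A vector `F` of function values which is dominated by a kernel matrix is almost interpolated
by features approximating that kernel. -/
theorem exists_weights_of_features {K : Matrix (Fin N) (Fin N) ℝ} (φ : Fin N → n → ℝ)
    (F : Fin N → ℝ) {B ε : ℝ} (hB : 0 ≤ B) (hε : 0 < ε)
    (hK : ∀ i j, |K i j - φ i ⬝ᵥ φ j| ≤ ε)
    (hF : ∀ c : Fin N → ℝ, (c ⬝ᵥ F) ^ 2 ≤ B ^ 2 * (c ⬝ᵥ K *ᵥ c)) :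
    ∃ θ : n → ℝ, θ ⬝ᵥ θ ≤ B ^ 2 ∧ ∀ i, |F i - θ ⬝ᵥ φ i| ≤ B * √(N * ε) := by
  rcases Nat.eq_zero_or_pos N with rfl | hN
  · exact ⟨0, by simpa using sq_nonneg B, fun i => i.elim0⟩
  set Φ : Matrix (Fin N) n ℝ := Matrix.of φ with hΦ
  -- The ridge parameter is the Loewner size of K - Φ Φᵀ, so K ≤ μ + Φ Φᵀ = M. The weights are θ =
  -- Φᵀ M⁻¹ F.
  set μ : ℝ := N * ε with hμ
  have hμ0 : 0 < μ := by positivity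
  set M : Matrix (Fin N) (Fin N) ℝ := μ • 1 + Φ * Φᵀ with hMdef
  have hM : M.PosDef := (posDef_smul_one hμ0).add_posSemidef
    (by simpa using posSemidef_self_mul_conjTranspose Φ)
  set w := M⁻¹ *ᵥ F with hw
  have hMw : M *ᵥ w = F := hM.mulVec_inv_mulVec F
  have hquad : w ⬝ᵥ F = μ * (w ⬝ᵥ w) + (Φᵀ *ᵥ w) ⬝ᵥ (Φᵀ *ᵥ w) := by
    conv_lhs => rw [← hMw]
    rw [hMdef, add_mulVec, dotProduct_add, smul_mulVec, one_mulVec, dotProduct_smul, smul_eq_mul,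
      ← mulVec_mulVec, dotProduct_mulVec w Φ, ← mulVec_transpose]
  have hKw : w ⬝ᵥ K *ᵥ w ≤ w ⬝ᵥ F := by
    have h1 := quadForm_le_of_abs_le (E := K - Φ * Φᵀ) (ε := ε)
      (fun i j => by simpa [hΦ, mul_apply, dotProduct] using hK i j) w hε.le
    have h2 := (abs_le.1 h1).2
    rw [sub_mulVec, dotProduct_sub, ← mulVec_mulVec, dotProduct_mulVec w Φ, ← mulVec_transpose]
      at h2
    linarith
  -- A self-bounding argument: (w · F)² ≤ B² wᵀ K w ≤ B² (w · F). As w · F = μ ‖w‖² + ‖θ‖², this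
  -- controls both the norm of θ and the residuals μ w_i.
  have hwF : w ⬝ᵥ F ≤ B ^ 2 := by
    have h0 : 0 ≤ w ⬝ᵥ F := by
      rw [hquad]; have := dotProduct_self_nonneg' w; have := dotProduct_self_nonneg' (Φᵀ *ᵥ w)
      positivity
    have h1 := (hF w).trans (mul_le_mul_of_nonneg_left hKw (sq_nonneg B))
    rcases h0.eq_or_lt with h | h
    · rw [← h]; positivity
    · nlinarith
  refine ⟨Φᵀ *ᵥ w, ?_, fun i => ?_⟩
  · have := mul_nonneg hμ0.le (dotProduct_self_nonneg' w); linarith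
  · have h1 : F i - (Φᵀ *ᵥ w) ⬝ᵥ φ i = μ * w i := by
      have h2 := congrFun hMw i
      rw [hMdef, add_mulVec, smul_mulVec, one_mulVec, ← mulVec_mulVec] at h2
      have h3 : (Φ *ᵥ (Φᵀ *ᵥ w)) i = (Φᵀ *ᵥ w) ⬝ᵥ φ i := by
        rw [dotProduct_comm]; rfl
      simp only [Pi.add_apply, Pi.smul_apply, smul_eq_mul] at h2
      linarith
    have h4 : w i ^ 2 ≤ w ⬝ᵥ w := by
      have := Finset.single_le_sum (f := fun j => w j * w j)
        (fun j _ => mul_self_nonneg (w j)) (Finset.mem_univ i)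
      simpa [sq, dotProduct] using this
    rw [h1]
    refine abs_le_of_sq_le_sq ?_ (by positivity)
    rw [mul_pow, mul_pow B, Real.sq_sqrt hμ0.le]
    have h5 := dotProduct_self_nonneg' (Φᵀ *ᵥ w)
    nlinarith [mul_le_mul_of_nonneg_left h4 hμ0.le]

end Interpolation

/-! ### Differential entropy of Gaussian measures -/

section Entropy

open Matrix Module
open scoped MatrixOrder

variable {ι : Type} [Fintype ι]

/-- The Lebesgue density of the standard Gaussian measure. -/
noncomputable def stdGaussianPDF (x : EuclideanSpace ℝ ι) : ℝ :=
  ((2 * Real.pi) ^ (finrank ℝ (EuclideanSpace ℝ ι) / 2 : ℝ))⁻¹ * Real.exp (-(1 / 2) * ‖x‖ ^ 2)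

theorem stdGaussianPDF_pos (x : EuclideanSpace ℝ ι) : 0 < stdGaussianPDF x := by
  unfold stdGaussianPDF; positivity

theorem measurable_stdGaussianPDF : Measurable (stdGaussianPDF (ι := ι)) := by
  unfold stdGaussianPDF; fun_prop

theorem integrable_stdGaussianPDF : Integrable (stdGaussianPDF (ι := ι)) := by
  have h := (GaussianFourier.integrable_cexp_neg_mul_sq_norm_add (V := EuclideanSpace ℝ ι)
    (b := (1 / 2 : ℂ)) (by norm_num) 0 0).norm
  refine Integrable.const_mul ?_ _
  refine h.congr (ae_of_all _ fun x => ?_)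
  simp [Complex.norm_exp, ← Complex.ofReal_pow]

/-- Both sides are finite measures with the same characteristic function, by the Gaussian Fourier
integral. -/
theorem stdGaussian_eq_withDensity : stdGaussian (EuclideanSpace ℝ ι) =
    volume.withDensity fun x => ENNReal.ofReal (stdGaussianPDF x) := by
  have hfin : IsFiniteMeasure ((volume : Measure (EuclideanSpace ℝ ι)).withDensity
      fun x => ENNReal.ofReal (stdGaussianPDF x)) :=
    isFiniteMeasure_withDensity_ofReal integrable_stdGaussianPDF.2
  refine Measure.ext_of_charFun (funext fun t => ?_)
  rw [charFun_stdGaussian, charFun_apply,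
    integral_withDensity_eq_integral_toReal_smul measurable_stdGaussianPDF.ennreal_ofReal
      (ae_of_all _ fun _ => ENNReal.ofReal_lt_top)]
  have h := GaussianFourier.integral_cexp_neg_mul_sq_norm_add (V := EuclideanSpace ℝ ι)
    (b := (1 / 2 : ℂ)) (by norm_num) Complex.I t
  have hc : ((((2 * Real.pi) ^ (finrank ℝ (EuclideanSpace ℝ ι) / 2 : ℝ) : ℝ))  : ℂ) =
      (Real.pi / (1 / 2 : ℂ)) ^ (finrank ℝ (EuclideanSpace ℝ ι) / 2 : ℂ) := by
    rw [Complex.ofReal_cpow (by positivity)]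
    push_cast
    congr 1
    ring
  have hc0 : ((2 * Real.pi) ^ (finrank ℝ (EuclideanSpace ℝ ι) / 2 : ℝ) : ℝ) ≠ 0 := by positivity
  calc Complex.exp (-(‖t‖ : ℂ) ^ 2 / 2)
      = ((((2 * Real.pi) ^ (finrank ℝ (EuclideanSpace ℝ ι) / 2 : ℝ) : ℝ))  : ℂ)⁻¹ *
        ∫ v : EuclideanSpace ℝ ι,
          Complex.exp (-(1 / 2 : ℂ) * (‖v‖ : ℂ) ^ 2 + Complex.I * (inner ℝ t v : ℝ)) := by
        rw [h, hc, ← mul_assoc, inv_mul_cancel₀, one_mul]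
        · congr 1
          rw [Complex.I_sq]
          ring
        · rw [← hc]; exact_mod_cast hc0
    _ = _ := by
        rw [← integral_const_mul]
        congr 1 with v
        rw [ENNReal.toReal_ofReal (stdGaussianPDF_pos v).le, stdGaussianPDF, Complex.real_smul,
          Complex.exp_add, real_inner_comm]
        push_cast
        rw [mul_assoc]
        congr 3
        ring

theorem log_stdGaussianPDF (x : EuclideanSpace ℝ ι) : Real.log (stdGaussianPDF x) =
    -Real.log ((2 * Real.pi) ^ (finrank ℝ (EuclideanSpace ℝ ι) / 2 : ℝ)) + -(1 / 2) * ‖x‖ ^ 2 := by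
  rw [stdGaussianPDF, Real.log_mul (by positivity) (Real.exp_pos _).ne', Real.log_exp, Real.log_inv]

theorem integrable_log_stdGaussianPDF :
    Integrable (fun x => Real.log (stdGaussianPDF x)) (stdGaussian (EuclideanSpace ℝ ι)) := by
  simp_rw [log_stdGaussianPDF]
  refine (integrable_const _).add (Integrable.const_mul ?_ _)
  exact (IsGaussian.memLp_two_id (μ := stdGaussian (EuclideanSpace ℝ ι))).integrable_norm_pow
    two_ne_zero

/-- A bijection that multiplies volume by c divides the density by c, and therefore adds log c to
the entropy. -/
theorem differentialEntropy_map_of_density {μ : Measure (EuclideanSpace ℝ ι)}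
    [IsProbabilityMeasure μ] {g : EuclideanSpace ℝ ι → ℝ} (hg : Measurable g) (hpos : ∀ x, 0 < g x)
    (hμ : μ = volume.withDensity fun x => ENNReal.ofReal (g x))
    (hint : Integrable (fun x => Real.log (g x)) μ)
    (F : EuclideanSpace ℝ ι ≃ᵐ EuclideanSpace ℝ ι) {c : ℝ} (hc : 0 < c)
    (hF : Measure.map F volume = ENNReal.ofReal c⁻¹ • volume) :
    differentialEntropy (μ.map F) = Real.log c - ∫ x, Real.log (g x) ∂μ := by
  set f : EuclideanSpace ℝ ι → ℝ := fun y => c⁻¹ * g (F.symm y) with hf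
  have hfm : Measurable f := (hg.comp F.symm.measurable).const_mul _
  have hmap : μ.map F = volume.withDensity fun y => ENNReal.ofReal (f y) := by
    ext s hs
    have h1 : ∫⁻ x in F ⁻¹' s, ENNReal.ofReal (g x) =
        ∫⁻ y in s, ENNReal.ofReal (g (F.symm y)) ∂(Measure.map F volume) := by
      rw [setLIntegral_map hs (by fun_prop) F.measurable]
      simp
    rw [Measure.map_apply F.measurable hs, hμ, withDensity_apply _ (F.measurable hs),
      withDensity_apply _ hs, h1, hF, Measure.restrict_smul, lintegral_smul_measure, smul_eq_mul,
      ← lintegral_const_mul _ (by fun_prop)]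
    simp_rw [hf, ENNReal.ofReal_mul (inv_pos.2 hc).le]
  have hrn : (μ.map F).rnDeriv volume =ᵐ[μ.map F] fun y => ENNReal.ofReal (f y) := by
    rw [hmap]
    exact (withDensity_absolutelyContinuous _ _).ae_le
      (Measure.rnDeriv_withDensity _ hfm.ennreal_ofReal)
  have h2 : ∫ z, Real.log ((μ.map F).rnDeriv volume z).toReal ∂(μ.map F) =
      ∫ z, Real.log (f z) ∂(μ.map F) := by
    refine integral_congr_ae (hrn.mono fun z hz => ?_)
    simp only [hz]
    rw [ENNReal.toReal_ofReal (mul_nonneg (inv_pos.2 hc).le (hpos _).le)]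
  rw [differentialEntropy, h2, integral_map_equiv]
  have h3 : ∀ x, Real.log (f (F x)) = -Real.log c + Real.log (g x) := by
    intro x
    simp only [hf, MeasurableEquiv.symm_apply_apply]
    rw [Real.log_mul (inv_pos.2 hc).ne' (hpos x).ne', Real.log_inv]
  simp_rw [h3]
  rw [integral_add (integrable_const _) hint]
  simp
  ring

variable [DecidableEq ι]

/-- N(z, S) is the image of the standard normal law under x ↦ z + √S x, which scales volume by √(det
S). The entropy of the standard law is left unevaluated because it cancels in the information gain.
-/
theorem differentialEntropy_multivariateGaussian (z : EuclideanSpace ℝ ι) {S : Matrix ι ι ℝ}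
    (hS : S.PosDef) : differentialEntropy (multivariateGaussian z S) =
      Real.log S.det / 2 -
        ∫ x, Real.log (stdGaussianPDF x) ∂(stdGaussian (EuclideanSpace ℝ ι)) := by
  set L := toEuclideanCLM (𝕜 := ℝ) (CFC.sqrt S) with hL
  have hdet : LinearMap.det (L : EuclideanSpace ℝ ι →ₗ[ℝ] EuclideanSpace ℝ ι) = √S.det := by
    rw [hL, coe_toEuclideanCLM_eq_toEuclideanLin, toEuclideanLin, toLpLin_eq_toLin, LinearMap.det_toLin,
      hS.posSemidef.det_sqrt]
    rw [RCLike.sqrt_of_nonneg hS.det_pos.le]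
    simp
  have hpos : 0 < √S.det := Real.sqrt_pos.2 hS.det_pos
  set E : EuclideanSpace ℝ ι ≃ₗ[ℝ] EuclideanSpace ℝ ι :=
    LinearMap.equivOfDetNeZero (L : EuclideanSpace ℝ ι →ₗ[ℝ] EuclideanSpace ℝ ι)
      (by rw [hdet]; exact hpos.ne') with hE
  set F : EuclideanSpace ℝ ι ≃ᵐ EuclideanSpace ℝ ι :=
    (E.toContinuousLinearEquiv.toHomeomorph.trans (Homeomorph.addLeft z)).toMeasurableEquiv with hF
  have hFapp : ⇑F = fun x => z + L x := rfl
  have hvol : Measure.map F volume = ENNReal.ofReal (√S.det)⁻¹ • volume := by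
    have h1 : ⇑F = (fun x => z + x) ∘ (L : EuclideanSpace ℝ ι →ₗ[ℝ] EuclideanSpace ℝ ι) := rfl
    have h2 : Measurable (L : EuclideanSpace ℝ ι →ₗ[ℝ] EuclideanSpace ℝ ι) :=
      L.continuous.measurable
    rw [h1, ← Measure.map_map (measurable_const_add z) h2,
      Measure.map_linearMap_addHaar_eq_smul_addHaar _ (by rw [hdet]; exact hpos.ne'), hdet,
      Measure.map_smul, map_add_left_eq_self, abs_of_pos (inv_pos.2 hpos)]
  have h := differentialEntropy_map_of_density measurable_stdGaussianPDF stdGaussianPDF_pos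
    stdGaussian_eq_withDensity integrable_log_stdGaussianPDF F hpos hvol
  rw [Real.log_sqrt hS.det_pos.le] at h
  rw [← h]
  rfl

end Entropy

/-! ### The information gain -/

section InfoGain

open Matrix

variable {d T : ℕ}

/-- The kernel matrix of the points `a_1, …, a_T`. -/
def kernelMatrix (k : (Fin d → ℝ) → (Fin d → ℝ) → ℝ) (a : Fin T → UnitCube d) :
    Matrix (Fin T) (Fin T) ℝ :=
  Matrix.of fun i j => k (a i) (a j)

/-- The entropy of N(z, ρ² I) does not depend on z, so the conditional entropy is a constant. The
law of f_A may be degenerate; this is harmless, since only the nonsingular covariances ρ² I and K +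
ρ² I enter an entropy. -/
theorem infoGain_eq_log_det {k : (Fin d → ℝ) → (Fin d → ℝ) → ℝ} {ρ : ℝ} (hρ : 0 < ρ)
    {a : Fin T → UnitCube d} (hk : (kernelMatrix k a).PosSemidef) :
    infoGain k ρ a =
      (Real.log (ρ ^ 2 • 1 + kernelMatrix k a).det - Real.log ((ρ ^ 2) ^ T)) / 2 := by
  have hN : (ρ ^ 2 • (1 : Matrix (Fin T) (Fin T) ℝ)).PosDef := posDef_smul_one (by positivity)
  have h1 : (kernelMatrix k a + ρ ^ 2 • 1).PosDef := hN.posSemidef_add hk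
  have h2 : infoGain k ρ a =
      differentialEntropy (multivariateGaussian 0 (kernelMatrix k a + ρ ^ 2 • 1)) -
      ∫ z, differentialEntropy (multivariateGaussian z (ρ ^ 2 • 1))
        ∂(multivariateGaussian 0 (kernelMatrix k a)) := rfl
  rw [h2, differentialEntropy_multivariateGaussian _ h1]
  simp_rw [differentialEntropy_multivariateGaussian _ hN]
  rw [integral_const, probReal_univ, one_smul, add_comm (kernelMatrix k a), det_smul]
  simp
  ring

end InfoGain

/-! ### A maximal inequality -/

section MaximalInequality

open scoped ENNReal

variable {Ω : Type*} [mΩ : MeasurableSpace Ω]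

/-- Ville's inequality over a finite horizon. -/
theorem mul_measure_exists_le_le_lintegral {P : Measure Ω} {ℱ : Filtration ℕ mΩ}
    {M : ℕ → Ω → ℝ≥0∞} (N : ℕ) (hM : ∀ n ≤ N, Measurable[ℱ n] (M n))
    (hstep : ∀ n < N, ∀ A, MeasurableSet[ℱ n] A → ∫⁻ ω in A, M (n + 1) ω ∂P ≤ ∫⁻ ω in A, M n ω ∂P)
    (c : ℝ≥0∞) : c * P {ω | ∃ n ≤ N, c ≤ M n ω} ≤ ∫⁻ ω, M 0 ω ∂P := by
  set U : ℕ → Set Ω := fun n => {ω | ∃ j ≤ n, c ≤ M j ω} with hU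
  have hD : ∀ n ≤ N, MeasurableSet[ℱ n] {ω | c ≤ M n ω} := fun n hn =>
    measurableSet_le measurable_const (hM n hn)
  have hsucc : ∀ n, U (n + 1) = U n ∪ {ω | c ≤ M (n + 1) ω} := by
    intro n
    ext ω
    simp only [hU, Set.mem_ofPred_eq, Set.mem_union, Nat.le_succ_iff]
    constructor
    · rintro ⟨j, hj | rfl, h⟩
      · exact .inl ⟨j, hj, h⟩
      · exact .inr h
    · rintro (⟨j, hj, h⟩ | h)
      · exact ⟨j, .inl hj, h⟩
      · exact ⟨_, .inr rfl, h⟩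
  have hU0 : U 0 = {ω | c ≤ M 0 ω} := by ext; simp [hU]
  have hUm : ∀ n ≤ N, MeasurableSet[ℱ n] (U n) := by
    intro n hn
    induction n with
    | zero => rw [hU0]; exact hD 0 hn
    | succ n ih =>
      rw [hsucc]
      exact (ℱ.mono n.le_succ _ (ih (by omega))).union (hD _ hn)
  have markov : ∀ n ≤ N, ∀ E, MeasurableSet E → E ⊆ {ω | c ≤ M n ω} →
      c * P E ≤ ∫⁻ ω in E, M n ω ∂P := by
    intro n hn E hE hsub
    rw [← setLIntegral_const]
    exact setLIntegral_mono' hE fun ω hω => hsub hω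
  -- The process stopped on first reaching c: mass that has crossed is counted as c, the rest keeps
  -- its current value. The total cannot increase, because Markov's inequality handles newly crossed
  -- mass and `hstep` the remainder.
  have key : ∀ n ≤ N, c * P (U n) + ∫⁻ ω in (U n)ᶜ, M n ω ∂P ≤ ∫⁻ ω, M 0 ω ∂P := by
    intro n hn
    induction n with
    | zero =>
      have hm := ℱ.le 0 _ (hUm 0 hn)
      exact (add_le_add_left (markov 0 hn _ hm hU0.le) _).trans (lintegral_add_compl _ hm).le
    | succ n ih =>
      refine le_trans ?_ (ih (by omega))
      have hmn := hUm n (by omega)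
      have hm := ℱ.le n _ hmn
      have hDm := ℱ.le (n + 1) _ (hD (n + 1) hn)
      set E := (U n)ᶜ ∩ {ω | c ≤ M (n + 1) ω} with hE
      have hEm : MeasurableSet E := hm.compl.inter hDm
      have h1 : U (n + 1) = U n ∪ E := by rw [hsucc, hE]; ext ω; simp; tauto
      have h2 : (U (n + 1))ᶜ = (U n)ᶜ \ {ω | c ≤ M (n + 1) ω} := by
        rw [hsucc]; ext ω; simp
      have h3 : P (U (n + 1)) ≤ P (U n) + P E := by rw [h1]; exact measure_union_le _ _
      calc c * P (U (n + 1)) + ∫⁻ ω in (U (n + 1))ᶜ, M (n + 1) ω ∂P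
          ≤ c * (P (U n) + P E) + ∫⁻ ω in (U (n + 1))ᶜ, M (n + 1) ω ∂P := by gcongr
        _ ≤ c * P (U n) + (∫⁻ ω in E, M (n + 1) ω ∂P +
              ∫⁻ ω in (U (n + 1))ᶜ, M (n + 1) ω ∂P) := by
            rw [mul_add, add_assoc]
            gcongr
            exact markov (n + 1) hn _ hEm Set.inter_subset_right
        _ = c * P (U n) + ∫⁻ ω in (U n)ᶜ, M (n + 1) ω ∂P := by
            rw [hE, h2, lintegral_inter_add_sdiff _ _ hDm]
        _ ≤ _ := by
            gcongr 1
            exact hstep n (by omega) _ hmn.compl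
  exact le_self_add.trans (key N le_rfl)

end MaximalInequality

/-! ### Conditionally sub-Gaussian noise with random coefficients -/

section SubGaussian

open scoped ENNReal
open Filter Topology

variable {Ω : Type*} {m mΩ : MeasurableSpace Ω} {P : Measure Ω} [IsProbabilityMeasure P]
  {η : Ω → ℝ} {q : ℝ}

theorem setLIntegral_exp_mul_sub_le_of_condExp_le (hm : m ≤ mΩ)
    (hint : ∀ s : ℝ, Integrable (fun ω => Real.exp (s * η ω)) P)
    (hsub : ∀ s : ℝ, P[fun ω => Real.exp (s * η ω) | m] ≤ᵐ[P] fun _ => Real.exp (q * s ^ 2 / 2))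
    (c : ℝ) {A : Set Ω} (hA : MeasurableSet[m] A) :
    ∫⁻ ω in A, ENNReal.ofReal (Real.exp (c * η ω - q * c ^ 2 / 2)) ∂P ≤ P A := by
  have h1 : ∫ ω in A, Real.exp (c * η ω) ∂P ≤ Real.exp (q * c ^ 2 / 2) * P.real A := by
    rw [← setIntegral_condExp hm (hint c) hA]
    calc ∫ ω in A, (P[fun ω => Real.exp (c * η ω) | m]) ω ∂P
        ≤ ∫ _ in A, Real.exp (q * c ^ 2 / 2) ∂P :=
          setIntegral_mono_ae integrable_condExp.integrableOn (integrable_const _).integrableOn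
            (hsub c)
      _ = _ := by rw [setIntegral_const, smul_eq_mul, mul_comm]
  have h2 : ∫⁻ ω in A, ENNReal.ofReal (Real.exp (c * η ω)) ∂P ≤
      ENNReal.ofReal (Real.exp (q * c ^ 2 / 2)) * P A := by
    rw [← ofReal_integral_eq_lintegral_ofReal (hint c).integrableOn
      (ae_of_all _ fun ω => (Real.exp_pos _).le)]
    refine (ENNReal.ofReal_le_ofReal h1).trans ?_
    rw [ENNReal.ofReal_mul (Real.exp_pos _).le, Measure.real, ENNReal.ofReal_toReal
      (measure_ne_top _ _)]
  calc ∫⁻ ω in A, ENNReal.ofReal (Real.exp (c * η ω - q * c ^ 2 / 2)) ∂P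
      = ∫⁻ ω in A, ENNReal.ofReal (Real.exp (-(q * c ^ 2 / 2))) *
          ENNReal.ofReal (Real.exp (c * η ω)) ∂P := by
        congr 1 with ω
        rw [← ENNReal.ofReal_mul (Real.exp_pos _).le, ← Real.exp_add]
        ring_nf
    _ = ENNReal.ofReal (Real.exp (-(q * c ^ 2 / 2))) *
          ∫⁻ ω in A, ENNReal.ofReal (Real.exp (c * η ω)) ∂P :=
        lintegral_const_mul' _ _ ENNReal.ofReal_ne_top
    _ ≤ ENNReal.ofReal (Real.exp (-(q * c ^ 2 / 2))) *
          (ENNReal.ofReal (Real.exp (q * c ^ 2 / 2)) * P A) := by gcongr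
    _ = P A := by
        rw [← mul_assoc, ← ENNReal.ofReal_mul (Real.exp_pos _).le, ← Real.exp_add]
        simp

theorem Measurable.exists_tendsto_finite_range {α : Type*} [MeasurableSpace α] {σ : α → ℝ}
    (hσ : Measurable σ) : ∃ f : ℕ → α → ℝ, (∀ n, Measurable (f n)) ∧
      (∀ n, (Set.range (f n)).Finite) ∧ ∀ a, Tendsto (fun n => f n a) atTop (𝓝 (σ a)) :=
  ⟨fun n => hσ.stronglyMeasurable.approx n, fun _ => SimpleFunc.measurable _,
    fun _ => SimpleFunc.finite_range _, hσ.stronglyMeasurable.tendsto_approx⟩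

/-- The conditional bound is assumed only for deterministic s. A coefficient with finitely many
values is handled on its level sets, and a general one by approximation and Fatou's lemma. -/
theorem setLIntegral_exp_sub_le_of_measurable (hm : m ≤ mΩ) (hη : Measurable η)
    (hint : ∀ s : ℝ, Integrable (fun ω => Real.exp (s * η ω)) P)
    (hsub : ∀ s : ℝ, P[fun ω => Real.exp (s * η ω) | m] ≤ᵐ[P] fun _ => Real.exp (q * s ^ 2 / 2))
    {σ : Ω → ℝ} (hσ : Measurable[m] σ) {A : Set Ω} (hA : MeasurableSet[m] A) :
    ∫⁻ ω in A, ENNReal.ofReal (Real.exp (σ ω * η ω - q * σ ω ^ 2 / 2)) ∂P ≤ P A := by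
  obtain ⟨f, hf, hfin, hfσ⟩ := @Measurable.exists_tendsto_finite_range Ω m σ hσ
  have hsimple : ∀ n, ∫⁻ ω in A,
      ENNReal.ofReal (Real.exp (f n ω * η ω - q * f n ω ^ 2 / 2)) ∂P ≤ P A := by
    intro n
    have hfib : ∀ c, MeasurableSet[m] ((f n) ⁻¹' {c}) := fun c => hf n (measurableSet_singleton c)
    have h1 : ∀ ω, ENNReal.ofReal (Real.exp (f n ω * η ω - q * f n ω ^ 2 / 2)) =
        ∑ c ∈ (hfin n).toFinset, ((f n) ⁻¹' {c}).indicator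
          (fun ω => ENNReal.ofReal (Real.exp (c * η ω - q * c ^ 2 / 2))) ω := by
      intro ω
      rw [Finset.sum_eq_single (f n ω)]
      · simp
      · intro c _ hc
        exact Set.indicator_of_notMem (by simpa using hc.symm) _
      · intro h
        simp at h
    have hmeas : ∀ c : ℝ,
        Measurable fun ω => ENNReal.ofReal (Real.exp (c * η ω - q * c ^ 2 / 2)) :=
      fun c => by fun_prop
    simp_rw [h1]
    rw [lintegral_finsetSum _ fun c _ => (hmeas c).indicator (hm _ (hfib c))]
    calc ∑ c ∈ (hfin n).toFinset, ∫⁻ ω in A, ((f n) ⁻¹' {c}).indicator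
            (fun ω => ENNReal.ofReal (Real.exp (c * η ω - q * c ^ 2 / 2))) ω ∂P
        ≤ ∑ c ∈ (hfin n).toFinset, P ((f n) ⁻¹' {c} ∩ A) := by
          refine Finset.sum_le_sum fun c _ => ?_
          rw [lintegral_indicator (hm _ (hfib c)), Measure.restrict_restrict (hm _ (hfib c))]
          exact setLIntegral_exp_mul_sub_le_of_condExp_le hm hint hsub c
            (@MeasurableSet.inter _ m _ _ (hfib c) hA)
      _ = P.restrict A Set.univ := by
          have huniv : f n ⁻¹' ((hfin n).toFinset : Set ℝ) = Set.univ := by simp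
          rw [← huniv, ← sum_measure_preimage_singleton _ fun c _ => hm _ (hfib c)]
          exact Finset.sum_congr rfl fun c _ => (Measure.restrict_apply (hm _ (hfib c))).symm
      _ = P A := by simp
  have hlim : ∀ ω, Tendsto
      (fun n => ENNReal.ofReal (Real.exp (f n ω * η ω - q * f n ω ^ 2 / 2))) atTop
      (𝓝 (ENNReal.ofReal (Real.exp (σ ω * η ω - q * σ ω ^ 2 / 2)))) := by
    intro ω
    have h := hfσ ω
    refine (ENNReal.continuous_ofReal.tendsto _).comp ((Real.continuous_exp.tendsto _).comp ?_)
    exact (h.mul_const _).sub (((h.pow 2).const_mul q).div_const 2)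
  calc ∫⁻ ω in A, ENNReal.ofReal (Real.exp (σ ω * η ω - q * σ ω ^ 2 / 2)) ∂P
      = ∫⁻ ω in A, liminf
          (fun n => ENNReal.ofReal (Real.exp (f n ω * η ω - q * f n ω ^ 2 / 2))) atTop ∂P := by
        congr 1 with ω
        exact (hlim ω).liminf_eq.symm
    _ ≤ liminf (fun n => ∫⁻ ω in A,
          ENNReal.ofReal (Real.exp (f n ω * η ω - q * f n ω ^ 2 / 2)) ∂P) atTop := by
        refine lintegral_liminf_le fun n => ?_
        have : Measurable (f n) := (hf n).mono hm le_rfl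
        fun_prop
    _ ≤ P A := by
        refine liminf_le_of_frequently_le' (Frequently.of_forall hsimple)

/-- The bound on all sets of `m` says that the measure with density `g` is dominated by `P` on `m`;
integrating the `m`-measurable weight `Z` against both gives the claim. -/
theorem lintegral_mul_exp_sub_le (hm : m ≤ mΩ) (hη : Measurable η)
    (hint : ∀ s : ℝ, Integrable (fun ω => Real.exp (s * η ω)) P)
    (hsub : ∀ s : ℝ, P[fun ω => Real.exp (s * η ω) | m] ≤ᵐ[P] fun _ => Real.exp (q * s ^ 2 / 2))
    {σ : Ω → ℝ} (hσ : Measurable[m] σ) {Z : Ω → ℝ≥0∞} (hZ : Measurable[m] Z) :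
    ∫⁻ ω, Z ω * ENNReal.ofReal (Real.exp (σ ω * η ω - q * σ ω ^ 2 / 2)) ∂P ≤ ∫⁻ ω, Z ω ∂P := by
  set g : Ω → ℝ≥0∞ := fun ω => ENNReal.ofReal (Real.exp (σ ω * η ω - q * σ ω ^ 2 / 2)) with hg
  have hgm : Measurable g := by
    have : Measurable σ := hσ.mono hm le_rfl
    fun_prop
  have hle : (P.withDensity g).trim hm ≤ P.trim hm := by
    refine Measure.le_iff.2 fun A hA => ?_
    rw [trim_measurableSet_eq hm hA, trim_measurableSet_eq hm hA, withDensity_apply _ (hm _ hA)]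
    exact setLIntegral_exp_sub_le_of_measurable hm hη hint hsub hσ hA
  calc ∫⁻ ω, Z ω * g ω ∂P = ∫⁻ ω, (g * Z) ω ∂P := by simp [mul_comm]
    _ = ∫⁻ ω, Z ω ∂(P.withDensity g) :=
        (lintegral_withDensity_eq_lintegral_mul _ hgm (hZ.mono hm le_rfl)).symm
    _ = ∫⁻ ω, Z ω ∂((P.withDensity g).trim hm) := (lintegral_trim hm hZ).symm
    _ ≤ ∫⁻ ω, Z ω ∂(P.trim hm) := lintegral_mono' hle le_rfl
    _ = _ := lintegral_trim hm hZ

/-- A Gaussian mixture of exponential martingale increments, in closed form. -/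
theorem lintegral_exp_gaussian_mixture {q u : ℝ} (hq : 0 < q) (hu : 0 ≤ u) (s y : ℝ) :
    ∫⁻ v, ENNReal.ofReal (Real.exp ((s / q + √(u / q) * v) * y
        - q * (s / q + √(u / q) * v) ^ 2 / 2)) ∂(gaussianReal 0 1) =
      ENNReal.ofReal ((√(1 + u))⁻¹ *
        Real.exp ((u * y ^ 2 + 2 * s * y - s ^ 2) / (2 * q * (1 + u)))) := by
  set b := √(u / q) with hb
  have hb2 : b ^ 2 = u / q := Real.sq_sqrt (by positivity)
  have hu1 : 0 < 1 + u := by positivity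
  set w : NNReal := ⟨(1 + u)⁻¹, by positivity⟩ with hw
  have hwc : (w : ℝ) = (1 + u)⁻¹ := rfl
  have hw0 : w ≠ 0 := by
    intro h
    have : (w : ℝ) = 0 := by rw [h]; rfl
    rw [hwc] at this
    exact (inv_pos.2 hu1).ne' this
  set K := (√(1 + u))⁻¹ * Real.exp ((u * y ^ 2 + 2 * s * y - s ^ 2) / (2 * q * (1 + u))) with hK
  have hK0 : 0 ≤ K := by positivity
  -- Completing the square in v turns the integrand into K times the Gaussian density of mean b (y -
  -- s)/(1 + u) and variance 1/(1 + u), which has total mass one.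
  have hpt : ∀ v : ℝ, gaussianPDFReal 0 1 v * Real.exp ((s / q + b * v) * y
      - q * (s / q + b * v) ^ 2 / 2) = K * gaussianPDFReal (b * (y - s) / (1 + u)) w v := by
    intro v
    rw [gaussianPDFReal, gaussianPDFReal, hK, hwc]
    have h1 : √(2 * Real.pi * (1 + u)⁻¹) = √(2 * Real.pi) * (√(1 + u))⁻¹ := by
      rw [Real.sqrt_mul (by positivity), Real.sqrt_inv]
    have h2 : √(1 + u) ≠ 0 := by positivity
    have h3 : √(2 * Real.pi) ≠ 0 := by positivity
    rw [h1]
    have hexp : -(v - 0) ^ 2 / (2 * ((1 : NNReal) : ℝ)) + ((s / q + b * v) * y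
        - q * (s / q + b * v) ^ 2 / 2) = (u * y ^ 2 + 2 * s * y - s ^ 2) / (2 * q * (1 + u)) +
        -(v - b * (y - s) / (1 + u)) ^ 2 / (2 * (1 + u)⁻¹) := by
      have e1 : q * (s / q + b * v) ^ 2 = s ^ 2 / q + 2 * s * b * v + u * v ^ 2 := by
        have : q * b ^ 2 = u := by rw [hb2]; field_simp
        field_simp
        linear_combination (q * v ^ 2) * this
      have e2 : (v - b * (y - s) / (1 + u)) ^ 2 = v ^ 2 - 2 * v * b * (y - s) / (1 + u)
          + u / q * (y - s) ^ 2 / (1 + u) ^ 2 := by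
        rw [← hb2]; field_simp; ring
      rw [e1, e2, NNReal.coe_one]
      field_simp
      ring
    calc (√(2 * Real.pi * ((1 : NNReal) : ℝ)))⁻¹ * Real.exp (-(v - 0) ^ 2 / (2 * ((1 : NNReal) : ℝ)))
          * Real.exp ((s / q + b * v) * y - q * (s / q + b * v) ^ 2 / 2)
        = (√(2 * Real.pi))⁻¹ * Real.exp (-(v - 0) ^ 2 / (2 * ((1 : NNReal) : ℝ)) +
            ((s / q + b * v) * y - q * (s / q + b * v) ^ 2 / 2)) := by
          rw [Real.exp_add, NNReal.coe_one, mul_one, mul_assoc]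
      _ = _ := by
          rw [hexp, Real.exp_add]
          field_simp
  rw [gaussianReal_of_var_ne_zero _ one_ne_zero,
    lintegral_withDensity_eq_lintegral_mul _ (measurable_gaussianPDF 0 1) (by fun_prop)]
  calc ∫⁻ v, (gaussianPDF 0 1 * fun v => ENNReal.ofReal (Real.exp ((s / q + b * v) * y
        - q * (s / q + b * v) ^ 2 / 2))) v
      = ∫⁻ v, ENNReal.ofReal K * gaussianPDF (b * (y - s) / (1 + u)) w v := by
        congr 1 with v
        rw [Pi.mul_apply, gaussianPDF, gaussianPDF,
          ← ENNReal.ofReal_mul (gaussianPDFReal_nonneg _ _ _), hpt, ENNReal.ofReal_mul hK0]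
    _ = ENNReal.ofReal K := by
        rw [lintegral_const_mul _ (measurable_gaussianPDF _ _), lintegral_gaussianPDF_eq_one _ hw0,
          mul_one]

end SubGaussian

/-! ### The self-normalized bound for vector-valued martingales -/

section SelfNormalized

open Matrix
open scoped ENNReal

variable {n : Type*} [DecidableEq n]

/-- The regularised design matrix `c I + ∑_{1 ≤ τ < t} φ_τ φ_τᵀ`. -/
noncomputable def designMatrix (c : ℝ) (φ : ℕ → n → ℝ) (t : ℕ) : Matrix n n ℝ :=
  c • 1 + ∑ τ ∈ Finset.Ico 1 t, vecMulVec (φ τ) (φ τ)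

theorem designMatrix_one (c : ℝ) (φ : ℕ → n → ℝ) : designMatrix c φ 1 = c • 1 := by
  simp [designMatrix]

theorem designMatrix_succ (c : ℝ) (φ : ℕ → n → ℝ) {t : ℕ} (ht : 1 ≤ t) :
    designMatrix c φ (t + 1) = designMatrix c φ t + vecMulVec (φ t) (φ t) := by
  rw [designMatrix, designMatrix, Finset.sum_Ico_succ_top ht, add_assoc]

variable [Fintype n]

theorem posDef_designMatrix {c : ℝ} (hc : 0 < c) (φ : ℕ → n → ℝ) (t : ℕ) :
    (designMatrix c φ t).PosDef :=
  (posDef_smul_one hc).add_posSemidef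
    (posSemidef_sum _ fun τ _ => posSemidef_vecMulVec_self (φ τ))

/-- By Cramer's rule the inverse is the adjugate over the determinant, both continuous in the
entries; singular matrices then need no separate treatment. -/
theorem measurable_dotProduct_inv_mulVec :
    Measurable fun z : (n → n → ℝ) × (n → ℝ) × (n → ℝ) =>
      z.2.1 ⬝ᵥ (Matrix.of z.1)⁻¹ *ᵥ z.2.2 := by
  have h : ∀ z : (n → n → ℝ) × (n → ℝ) × (n → ℝ), z.2.1 ⬝ᵥ (Matrix.of z.1)⁻¹ *ᵥ z.2.2 =
      (Matrix.of z.1).det⁻¹ * (z.2.1 ⬝ᵥ (Matrix.of z.1).adjugate *ᵥ z.2.2) := by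
    intro z
    rw [inv_def, Ring.inverse_eq_inv', smul_mulVec, dotProduct_smul, smul_eq_mul]
  simp_rw [h]
  have hof : Continuous fun z : (n → n → ℝ) × (n → ℝ) × (n → ℝ) => Matrix.of z.1 :=
    continuous_fst
  refine Measurable.mul (hof.matrix_det.measurable.inv) (Continuous.measurable ?_)
  exact continuous_snd.fst.dotProduct (hof.matrix_adjugate.matrix_mulVec continuous_snd.snd)

theorem measurable_dotProduct_inv_designMatrix_mulVec {Ω : Type*} {m : MeasurableSpace Ω} {c : ℝ}
    {φ : ℕ → Ω → n → ℝ} {t : ℕ} (hφ : ∀ τ ∈ Finset.Ico 1 t, Measurable (φ τ)) {a b : Ω → n → ℝ}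
    (ha : Measurable a) (hb : Measurable b) :
    Measurable fun ω => a ω ⬝ᵥ (designMatrix c (fun τ => φ τ ω) t)⁻¹ *ᵥ b ω := by
  have hW : Measurable fun ω => fun i j => designMatrix c (fun τ => φ τ ω) t i j := by
    refine measurable_pi_lambda _ fun i => measurable_pi_lambda _ fun j => ?_
    simp only [designMatrix, Matrix.add_apply, Matrix.sum_apply, vecMulVec_apply]
    refine measurable_const.add (Finset.measurable_sum _ fun τ hτ => ?_)
    exact ((measurable_pi_apply i).comp (hφ τ hτ)).mul ((measurable_pi_apply j).comp (hφ τ hτ))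
  exact measurable_dotProduct_inv_mulVec.comp (hW.prodMk (ha.prodMk hb))

theorem measurable_det_designMatrix {Ω : Type*} {m : MeasurableSpace Ω} {c : ℝ}
    {φ : ℕ → Ω → n → ℝ} {t : ℕ} (hφ : ∀ τ ∈ Finset.Ico 1 t, Measurable (φ τ)) :
    Measurable fun ω => (designMatrix c (fun τ => φ τ ω) t).det := by
  have hW : Measurable fun ω => fun i j => designMatrix c (fun τ => φ τ ω) t i j := by
    refine measurable_pi_lambda _ fun i => measurable_pi_lambda _ fun j => ?_
    simp only [designMatrix, Matrix.add_apply, Matrix.sum_apply, vecMulVec_apply]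
    refine measurable_const.add (Finset.measurable_sum _ fun τ hτ => ?_)
    exact ((measurable_pi_apply i).comp (hφ τ hτ)).mul ((measurable_pi_apply j).comp (hφ τ hτ))
  have hdet : Continuous fun W : n → n → ℝ => (Matrix.of W).det :=
    Continuous.matrix_det (A := fun W : n → n → ℝ => Matrix.of W) continuous_id
  exact hdet.measurable.comp hW

/-- The Gaussian mixture of the exponential supermartingales of `∑ τ, η_τ φ_τ`. -/
noncomputable def mixtureMartingale (q c : ℝ) (φ : ℕ → n → ℝ) (η : ℕ → ℝ) (t : ℕ) : ℝ :=
  (√((designMatrix c φ t).det / c ^ Fintype.card n))⁻¹ *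
    Real.exp (((∑ τ ∈ Finset.Ico 1 t, η τ • φ τ) ⬝ᵥ (designMatrix c φ t)⁻¹ *ᵥ
      (∑ τ ∈ Finset.Ico 1 t, η τ • φ τ)) / (2 * q))

theorem mixtureMartingale_nonneg (q c : ℝ) (φ : ℕ → n → ℝ) (η : ℕ → ℝ) (t : ℕ) :
    0 ≤ mixtureMartingale q c φ η t := by
  unfold mixtureMartingale; positivity

theorem mixtureMartingale_one (q : ℝ) {c : ℝ} (hc : 0 < c) (φ : ℕ → n → ℝ) (η : ℕ → ℝ) :
    mixtureMartingale q c φ η 1 = 1 := by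
  have : c ^ Fintype.card n ≠ 0 := by positivity
  simp [mixtureMartingale, designMatrix_one, this]

/-- The method of mixtures, one dimension at a time. The matrix determinant lemma and
Sherman-Morrison show that adding one term multiplies the mixture by a one-dimensional Gaussian
average of exp(σ η_t - q σ²/2), with σ fixed by the past and the mixing variable v. No integral over
the feature space is needed. -/
theorem mixtureMartingale_succ {q c : ℝ} (hq : 0 < q) (hc : 0 < c) (φ : ℕ → n → ℝ) (η : ℕ → ℝ)
    {t : ℕ} (ht : 1 ≤ t) :
    ENNReal.ofReal (mixtureMartingale q c φ η (t + 1)) =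
      ENNReal.ofReal (mixtureMartingale q c φ η t) * ∫⁻ v, ENNReal.ofReal (Real.exp
        (((φ t ⬝ᵥ (designMatrix c φ t)⁻¹ *ᵥ (∑ τ ∈ Finset.Ico 1 t, η τ • φ τ)) / q +
            √((φ t ⬝ᵥ (designMatrix c φ t)⁻¹ *ᵥ φ t) / q) * v) * η t
          - q * ((φ t ⬝ᵥ (designMatrix c φ t)⁻¹ *ᵥ (∑ τ ∈ Finset.Ico 1 t, η τ • φ τ)) / q +
            √((φ t ⬝ᵥ (designMatrix c φ t)⁻¹ *ᵥ φ t) / q) * v) ^ 2 / 2)) ∂(gaussianReal 0 1) := by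
  have hW := posDef_designMatrix hc φ t
  set W := designMatrix c φ t with hWdef
  set S := ∑ τ ∈ Finset.Ico 1 t, η τ • φ τ with hS
  set s := φ t ⬝ᵥ W⁻¹ *ᵥ S with hs
  set u := φ t ⬝ᵥ W⁻¹ *ᵥ φ t with hu
  have hu0 : 0 ≤ u := hW.quadForm_inv_nonneg _
  have hu1 : 0 < 1 + u := by positivity
  rw [lintegral_exp_gaussian_mixture hq hu0,
    ← ENNReal.ofReal_mul (mixtureMartingale_nonneg _ _ _ _ _)]
  congr 1
  rw [mixtureMartingale, mixtureMartingale, designMatrix_succ c φ ht, Finset.sum_Ico_succ_top ht,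
    ← hWdef, ← hS, hW.det_add_vecMulVec, ← hu, hW.quadForm_inv_add_vecMulVec, ← hu]
  have h1 : (S + η t • φ t) ⬝ᵥ W⁻¹ *ᵥ (S + η t • φ t) =
      S ⬝ᵥ W⁻¹ *ᵥ S + 2 * η t * s + η t ^ 2 * u := by
    simp only [mulVec_add, mulVec_smul, dotProduct_add, add_dotProduct, dotProduct_smul,
      smul_dotProduct, smul_eq_mul, hW.inv.1.dotProduct_mulVec_comm S (φ t)]
    rw [← hs, ← hu]; ring
  have h2 : φ t ⬝ᵥ W⁻¹ *ᵥ (S + η t • φ t) = s + η t * u := by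
    simp only [mulVec_add, mulVec_smul, dotProduct_add, dotProduct_smul, smul_eq_mul, ← hs, ← hu]
  rw [h1, h2, mul_div_right_comm, Real.sqrt_mul (div_nonneg hW.det_pos.le (by positivity)),
    mul_inv, mul_mul_mul_comm, ← Real.exp_add]
  congr 2
  field_simp
  ring

theorem measurable_ofReal_mixtureMartingale {Ω : Type*} {m : MeasurableSpace Ω} (q c : ℝ)
    {φ : ℕ → Ω → n → ℝ} {η : ℕ → Ω → ℝ} {t : ℕ} (hφ : ∀ τ ∈ Finset.Ico 1 t, Measurable (φ τ))
    (hη : ∀ τ ∈ Finset.Ico 1 t, Measurable (η τ)) :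
    Measurable fun ω => ENNReal.ofReal
      (mixtureMartingale q c (fun τ => φ τ ω) (fun τ => η τ ω) t) := by
  have hS : Measurable fun ω => ∑ τ ∈ Finset.Ico 1 t, η τ ω • φ τ ω :=
    Finset.measurable_sum _ fun τ hτ => (hη τ hτ).smul (hφ τ hτ)
  have h1 := measurable_dotProduct_inv_designMatrix_mulVec (c := c) hφ hS hS
  have h2 := measurable_det_designMatrix (c := c) hφ
  unfold mixtureMartingale
  fun_prop

/-- By Tonelli the average over v can be taken last; for fixed v the coefficient of the noise is
`m`-measurable, so the sub-Gaussian step applies. -/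
theorem setLIntegral_mixtureMartingale_succ_le {Ω : Type*} {m mΩ : MeasurableSpace Ω}
    {P : Measure Ω} [IsProbabilityMeasure P] {q c : ℝ} (hq : 0 < q) (hc : 0 < c) (hm : m ≤ mΩ) {φ : ℕ → Ω → n → ℝ} {η : ℕ → Ω → ℝ} {t : ℕ} (ht : 1 ≤ t)
    (hφ : ∀ τ ∈ Finset.Icc 1 t, Measurable[m] (φ τ))
    (hη : ∀ τ ∈ Finset.Ico 1 t, Measurable[m] (η τ)) (hηt : Measurable (η t))
    (hint : ∀ s : ℝ, Integrable (fun ω => Real.exp (s * η t ω)) P)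
    (hsub : ∀ s : ℝ, P[fun ω => Real.exp (s * η t ω) | m] ≤ᵐ[P]
      fun _ => Real.exp (q * s ^ 2 / 2))
    {A : Set Ω} (hA : MeasurableSet[m] A) :
    ∫⁻ ω in A, ENNReal.ofReal
        (mixtureMartingale q c (fun τ => φ τ ω) (fun τ => η τ ω) (t + 1)) ∂P ≤
      ∫⁻ ω in A, ENNReal.ofReal
        (mixtureMartingale q c (fun τ => φ τ ω) (fun τ => η τ ω) t) ∂P := by
  set M : Ω → ℝ≥0∞ := fun ω => ENNReal.ofReal
    (mixtureMartingale q c (fun τ => φ τ ω) (fun τ => η τ ω) t) with hM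
  have hφ' : ∀ τ ∈ Finset.Ico 1 t, Measurable[m] (φ τ) := fun τ hτ =>
    hφ τ (Finset.Ico_subset_Icc_self hτ)
  have hφt : Measurable[m] (φ t) := hφ t (Finset.right_mem_Icc.2 ht)
  have hMm : Measurable[m] M := measurable_ofReal_mixtureMartingale q c hφ' hη
  have hS : Measurable[m] fun ω => ∑ τ ∈ Finset.Ico 1 t, η τ ω • φ τ ω :=
    Finset.measurable_sum _ fun τ hτ => (hη τ hτ).smul (hφ' τ hτ)
  set s : Ω → ℝ := fun ω => φ t ω ⬝ᵥ (designMatrix c (fun τ => φ τ ω) t)⁻¹ *ᵥ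
    (∑ τ ∈ Finset.Ico 1 t, η τ ω • φ τ ω) with hs
  have hsm : Measurable[m] s := measurable_dotProduct_inv_designMatrix_mulVec hφ' hφt hS
  set u : Ω → ℝ := fun ω => φ t ω ⬝ᵥ (designMatrix c (fun τ => φ τ ω) t)⁻¹ *ᵥ φ t ω with hu
  have hum : Measurable[m] u := measurable_dotProduct_inv_designMatrix_mulVec hφ' hφt hφt
  have hσm : ∀ v : ℝ, Measurable[m] fun ω => s ω / q + √(u ω / q) * v := fun v =>
    (hsm.div_const q).add ((hum.div_const q).sqrt.mul_const v)
  set g : Ω → ℝ → ℝ≥0∞ := fun ω v => ENNReal.ofReal (Real.exp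
    ((s ω / q + √(u ω / q) * v) * η t ω - q * (s ω / q + √(u ω / q) * v) ^ 2 / 2)) with hg
  have hgm : Measurable (Function.uncurry g) := by
    have h1 : Measurable s := hsm.mono hm le_rfl
    have h2 : Measurable u := hum.mono hm le_rfl
    simp only [hg, Function.uncurry_def]
    fun_prop
  have hM' : Measurable M := hMm.mono hm le_rfl
  calc ∫⁻ ω in A, ENNReal.ofReal
        (mixtureMartingale q c (fun τ => φ τ ω) (fun τ => η τ ω) (t + 1)) ∂P
      = ∫⁻ ω in A, ∫⁻ v, M ω * g ω v ∂(gaussianReal 0 1) ∂P := by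
        congr 1 with ω
        rw [lintegral_const_mul _ hgm.of_uncurry_left]
        exact mixtureMartingale_succ hq hc _ _ ht
    _ = ∫⁻ v, ∫⁻ ω in A, M ω * g ω v ∂P ∂(gaussianReal 0 1) := by
        refine lintegral_lintegral_swap (Measurable.aemeasurable ?_)
        exact (hM'.comp measurable_fst).mul hgm
    _ ≤ ∫⁻ _, ∫⁻ ω in A, M ω ∂P ∂(gaussianReal 0 1) := by
        refine lintegral_mono fun v => ?_
        have h := lintegral_mul_exp_sub_le hm hηt hint hsub (hσm v)
          (Z := A.indicator M) (hMm.indicator hA)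
        rw [lintegral_indicator (hm _ hA)] at h
        refine le_trans (le_of_eq ?_) h
        rw [← lintegral_indicator (hm _ hA)]
        congr 1 with ω
        by_cases hω : ω ∈ A <;> simp [hω, hg]
    _ = _ := by simp

/-- With probability at least `1 - δ`, simultaneously for `t = 1, …, T`, the noise
`S_t = ∑_{τ < t} η_τ φ_τ` satisfies
`‖S_t‖²_{W_t⁻¹} ≤ q (log (det W_t / c ^ m) + 2 log (1 / δ))`. -/
theorem measure_not_selfNormalized_le {Ω : Type*} {mΩ : MeasurableSpace Ω}
    {P : Measure Ω} [IsProbabilityMeasure P] {q c : ℝ} (hq : 0 < q) (hc : 0 < c)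
    {ℱ : Filtration ℕ mΩ} {φ : ℕ → Ω → n → ℝ} {η : ℕ → Ω → ℝ} {T : ℕ}
    (hφ : ∀ t ∈ Finset.Icc 1 T, Measurable[ℱ (t - 1)] (φ t))
    (hη : ∀ t ∈ Finset.Icc 1 T, Measurable[ℱ t] (η t))
    (hint : ∀ t ∈ Finset.Icc 1 T, ∀ s : ℝ, Integrable (fun ω => Real.exp (s * η t ω)) P)
    (hsub : ∀ t ∈ Finset.Icc 1 T, ∀ s : ℝ, P[fun ω => Real.exp (s * η t ω) | ℱ (t - 1)] ≤ᵐ[P]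
      fun _ => Real.exp (q * s ^ 2 / 2))
    {δ : ℝ} (hδ : 0 < δ) :
    P {ω | ¬ ∀ t ∈ Finset.Icc 1 T, (∑ τ ∈ Finset.Ico 1 t, η τ ω • φ τ ω) ⬝ᵥ
        (designMatrix c (fun τ => φ τ ω) t)⁻¹ *ᵥ (∑ τ ∈ Finset.Ico 1 t, η τ ω • φ τ ω) ≤
      q * (Real.log ((designMatrix c (fun τ => φ τ ω) t).det / c ^ Fintype.card n) +
        2 * Real.log (1 / δ))} ≤ ENNReal.ofReal δ := by
  rcases Nat.eq_zero_or_pos T with rfl | hT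
  · simp
  -- The index shifts by one: the mixture at round k + 1 involves the noise of rounds 1 to k only,
  -- so it is `ℱ k`-measurable, and it equals 1 at k = 0.
  set M : ℕ → Ω → ℝ≥0∞ := fun k ω => ENNReal.ofReal
    (mixtureMartingale q c (fun τ => φ τ ω) (fun τ => η τ ω) (k + 1)) with hM
  have hville := mul_measure_exists_le_le_lintegral (P := P) (ℱ := ℱ) (M := M) (T - 1)
    (fun k hk => by
      refine measurable_ofReal_mixtureMartingale q c (fun τ hτ => ?_) fun τ hτ => ?_ <;>
        rw [Finset.mem_Ico] at hτ
      · exact (hφ τ (Finset.mem_Icc.2 (by omega))).mono (ℱ.mono (by omega)) le_rfl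
      · exact (hη τ (Finset.mem_Icc.2 (by omega))).mono (ℱ.mono (by omega)) le_rfl)
    (fun k hk A hA => by
      have hk1 : k + 1 ∈ Finset.Icc 1 T := Finset.mem_Icc.2 (by omega)
      refine setLIntegral_mixtureMartingale_succ_le hq hc (ℱ.le k) (by omega) (fun τ hτ => ?_)
        (fun τ hτ => ?_) (Measurable.mono (hη _ hk1) (ℱ.le (k + 1)) le_rfl) (hint _ hk1) (hsub _ hk1) hA
      · rw [Finset.mem_Icc] at hτ
        exact (hφ τ (Finset.mem_Icc.2 (by omega))).mono (ℱ.mono (by omega)) le_rfl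
      · rw [Finset.mem_Ico] at hτ
        exact (hη τ (Finset.mem_Icc.2 (by omega))).mono (ℱ.mono (by omega)) le_rfl)
    (ENNReal.ofReal (1 / δ))
  have h0 : ∫⁻ ω, M 0 ω ∂P = 1 := by simp [hM, mixtureMartingale_one q hc]
  rw [h0] at hville
  have hle : P {ω | ∃ k ≤ T - 1, ENNReal.ofReal (1 / δ) ≤ M k ω} ≤ ENNReal.ofReal δ := by
    have h1 : ENNReal.ofReal δ * ENNReal.ofReal (1 / δ) = 1 := by
      rw [← ENNReal.ofReal_mul hδ.le, mul_one_div_cancel hδ.ne', ENNReal.ofReal_one]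
    calc P {ω | ∃ k ≤ T - 1, ENNReal.ofReal (1 / δ) ≤ M k ω}
        = ENNReal.ofReal δ * (ENNReal.ofReal (1 / δ) *
            P {ω | ∃ k ≤ T - 1, ENNReal.ofReal (1 / δ) ≤ M k ω}) := by rw [← mul_assoc, h1, one_mul]
      _ ≤ ENNReal.ofReal δ * 1 := by gcongr
      _ = _ := mul_one _
  refine (measure_mono fun ω hω => ?_).trans hle
  simp only [Set.mem_ofPred_eq, not_forall, not_le] at hω ⊢
  obtain ⟨t, ht, hlt⟩ := hω
  rw [Finset.mem_Icc] at ht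
  refine ⟨t - 1, by omega, ENNReal.ofReal_le_ofReal ?_⟩
  rw [Nat.sub_add_cancel ht.1, mixtureMartingale]
  set D := (designMatrix c (fun τ => φ τ ω) t).det / c ^ Fintype.card n
  have hD : 0 < D := div_pos (posDef_designMatrix hc _ t).det_pos (by positivity)
  set Q := (∑ τ ∈ Finset.Ico 1 t, η τ ω • φ τ ω) ⬝ᵥ
        (designMatrix c (fun τ => φ τ ω) t)⁻¹ *ᵥ (∑ τ ∈ Finset.Ico 1 t, η τ ω • φ τ ω)
  have h1 : Real.log D / 2 + Real.log (1 / δ) ≤ Q / (2 * q) := by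
    rw [le_div_iff₀ (by positivity)]; linarith
  have h2 : (√D)⁻¹ = Real.exp (-(Real.log D / 2)) := by
    rw [Real.exp_neg, ← Real.log_sqrt hD.le, Real.exp_log (Real.sqrt_pos.2 hD)]
  rw [h2, ← Real.exp_add]
  calc 1 / δ = Real.exp (Real.log (1 / δ)) := (Real.exp_log (by positivity)).symm
    _ ≤ _ := Real.exp_le_exp.2 (by linarith)

end SelfNormalized

/-! ### Kernels with a spectral density, and their Hilbert spaces -/

section Kernel

open Matrix

variable {d : ℕ} {k : (Fin d → ℝ) → (Fin d → ℝ) → ℝ}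

theorem HasProductSpectralDensity.integrable_prod {p : Fin d → ℝ → ℝ}
    (h : HasProductSpectralDensity k p) :
    Integrable fun ω : Fin d → ℝ => ∏ j, p j (ω j) :=
  Integrable.fintype_prod fun j => h.integrable j

theorem HasProductSpectralDensity.continuous {p : Fin d → ℝ → ℝ}
    (h : HasProductSpectralDensity k p) :
    Continuous fun z : (Fin d → ℝ) × (Fin d → ℝ) => k z.1 z.2 := by
  simp_rw [h.eq_integral]
  refine continuous_of_dominated (bound := fun ω : Fin d → ℝ => ∏ j, p j (ω j))
    (fun z => ?_) (fun z => ae_of_all _ fun ω => ?_) h.integrable_prod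
    (ae_of_all _ fun ω => by fun_prop)
  · exact (Continuous.aestronglyMeasurable (by fun_prop)).mul h.integrable_prod.1
  · have h0 : 0 ≤ ∏ j, p j (ω j) := Finset.prod_nonneg fun j _ => h.nonneg j _
    rw [norm_mul, Real.norm_eq_abs, Real.norm_eq_abs, abs_of_nonneg h0]
    exact mul_le_of_le_one_left h0 (Real.abs_cos_le_one _)

theorem HasProductSpectralDensity.apply_self {p : Fin d → ℝ → ℝ}
    (h : HasProductSpectralDensity k p) (x : Fin d → ℝ) : k x x = k 0 0 := by
  rw [h.eq_integral, h.eq_integral]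
  simp

variable {ℋ : Type v} [NormedAddCommGroup ℋ] [InnerProductSpace ℝ ℋ] [CompleteSpace ℋ]
  [RKHS ℝ ℋ (UnitCube d) ℝ]

theorem IsRKHSOf.inner_kerFun_kerFun (h : IsRKHSOf ℋ k) (x y : UnitCube d) :
    inner ℝ (RKHS.kerFun ℋ x (1 : ℝ)) (RKHS.kerFun ℋ y (1 : ℝ)) = k x y := by
  rw [RKHS.kerFun_inner, RKHS.kerFun_apply, h x y]
  simp

theorem RKHS.inner_kerFun_one (f : ℋ) (x : UnitCube d) :
    inner ℝ (RKHS.kerFun ℋ x (1 : ℝ)) f = f x := by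
  rw [RKHS.kerFun_inner]
  simp

theorem IsRKHSOf.quadForm_eq (h : IsRKHSOf ℋ k) {N : ℕ} (a : Fin N → UnitCube d)
    (c : Fin N → ℝ) : c ⬝ᵥ kernelMatrix k a *ᵥ c =
      ‖∑ i, c i • RKHS.kerFun ℋ (a i) (1 : ℝ)‖ ^ 2 := by
  rw [← real_inner_self_eq_norm_sq, sum_inner]
  simp only [dotProduct, mulVec]
  refine Finset.sum_congr rfl fun i _ => ?_
  rw [real_inner_smul_left, inner_sum]
  congr 1
  refine Finset.sum_congr rfl fun j _ => ?_
  rw [real_inner_smul_right, h.inner_kerFun_kerFun]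
  simp [kernelMatrix, mul_comm]

theorem IsRKHSOf.symm (h : IsRKHSOf ℋ k) (x y : UnitCube d) : k x y = k y x := by
  rw [← h.inner_kerFun_kerFun, ← h.inner_kerFun_kerFun, real_inner_comm]

theorem IsRKHSOf.posSemidef_kernelMatrix (h : IsRKHSOf ℋ k) {N : ℕ} (a : Fin N → UnitCube d) :
    (kernelMatrix k a).PosSemidef := by
  refine posSemidef_of_quadForm_nonneg (Matrix.ext fun i j => ?_) fun c => ?_
  · exact h.symm _ _
  · rw [h.quadForm_eq]; positivity

/-- Only the upper bound on k is given; the lower one comes from Cauchy-Schwarz in the RKHS. -/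
theorem IsRKHSOf.abs_le_one (h : IsRKHSOf ℋ k) (h1 : ∀ x y, k x y ≤ 1) (x y : UnitCube d) :
    |k x y| ≤ 1 := by
  have hn : ∀ z : UnitCube d, ‖RKHS.kerFun ℋ z (1 : ℝ)‖ ≤ 1 := fun z => by
    have : ‖RKHS.kerFun ℋ z (1 : ℝ)‖ ^ 2 ≤ 1 := by
      rw [← real_inner_self_eq_norm_sq, h.inner_kerFun_kerFun]; exact h1 _ _
    nlinarith [norm_nonneg (RKHS.kerFun ℋ z (1 : ℝ))]
  rw [← h.inner_kerFun_kerFun]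
  exact (abs_real_inner_le_norm _ _).trans
    (mul_le_one₀ (hn x) (norm_nonneg _) (hn y))

/-- Finitely many values of a function of norm at most `B` are dominated by the kernel matrix. -/
theorem IsRKHSOf.sq_dotProduct_le (h : IsRKHSOf ℋ k) {f : ℋ} {B : ℝ} (hf : ‖f‖ ≤ B) {N : ℕ}
    (a : Fin N → UnitCube d) (c : Fin N → ℝ) :
    (c ⬝ᵥ fun i => f (a i)) ^ 2 ≤ B ^ 2 * (c ⬝ᵥ kernelMatrix k a *ᵥ c) := by
  have h1 : (c ⬝ᵥ fun i => f (a i)) = inner ℝ (∑ i, c i • RKHS.kerFun ℋ (a i) (1 : ℝ)) f := by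
    rw [sum_inner]
    refine Finset.sum_congr rfl fun i _ => ?_
    rw [real_inner_smul_left, RKHS.inner_kerFun_one]
  rw [h1, h.quadForm_eq, ← mul_pow, mul_comm B]
  refine sq_le_sq' ?_ ?_
  · have := (abs_le.1 (abs_real_inner_le_norm (∑ i, c i • RKHS.kerFun ℋ (a i) (1 : ℝ)) f)).1
    have := mul_le_mul_of_nonneg_left hf (norm_nonneg (∑ i, c i • RKHS.kerFun ℋ (a i) (1 : ℝ)))
    linarith
  · exact (real_inner_le_norm _ _).trans (by gcongr)

/-- Settles the degenerate case k(0,0) = 0, in which γ_T need not grow. -/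
theorem IsRKHSOf.apply_eq_zero (h : IsRKHSOf ℋ k) (f : ℋ) {x : UnitCube d} (hx : k x x = 0) :
    f x = 0 := by
  have h1 : RKHS.kerFun ℋ x (1 : ℝ) = 0 := by
    rw [← inner_self_eq_zero (𝕜 := ℝ), h.inner_kerFun_kerFun, hx]
  rw [← RKHS.inner_kerFun_one, h1, inner_zero_left]

end Kernel

/-! ### The maximum information gain -/

section MaxInfoGain

open Matrix Filter Topology

variable {d T : ℕ} {k : (Fin d → ℝ) → (Fin d → ℝ) → ℝ} {ρ : ℝ}

theorem posDef_add_kernelMatrix (hρ : 0 < ρ) {a : Fin T → UnitCube d}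
    (hk : (kernelMatrix k a).PosSemidef) : (ρ ^ 2 • 1 + kernelMatrix k a).PosDef :=
  (posDef_smul_one (by positivity)).add_posSemidef hk

theorem isHermitian_smul_one (c : ℝ) : (c • (1 : Matrix (Fin T) (Fin T) ℝ)).IsHermitian := by
  simp [IsHermitian]

theorem log_det_add_kernelMatrix_le (hρ : 0 < ρ) {a : Fin T → UnitCube d}
    (hk : (kernelMatrix k a).PosSemidef) (h1 : ∀ x y : UnitCube d, |k x y| ≤ 1) :
    Real.log (ρ ^ 2 • 1 + kernelMatrix k a).det ≤ Real.log ((ρ ^ 2 + T) ^ T) := by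
  have h2 : ((ρ ^ 2 + T) • 1 - (ρ ^ 2 • 1 + kernelMatrix k a)).PosSemidef := by
    refine posSemidef_of_quadForm_nonneg ?_ fun c => ?_
    · have := ((isHermitian_smul_one (T := T) (ρ ^ 2 + T)).sub
        ((isHermitian_smul_one (T := T) (ρ ^ 2)).add hk.1))
      simpa [IsHermitian, IsSymm] using this
    · have := (abs_le.1 (quadForm_le_of_abs_le (E := kernelMatrix k a) (ε := 1)
        (fun i j => h1 (a i) (a j)) c zero_le_one)).2
      simp only [sub_mulVec, add_mulVec, dotProduct_sub, dotProduct_add, smul_mulVec, one_mulVec,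
        dotProduct_smul, smul_eq_mul]
      linarith
  have h3 := (posDef_add_kernelMatrix hρ hk).log_det_mono h2
  rwa [det_smul, det_one, mul_one, Fintype.card_fin] at h3

/-- Makes the real `sSup` in `maxInfoGain` a genuine supremum instead of its default value 0; a
crude bound suffices. -/
theorem bddAbove_infoGain (hρ : 0 < ρ)
    (hk : ∀ a : Fin T → UnitCube d, (kernelMatrix k a).PosSemidef)
    (h1 : ∀ x y : UnitCube d, |k x y| ≤ 1) :
    BddAbove {g | ∃ a : Fin T → UnitCube d, Function.Injective a ∧ g = infoGain k ρ a} := by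
  refine ⟨(Real.log ((ρ ^ 2 + T) ^ T) - Real.log ((ρ ^ 2) ^ T)) / 2, ?_⟩
  rintro _ ⟨a, -, rfl⟩
  rw [infoGain_eq_log_det hρ (hk a)]
  have := log_det_add_kernelMatrix_le hρ (hk a) h1
  linarith

/-- The points `(1 - s) a_i + s (i / T, …, i / T)`. -/
noncomputable def perturbedPoints (a : Fin T → UnitCube d) (s : Set.Icc (0 : ℝ) 1) (i : Fin T) : UnitCube d :=
  ⟨fun j => (1 - s) * (a i : Fin d → ℝ) j + s * ((i : ℕ) / (T : ℝ)), by
    have hT : (0 : ℝ) < T := by exact_mod_cast i.pos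
    have hi : ((i : ℕ) : ℝ) / T ≤ 1 := by
      rw [div_le_one hT]; exact_mod_cast i.2.le
    have hi0 : 0 ≤ ((i : ℕ) : ℝ) / T := by positivity
    have hs0 := s.2.1
    have hs1 := s.2.2
    refine ⟨fun j => ?_, fun j => ?_⟩
    · have := (a i).2.1 j
      simp only [Pi.zero_apply] at this ⊢
      have := mul_nonneg (sub_nonneg.2 hs1) this
      positivity
    · have := (a i).2.2 j
      simp only [Pi.one_apply] at this ⊢
      nlinarith [mul_le_mul_of_nonneg_left this (sub_nonneg.2 hs1),
        mul_le_mul_of_nonneg_left hi hs0]⟩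

theorem continuous_perturbedPoints (a : Fin T → UnitCube d) :
    Continuous fun s => perturbedPoints a s := by
  refine continuous_pi fun i => Continuous.subtype_mk (continuous_pi fun j => ?_) _
  fun_prop

theorem perturbedPoints_zero (a : Fin T → UnitCube d) :
    perturbedPoints a 0 = a := by
  ext i j
  simp [perturbedPoints]

/-- Coinciding points are separated for every s ≠ 0 by the drift i / T, which needs a coordinate and
hence d > 0. Points already distinct stay distinct near s = 0 by continuity. -/
theorem eventually_injective_perturbedPoints (hd : 0 < d) (a : Fin T → UnitCube d) :
    ∀ᶠ s in 𝓝[≠] (0 : Set.Icc (0 : ℝ) 1), Function.Injective (perturbedPoints a s) := by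
  have key : ∀ i i' : Fin T, i ≠ i' → ∀ᶠ s in 𝓝[≠] (0 : Set.Icc (0 : ℝ) 1),
      perturbedPoints a s i ≠ perturbedPoints a s i' := by
    intro i i' hne
    by_cases hai : a i = a i'
    · refine eventually_nhdsWithin_of_forall fun s hs h => hs ?_
      have hT : (T : ℝ) ≠ 0 := by exact_mod_cast i.pos.ne'
      have h1 := congrFun (congrArg Subtype.val h) ⟨0, hd⟩
      simp only [perturbedPoints, hai, add_right_inj] at h1
      have h2 : (s : ℝ) * (((i : ℕ) : ℝ) - ((i' : ℕ) : ℝ)) = 0 := by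
        field_simp at h1
        linarith
      rcases mul_eq_zero.1 h2 with h3 | h3
      · exact Subtype.ext h3
      · exact absurd (Fin.ext (by exact_mod_cast sub_eq_zero.1 h3)) hne
    · have hc := continuous_perturbedPoints a
      have h1 : IsOpen {s | perturbedPoints a s i ≠ perturbedPoints a s i'} :=
        isOpen_ne_fun ((continuous_apply i).comp hc) ((continuous_apply i').comp hc)
      exact nhdsWithin_le_nhds (h1.mem_nhds (by simpa [perturbedPoints_zero] using hai))
  have h2 : ∀ᶠ s in 𝓝[≠] (0 : Set.Icc (0 : ℝ) 1), ∀ i i' : Fin T, i ≠ i' →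
      perturbedPoints a s i ≠ perturbedPoints a s i' := by
    rw [eventually_all]; intro i
    rw [eventually_all]; intro i'
    by_cases h : i = i'
    · simp [h]
    · simpa [h] using key i i' h
  filter_upwards [h2] with s hs i i' h
  by_contra hne
  exact hs i i' hne h

/-- The information gain of arbitrary, possibly repeated, points is at most `maxInfoGain`. -/
theorem log_det_le_maxInfoGain (hd : 0 < d) (hρ : 0 < ρ)
    (hk : ∀ a : Fin T → UnitCube d, (kernelMatrix k a).PosSemidef)
    (h1 : ∀ x y : UnitCube d, |k x y| ≤ 1)
    (hc : Continuous fun z : (Fin d → ℝ) × (Fin d → ℝ) => k z.1 z.2) (a : Fin T → UnitCube d) :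
    (Real.log (ρ ^ 2 • 1 + kernelMatrix k a).det - Real.log ((ρ ^ 2) ^ T)) / 2 ≤
      maxInfoGain k ρ T := by
  set G : (Fin T → UnitCube d) → ℝ := fun a =>
    (Real.log (ρ ^ 2 • 1 + kernelMatrix k a).det - Real.log ((ρ ^ 2) ^ T)) / 2 with hG
  have hK : Continuous fun a : Fin T → UnitCube d => kernelMatrix k a := by
    refine continuous_pi fun i => continuous_pi fun j => ?_
    exact hc.comp ((continuous_subtype_val.comp (continuous_apply i)).prodMk
      (continuous_subtype_val.comp (continuous_apply j)))
  have hGc : Continuous G := by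
    refine ((Continuous.log ?_ fun a => ?_).sub continuous_const).div_const 2
    · exact (continuous_const.add hK).matrix_det
    · exact (posDef_add_kernelMatrix hρ (hk a)).det_pos.ne'
  -- The log-determinant is continuous in the points, so the bound for distinct configurations
  -- passes to the limit s → 0.
  have hlim : Tendsto (fun s => G (perturbedPoints a s)) (𝓝[≠] 0) (𝓝 (G a)) := by
    have := (hGc.comp (continuous_perturbedPoints a)).tendsto 0
    simp only [Function.comp_apply, perturbedPoints_zero] at this
    exact this.mono_left nhdsWithin_le_nhds
  have hne : (𝓝[≠] (0 : Set.Icc (0 : ℝ) 1)).NeBot := by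
    rw [← mem_closure_iff_nhdsWithin_neBot, Metric.mem_closure_iff]
    intro ε hε
    refine ⟨⟨min (ε / 2) 1, by positivity, min_le_right _ _⟩, ?_, ?_⟩
    · intro h
      have h' := congrArg Subtype.val h
      have : (0 : ℝ) < min (ε / 2) 1 := by positivity
      exact this.ne' h'
    · rw [Subtype.dist_eq, Real.dist_eq]
      have h3 : (0 : ℝ) < min (ε / 2) 1 := by positivity
      change |0 - min (ε / 2) 1| < ε
      rw [zero_sub, abs_neg, abs_of_pos h3]
      exact (min_le_left _ _).trans_lt (by linarith)
  refine le_of_tendsto hlim ?_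
  filter_upwards [eventually_injective_perturbedPoints hd a] with s hs
  exact le_csSup (bddAbove_infoGain hρ hk h1) ⟨_, hs, (infoGain_eq_log_det hρ (hk _)).symm⟩

/-- T copies of the origin have a rank-one kernel matrix, whose gain is explicit. The bound makes
γ_T exceed 1 for large T when k(0,0) > 0. -/
theorem log_one_add_le_maxInfoGain (hd : 0 < d) (hT : 0 < T) (hρ : 0 < ρ)
    (hk : ∀ a : Fin T → UnitCube d, (kernelMatrix k a).PosSemidef)
    (h1 : ∀ x y : UnitCube d, |k x y| ≤ 1)
    (hc : Continuous fun z : (Fin d → ℝ) × (Fin d → ℝ) => k z.1 z.2) :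
    Real.log (1 + T * k 0 0 / ρ ^ 2) / 2 ≤ maxInfoGain k ρ T := by
  set z : UnitCube d := ⟨0, le_rfl, zero_le_one⟩ with hz
  have h00 : 0 ≤ k 0 0 := by
    have := (hk fun _ => z).diag_nonneg (i := ⟨0, hT⟩)
    simpa [kernelMatrix] using this
  refine le_trans (le_of_eq ?_) (log_det_le_maxInfoGain hd hρ hk h1 hc fun _ => z)
  set v : Fin T → ℝ := fun _ => √(k 0 0) with hv
  have h3 : kernelMatrix k (fun _ : Fin T => z) = vecMulVec v v := by
    ext i j
    simp [kernelMatrix, vecMulVec_apply, hv, hz, Real.mul_self_sqrt h00]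
  have h4 : (0 : ℝ) < ρ ^ 2 := by positivity
  rw [h3, (posDef_smul_one h4).det_add_vecMulVec, quadForm_inv_smul_one h4, det_smul, det_one,
    mul_one, Fintype.card_fin]
  have h5 : v ⬝ᵥ v = T * k 0 0 := by simp [dotProduct, hv, Real.mul_self_sqrt h00]
  rw [h5, Real.log_mul (by positivity) (by positivity)]
  ring

end MaxInfoGain

/-! ### Spectral bounds for the perturbation matrices -/

section Spectral

open Matrix
open scoped RealInnerProductSpace

variable {n : Type} [Fintype n] [DecidableEq n]

theorem dotProduct_mulVec_le_norm (S : Matrix n n ℝ) (a : n → ℝ) :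
    a ⬝ᵥ S *ᵥ a ≤ ‖toEuclideanCLM (𝕜 := ℝ) S‖ * (a ⬝ᵥ a) := by
  set z : EuclideanSpace ℝ n := WithLp.toLp 2 a with hz
  have h1 : a ⬝ᵥ S *ᵥ a = ⟪z, toEuclideanCLM (𝕜 := ℝ) S z⟫ := (inner_toEuclideanCLM S z z).symm
  have h2 : a ⬝ᵥ a = ‖z‖ ^ 2 := by
    rw [EuclideanSpace.real_norm_sq_eq]
    simp [hz, dotProduct, sq]
  rw [h1, h2, sq, ← mul_assoc, mul_comm]
  calc ⟪z, toEuclideanCLM (𝕜 := ℝ) S z⟫ ≤ ‖z‖ * ‖toEuclideanCLM (𝕜 := ℝ) S z‖ :=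
        real_inner_le_norm _ _
    _ ≤ ‖z‖ * (‖toEuclideanCLM (𝕜 := ℝ) S‖ * ‖z‖) := by
        gcongr; exact ContinuousLinearMap.le_opNorm _ _

theorem posSemidef_smul_one_sub {S : Matrix n n ℝ} (hS : S.IsHermitian) {c : ℝ}
    (h : ‖toEuclideanCLM (𝕜 := ℝ) S‖ ≤ c) : (c • 1 - S).PosSemidef := by
  refine posSemidef_of_quadForm_nonneg ?_ fun a => ?_
  · have : S.transpose = S := by simpa [IsHermitian] using hS
    simp [IsSymm, this]
  · rw [sub_mulVec, smul_mulVec, one_mulVec, dotProduct_sub, dotProduct_smul, smul_eq_mul]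
    have := mul_le_mul_of_nonneg_right h (dotProduct_self_nonneg' a)
    linarith [dotProduct_mulVec_le_norm S a]

/-- Duality with b = a gives ‖a‖⁴ ≤ (aᵀ S a)(aᵀ S⁻¹ a) ≤ (aᵀ S a) ‖a‖² / c. -/
theorem posSemidef_sub_smul_one {S : Matrix n n ℝ} (hS : S.PosDef) {c : ℝ} (hc : 0 < c)
    (h : ‖toEuclideanCLM (𝕜 := ℝ) S⁻¹‖ ≤ 1 / c) : (S - c • 1).PosSemidef := by
  refine posSemidef_of_quadForm_nonneg ?_ fun a => ?_
  · have : S.transpose = S := by simpa [IsHermitian] using hS.1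
    simp [IsSymm, this]
  · rw [sub_mulVec, smul_mulVec, one_mulVec, dotProduct_sub, dotProduct_smul, smul_eq_mul]
    have h0 := dotProduct_self_nonneg' a
    have h1 := hS.sq_dotProduct_le a a
    have h2 := (dotProduct_mulVec_le_norm S⁻¹ a).trans (mul_le_mul_of_nonneg_right h h0)
    have h3 := hS.posSemidef.quadForm_nonneg a
    have h4 := h1.trans (mul_le_mul_of_nonneg_left h2 h3)
    rcases h0.eq_or_lt with h5 | h5
    · rw [← h5]; simpa using h3
    · have h6 : a ⬝ᵥ a ≤ (a ⬝ᵥ S *ᵥ a) * (1 / c) := by nlinarith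
      rw [mul_one_div, le_div_iff₀ hc] at h6
      linarith

theorem posSemidef_dotProduct_smul_one_sub_vecMulVec (a : n → ℝ) :
    ((a ⬝ᵥ a) • (1 : Matrix n n ℝ) - vecMulVec a a).PosSemidef := by
  refine posSemidef_of_quadForm_nonneg ?_ fun b => ?_
  · have : (vecMulVec a a).transpose = vecMulVec a a := by
      ext i j; simp [vecMulVec_apply, mul_comm]
    simp [IsSymm, this]
  · rw [sub_mulVec, smul_mulVec, one_mulVec, dotProduct_sub, dotProduct_smul, smul_eq_mul,
      dotProduct_vecMulVec_mulVec]
    have := (PosSemidef.one (R := ℝ) (n := n)).sq_dotProduct_mulVec_le a b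
    simp only [one_mulVec] at this
    linarith

end Spectral

/-! ### The elliptical potential -/

section EllipticalPotential

open Matrix

variable {n : Type} [Fintype n]

/-- The Gram and kernel matrices differ by at most T ε in the Loewner order, and the regulariser ρ²
turns this into a factor 1 + T ε / ρ², raised to the power T in the determinant. -/
theorem log_det_features_le {d T : ℕ} {k : (Fin d → ℝ) → (Fin d → ℝ) → ℝ} {ρ ε : ℝ} (hρ : 0 < ρ)
    (hε : 0 ≤ ε) {Φ : (Fin d → ℝ) → n → ℝ} (hΦ : UniformlyApproximates Φ k ε)
    {a : Fin T → UnitCube d} (hk : (kernelMatrix k a).PosSemidef) :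
    Real.log (ρ ^ 2 • 1 + Matrix.of fun i j : Fin T => Φ (a i) ⬝ᵥ Φ (a j)).det ≤
      T * (T * ε / ρ ^ 2) + Real.log (ρ ^ 2 • 1 + kernelMatrix k a).det := by
  have hρ2 : (0 : ℝ) < ρ ^ 2 := by positivity
  set G : Matrix (Fin T) (Fin T) ℝ := Matrix.of fun i j : Fin T => Φ (a i) ⬝ᵥ Φ (a j) with hG
  set δ := T * ε / ρ ^ 2 with hδ
  have hδ0 : 0 ≤ δ := by positivity
  have hGpsd : G.PosSemidef := by
    set A : Matrix n (Fin T) ℝ := Matrix.of fun i j => Φ (a j) i with hA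
    have : G = Aᴴ * A := by ext i j; simp [hG, hA, mul_apply, dotProduct]
    rw [this]
    exact posSemidef_conjTranspose_mul_self A
  have hGpd : (ρ ^ 2 • 1 + G).PosDef := (posDef_smul_one hρ2).add_posSemidef hGpsd
  have hKpd := posDef_add_kernelMatrix hρ hk
  have h1 : ((1 + δ) • (ρ ^ 2 • 1 + kernelMatrix k a) - (ρ ^ 2 • 1 + G)).PosSemidef := by
    refine posSemidef_of_quadForm_nonneg ?_ fun c => ?_
    · have h2 := hGpd.1
      have h3 := hKpd.1
      simp only [IsHermitian, conjTranspose_eq_transpose_of_trivial] at h2 h3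
      rw [IsSymm, transpose_sub, transpose_smul, h2, h3]
    · have h2 := (abs_le.1 (quadForm_le_of_abs_le (E := kernelMatrix k a - G) (ε := ε)
        (fun i j => hΦ (a i) (a j)) c hε)).1
      have h3 := hk.quadForm_nonneg c
      have h4 : δ * (ρ ^ 2 * (c ⬝ᵥ c)) = T * ε * (c ⬝ᵥ c) := by rw [hδ]; field_simp
      simp only [sub_mulVec, add_mulVec, dotProduct_sub, dotProduct_add, smul_mulVec, one_mulVec,
        dotProduct_smul, smul_eq_mul] at h2 ⊢
      nlinarith [mul_nonneg hδ0 h3]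
  have h2 := hGpd.log_det_mono h1
  rw [det_smul, Real.log_mul (by positivity) hKpd.det_pos.ne', Real.log_pow, Fintype.card_fin] at h2
  have h3 : Real.log (1 + δ) ≤ δ := by
    have := Real.log_le_sub_one_of_pos (by linarith : 0 < 1 + δ); linarith
  have h4 : (T : ℝ) * Real.log (1 + δ) ≤ T * δ := by gcongr
  linarith

variable [DecidableEq n]

/-- Each rank-one update multiplies the determinant by 1 + u, so the log-determinant telescopes.
Here u ≤ U because the design matrix dominates c I, and then u ≤ (1 + U) log(1 + u). -/
theorem sum_quadForm_inv_designMatrix_le {c U : ℝ} (hc : 0 < c) {φ : ℕ → n → ℝ} {T : ℕ}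
    (hU : ∀ t ∈ Finset.Icc 1 T, φ t ⬝ᵥ φ t ≤ U * c) :
    ∑ t ∈ Finset.Icc 1 T, φ t ⬝ᵥ (designMatrix c φ t)⁻¹ *ᵥ φ t ≤
      (1 + U) * (Real.log (designMatrix c φ (T + 1)).det - Real.log (c ^ Fintype.card n)) := by
  induction T with
  | zero => simp [designMatrix_one]
  | succ T ih =>
    have ih' := ih fun t ht => hU t (Finset.Icc_subset_Icc_right T.le_succ ht)
    rw [Finset.sum_Icc_succ_top (by omega), designMatrix_succ c φ (by omega : 1 ≤ T + 1)]
    have hW := posDef_designMatrix hc φ (T + 1)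
    set W := designMatrix c φ (T + 1) with hWdef
    set u := φ (T + 1) ⬝ᵥ W⁻¹ *ᵥ φ (T + 1) with hu
    have hu0 : 0 ≤ u := hW.quadForm_inv_nonneg _
    have huU : u ≤ U := by
      refine (hW.quadForm_inv_le_div hc ?_ _).trans
        ((div_le_iff₀ hc).2 (hU _ (Finset.right_mem_Icc.2 (by omega))))
      rw [hWdef, designMatrix, add_sub_cancel_left]
      exact posSemidef_sum _ fun τ _ => posSemidef_vecMulVec_self (φ τ)
    have hlog : u ≤ (1 + U) * Real.log (1 + u) := by
      have h1 := Real.one_sub_inv_le_log_of_pos (by linarith : 0 < 1 + u)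
      have h2 : 1 - (1 + u)⁻¹ = u / (1 + u) := by field_simp; ring
      rw [h2, div_le_iff₀ (by linarith)] at h1
      have h3 : 0 ≤ Real.log (1 + u) := Real.log_nonneg (by linarith)
      nlinarith
    rw [hW.det_add_vecMulVec, ← hu, Real.log_mul hW.det_pos.ne' (by linarith)]
    linarith

/-- The identity det(1 + A B) = det(1 + B A) passes from the feature dimension to the T × T Gram
matrix, where comparison with the kernel is possible. -/
theorem log_det_designMatrix_eq {c : ℝ} (hc : 0 < c) (φ : ℕ → n → ℝ) (T : ℕ) :
    Real.log (designMatrix c φ (T + 1)).det - Real.log (c ^ Fintype.card n) =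
      Real.log (c • 1 + Matrix.of fun i j : Fin T => φ (i + 1) ⬝ᵥ φ (j + 1)).det -
        Real.log (c ^ T) := by
  set A : Matrix n (Fin T) ℝ := Matrix.of fun i j => φ (j + 1) i with hA
  have h1 : designMatrix c φ (T + 1) = c • (1 + (c⁻¹ • A) * Aᵀ) := by
    rw [designMatrix, smul_add, smul_mul, smul_smul, mul_inv_cancel₀ hc.ne', one_smul]
    congr 1
    ext i j
    rw [Matrix.sum_apply, mul_apply, Finset.sum_Ico_eq_sum_range, Finset.sum_range]
    exact Finset.sum_congr rfl fun l _ => by simp [vecMulVec_apply, hA, add_comm]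
  have h2 : (c • 1 + Matrix.of fun i j : Fin T => φ (i + 1) ⬝ᵥ φ (j + 1)) =
      c • (1 + Aᵀ * (c⁻¹ • A)) := by
    rw [smul_add, Matrix.mul_smul, smul_smul, mul_inv_cancel₀ hc.ne', one_smul]
    congr 1
  have h3 : (1 + (c⁻¹ • A) * Aᵀ).det = (1 + Aᵀ * (c⁻¹ • A)).det := det_one_add_mul_comm _ _
  have h4 : 0 < (1 + (c⁻¹ • A) * Aᵀ).det := by
    have := (posDef_designMatrix hc φ (T + 1)).det_pos
    rw [h1, det_smul] at this
    exact pos_of_mul_pos_right this (by positivity)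
  rw [h1, h2, det_smul, det_smul, ← h3, Real.log_mul (by positivity) h4.ne',
    Real.log_mul (by positivity) h4.ne', Fintype.card_fin]
  ring

end EllipticalPotential

/-! ### Confidence widths -/

section Confidence

open Matrix

variable {d : ℕ} {n : Type} [Fintype n] [DecidableEq n] {Φ : (Fin d → ℝ) → n → ℝ}
  {x : ℕ → UnitCube d} {H : ℕ → Matrix n n ℝ} {t : ℕ} {lam : ℝ}

theorem ucbV_eq_designMatrix_add {n : Type} [DecidableEq n] {Φ : (Fin d → ℝ) → n → ℝ}
    {H : ℕ → Matrix n n ℝ} (c : ℝ) :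
    ucbV Φ lam x H t = designMatrix (lam + c) (fun τ => Φ (x τ)) t + (H t - c • 1) := by
  rw [ucbV, designMatrix, add_smul]
  abel

theorem ucbV_eq_designMatrix_add' {n : Type} [DecidableEq n] {Φ : (Fin d → ℝ) → n → ℝ}
    {H : ℕ → Matrix n n ℝ} :
    ucbV Φ lam x H t = designMatrix lam (fun τ => Φ (x τ)) t + H t := by
  simpa using ucbV_eq_designMatrix_add (Φ := Φ) (lam := lam) (x := x) (H := H) (t := t) 0

theorem posDef_ucbV (hlam : 0 < lam) (hH : (H t).PosSemidef) : (ucbV Φ lam x H t).PosDef := by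
  rw [ucbV_eq_designMatrix_add']
  exact (posDef_designMatrix hlam _ t).add_posSemidef hH

theorem posSemidef_ucbV_sub_smul_one (hH : (H t).PosSemidef) :
    (ucbV Φ lam x H t - lam • 1).PosSemidef := by
  rw [ucbV, add_sub_cancel_right]
  exact (posSemidef_sum _ fun τ _ => posSemidef_vecMulVec_self _).add hH

theorem ellNorm_inv_ucbV_le (hlam : 0 < lam) (hH : (H t).PosSemidef) {b : n → ℝ}
    (hb : b ⬝ᵥ b ≤ 2) : ellNorm (ucbV Φ lam x H t)⁻¹ b ≤ √(2 / lam) := by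
  refine Real.sqrt_le_sqrt (((posDef_ucbV hlam hH).quadForm_inv_le_div hlam
    (posSemidef_ucbV_sub_smul_one hH) b).trans ?_)
  gcongr

/-- The standing assumptions on the inputs of the algorithm. -/
structure UCBParams.Admissible (par : UCBParams) : Prop where
  ρ_pos : 0 < par.ρ
  lam_pos : 0 < par.lam
  lam_le : par.lam ≤ par.ρ ^ 2
  B_nonneg : 0 ≤ par.B
  ε_nonneg : 0 ≤ par.ε
  lamMin_pos : 0 < par.lamMin
  lamMax_nonneg : 0 ≤ par.lamMax

/-- The event on which the perturbations of round `t` obey their bounds and the noise obeys the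
self-normalized bound. -/
structure GoodRound (par : UCBParams) (Φ : (Fin d → ℝ) → n → ℝ) (x : ℕ → UnitCube d) (η : ℕ → ℝ)
    (H : ℕ → Matrix n n ℝ) (h : ℕ → n → ℝ) (t : ℕ) : Prop where
  posDef : (H t).PosDef
  lamMin_le : (H t - par.lamMin • 1).PosSemidef
  le_lamMax : (par.lamMax • 1 - H t).PosSemidef
  ellNorm_le : ellNorm (H t)⁻¹ (h t) ≤ par.κ
  noise_le : (∑ τ ∈ Finset.Ico 1 t, η τ • Φ (x τ)) ⬝ᵥ
      (designMatrix (par.lam + par.lamMin) (fun τ => Φ (x τ)) t)⁻¹ *ᵥ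
        (∑ τ ∈ Finset.Ico 1 t, η τ • Φ (x τ)) ≤
    par.ρ ^ 2 * (Real.log ((designMatrix (par.lam + par.lamMin) (fun τ => Φ (x τ)) t).det /
      (par.lam + par.lamMin) ^ Fintype.card n) + 2 * Real.log (2 / par.ζ))

/-- The estimate of the reward by features has width `β_t^{1/2} ‖·‖_{V_t⁻¹}`, up to an error
caused by misspecification. -/
theorem abs_sub_ucbTheta_dotProduct_le {par : UCBParams} (hpar : par.Admissible)
    {h : ℕ → n → ℝ} {F η : ℕ → ℝ} (hgood : GoodRound par Φ x η H h t)
    {θ : n → ℝ} (hθ : θ ⬝ᵥ θ ≤ par.B ^ 2) {e : ℝ}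
    (hF : ∀ τ ∈ Finset.Ico 1 t, |F τ - θ ⬝ᵥ Φ (x τ)| ≤ e)
    (hφ : ∀ τ ∈ Finset.Ico 1 t, Φ (x τ) ⬝ᵥ Φ (x τ) ≤ 2) (b : n → ℝ) :
    |(ucbTheta Φ par.lam x (fun τ => F τ + η τ) H h t - θ) ⬝ᵥ b| ≤
      (par.ρ * ucbBetaSqrt par Φ x H t + (∑ _τ ∈ Finset.Ico 1 t, e) * √(2 / par.lam)) *
        ellNorm (ucbV Φ par.lam x H t)⁻¹ b := by
  obtain ⟨hρ, hlam, hlamρ, hB, hε, hmin0, hmax0⟩ := hpar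
  obtain ⟨hH, hmin, hmax, hh, hnoise⟩ := hgood
  have hV := posDef_ucbV (Φ := Φ) (x := x) hlam hH.posSemidef
  set V := ucbV Φ par.lam x H t with hVdef
  set c := par.lam + par.lamMin with hc
  have hc0 : 0 < c := by positivity
  have hW := posDef_designMatrix hc0 (fun τ => Φ (x τ)) t
  set W := designMatrix c (fun τ => Φ (x τ)) t with hWdef
  have hVW : (V - W).PosSemidef := by
    rw [hVdef, ucbV_eq_designMatrix_add par.lamMin, hWdef, hc, add_sub_cancel_left]
    exact hmin
  have hHl : (H t + par.lam • 1).PosDef := hH.add_posSemidef (posDef_smul_one hlam).posSemidef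
  have hVHl : (V - (H t + par.lam • 1)).PosSemidef := by
    rw [hVdef, ucbV, add_assoc, add_sub_cancel_right]
    exact posSemidef_sum _ fun τ _ => posSemidef_vecMulVec_self _
  have hVH : (V - H t).PosSemidef := by
    rw [hVdef, ucbV_eq_designMatrix_add', add_sub_cancel_right]
    exact (posDef_designMatrix hlam _ t).posSemidef
  set S := ∑ τ ∈ Finset.Ico 1 t, η τ • Φ (x τ) with hS
  set D := ∑ τ ∈ Finset.Ico 1 t, (F τ - θ ⬝ᵥ Φ (x τ)) • Φ (x τ) with hD
  -- The estimation error is V⁻¹ w, where w collects noise, misspecification, perturbation and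
  -- regularisation bias. Each summand is measured in the inverse of a matrix below V that suits it:
  -- W for the noise, λ I for the misspecification, H_t for h_t, and H_t + λ I for the bias.
  set w := S + D + h t + -((H t + par.lam • 1) *ᵥ θ) with hw
  have hdecomp : ucbTheta Φ par.lam x (fun τ => F τ + η τ) H h t - θ = V⁻¹ *ᵥ w := by
    have h1 : (∑ τ ∈ Finset.Ico 1 t, (F τ + η τ) • Φ (x τ)) + h t = V *ᵥ θ + w := by
      rw [hw, hVdef, ucbV, add_assoc (∑ τ ∈ _, _) (H t), add_mulVec, sum_mulVec, hS, hD]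
      have h2 : ∀ τ, vecMulVec (Φ (x τ)) (Φ (x τ)) *ᵥ θ = (θ ⬝ᵥ Φ (x τ)) • Φ (x τ) := by
        intro τ
        rw [vecMulVec_mulVec, dotProduct_comm]
        simp
      simp_rw [h2, sub_smul, add_smul]
      rw [Finset.sum_sub_distrib, Finset.sum_add_distrib]
      abel
    rw [ucbTheta, h1, ← hVdef, mulVec_add, hV.inv_mulVec_mulVec, add_sub_cancel_left]
  have hnorm : ellNorm V (V⁻¹ *ᵥ w) = ellNorm V⁻¹ w := by
    rw [← ellNorm_inv_mulVec hV, hV.mulVec_inv_mulVec]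
  rw [hdecomp]
  refine (abs_dotProduct_le_ellNorm hV _ b).trans ?_
  rw [hnorm]
  refine mul_le_mul_of_nonneg_right ?_ (ellNorm_nonneg _ _)
  have hVi := hV.inv.posSemidef
  have b1 : ellNorm V⁻¹ S ≤ par.ρ * √(Real.log (c⁻¹ • V).det + 2 * Real.log (2 / par.ζ)) := by
    refine (ellNorm_inv_antitone hW hV hVW S).trans ?_
    refine (Real.sqrt_le_sqrt hnoise).trans ?_
    rw [Real.sqrt_mul (by positivity), Real.sqrt_sq hρ.le]
    have h1 : W.det / c ^ Fintype.card n ≤ (c⁻¹ • V).det := by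
      rw [det_smul, inv_pow, div_eq_inv_mul]
      exact mul_le_mul_of_nonneg_left (hW.det_mono hVW) (by positivity)
    gcongr
    exact div_pos hW.det_pos (by positivity)
  have b2 : ellNorm V⁻¹ D ≤ (∑ _τ ∈ Finset.Ico 1 t, e) * √(2 / par.lam) := by
    refine (ellNorm_sum_le hVi _ _).trans ?_
    rw [Finset.sum_mul]
    refine Finset.sum_le_sum fun τ hτ => ?_
    rw [ellNorm_smul]
    exact mul_le_mul (hF τ hτ) (ellNorm_inv_ucbV_le hlam hH.posSemidef (hφ τ hτ))
      (ellNorm_nonneg _ _) ((abs_nonneg _).trans (hF τ hτ))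
  have b3 : ellNorm V⁻¹ (h t) ≤ par.κ := (ellNorm_inv_antitone hH hV hVH _).trans hh
  have b4 : ellNorm V⁻¹ (-((H t + par.lam • 1) *ᵥ θ)) ≤
      par.ρ * (par.B * √(par.lamMax / par.ρ ^ 2 + 1)) := by
    rw [ellNorm_neg]
    refine (ellNorm_inv_antitone hHl hV hVHl _).trans ?_
    rw [ellNorm_inv_mulVec hHl]
    have h1 : θ ⬝ᵥ (H t + par.lam • 1) *ᵥ θ ≤ (par.lamMax + par.lam) * (θ ⬝ᵥ θ) := by
      have := hmax.quadForm_nonneg θ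
      simp only [sub_mulVec, add_mulVec, dotProduct_sub, dotProduct_add, smul_mulVec, one_mulVec,
        dotProduct_smul, smul_eq_mul] at this ⊢
      linarith
    have h2 : (par.lamMax + par.lam) * (θ ⬝ᵥ θ) ≤ (par.lamMax + par.ρ ^ 2) * par.B ^ 2 :=
      mul_le_mul (by linarith) hθ (dotProduct_self_nonneg' θ) (by positivity)
    rw [ellNorm]
    refine (Real.sqrt_le_sqrt (h1.trans h2)).trans (le_of_eq ?_)
    have h3 : (par.lamMax + par.ρ ^ 2) * par.B ^ 2 =
        (par.ρ * par.B) ^ 2 * (par.lamMax / par.ρ ^ 2 + 1) := by field_simp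
    rw [h3, Real.sqrt_mul (by positivity), Real.sqrt_sq (by positivity)]
    ring
  -- Nonnegativity of this term of the multiplier is enough: the misspecification is carried
  -- separately, by `b2`.
  have b5 : 0 ≤ par.ρ * (t * par.B * par.ε / (par.ρ * √par.lamMin)) := by positivity
  have b6 : par.ρ * (par.κ / par.ρ) = par.κ := by field_simp
  have hsum : ellNorm V⁻¹ w ≤ ellNorm V⁻¹ S + ellNorm V⁻¹ D + ellNorm V⁻¹ (h t) +
      ellNorm V⁻¹ (-((H t + par.lam • 1) *ᵥ θ)) := by
    refine (ellNorm_add_le hVi _ _).trans ?_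
    gcongr
    refine (ellNorm_add_le hVi _ _).trans ?_
    gcongr
    exact ellNorm_add_le hVi _ _
  rw [ucbBetaSqrt, ← hVdef, ← hc]
  simp only [mul_add]
  linarith

end Confidence

/-! ### Regret on the good event -/

section Regret

open Matrix

variable {d : ℕ} {n : Type} [Fintype n] [DecidableEq n] {Φ : (Fin d → ℝ) → n → ℝ}
  {x : ℕ → UnitCube d} {η : ℕ → ℝ} {H : ℕ → Matrix n n ℝ} {h : ℕ → n → ℝ} {t T : ℕ}
  {par : UCBParams} {k : (Fin d → ℝ) → (Fin d → ℝ) → ℝ}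
  {ℋ : Type v} [NormedAddCommGroup ℋ] [InnerProductSpace ℝ ℋ] [CompleteSpace ℋ]
  [RKHS ℝ ℋ (UnitCube d) ℝ]

/-- Optimism: the index of a is at most that of x_t, so confidence bounds at both points leave twice
the width at x_t. The interpolation errors at a and x_t give the 2 in the last factor; the
misspecification inside the two confidence bounds gives 4 t / λ. -/
theorem instantaneous_regret_le (hpar : par.Admissible) (hgood : GoodRound par Φ x η H h t)
    (hℋ : IsRKHSOf ℋ k) {f : ℋ} (hf : ‖f‖ ≤ par.B) {ε : ℝ} (hε : 0 < ε)
    (happ : UniformlyApproximates Φ k ε) (hΦ : ∀ y : UnitCube d, Φ y ⬝ᵥ Φ y ≤ 2) (ht : 1 ≤ t)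
    {𝒟 : Set (UnitCube d)}
    (hmax : IsMaxOn (ucbIndex par Φ x (fun τ => f (x τ) + η τ) H h t) 𝒟 (x t))
    {a : UnitCube d} (ha : a ∈ 𝒟) :
    f a - f (x t) ≤
      2 * (par.ρ * ucbBetaSqrt par Φ x H t * ellNorm (ucbV Φ par.lam x H t)⁻¹ (Φ (x t))) +
        par.B * √((t + 1) * ε) * (2 + 4 * t / par.lam) := by
  -- Slot 0 holds the competitor a, slot i ≥ 1 the action x_i; a single θ must serve all of them.
  set z : Fin (t + 1) → UnitCube d := fun i => if (i : ℕ) = 0 then a else x i with hz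
  obtain ⟨θ, hθ, hθz⟩ := exists_weights_of_features (K := kernelMatrix k z) (fun i => Φ (z i))
    (fun i => f (z i)) hpar.B_nonneg hε (fun i j => happ (z i) (z j)) (hℋ.sq_dotProduct_le hf z)
  push_cast at hθz
  set e := par.B * √((t + 1) * ε) with he
  have he0 : 0 ≤ e := mul_nonneg hpar.B_nonneg (Real.sqrt_nonneg _)
  have hea : |f a - θ ⬝ᵥ Φ a| ≤ e := by simpa [hz] using hθz 0
  have hex : ∀ τ, 1 ≤ τ → τ ≤ t → |f (x τ) - θ ⬝ᵥ Φ (x τ)| ≤ e := fun τ h1 h2 => by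
    have := hθz ⟨τ, by omega⟩
    simpa [hz, show τ ≠ 0 by omega] using this
  have hconf := abs_sub_ucbTheta_dotProduct_le hpar hgood (F := fun τ => f (x τ)) hθ
    (fun τ hτ => hex τ (Finset.mem_Ico.1 hτ).1 (Finset.mem_Ico.1 hτ).2.le)
    (fun τ _ => hΦ (x τ))
  have ha1 := hconf (Φ a)
  have hx1 := hconf (Φ (x t))
  have hidx : ucbIndex par Φ x (fun τ => f (x τ) + η τ) H h t a ≤
      ucbIndex par Φ x (fun τ => f (x τ) + η τ) H h t (x t) := hmax ha
  simp only [ucbIndex] at hidx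
  set θ' := ucbTheta Φ par.lam x (fun τ => f (x τ) + η τ) H h t
  set β := ucbBetaSqrt par Φ x H t
  set σa := ellNorm (ucbV Φ par.lam x H t)⁻¹ (Φ a)
  set σx := ellNorm (ucbV Φ par.lam x H t)⁻¹ (Φ (x t))
  have hw : ∀ y : UnitCube d, ellNorm (ucbV Φ par.lam x H t)⁻¹ (Φ y) ≤ √(2 / par.lam) := fun y =>
    ellNorm_inv_ucbV_le hpar.lam_pos hgood.posDef.posSemidef (hΦ y)
  set r := (∑ _τ ∈ Finset.Ico 1 t, e) * √(2 / par.lam) with hr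
  have hr1 : r ≤ t * e * √(2 / par.lam) := by
    rw [hr, Finset.sum_const, nsmul_eq_mul, Nat.card_Ico]
    gcongr
    omega
  have hr0 : 0 ≤ r := mul_nonneg (Finset.sum_nonneg fun _ _ => he0) (Real.sqrt_nonneg _)
  have hlam := hpar.lam_pos
  have hrσ : ∀ y : UnitCube d, r * ellNorm (ucbV Φ par.lam x H t)⁻¹ (Φ y) ≤
      t * e * (2 / par.lam) := fun y => by
    calc r * ellNorm (ucbV Φ par.lam x H t)⁻¹ (Φ y)
        ≤ (t * e * √(2 / par.lam)) * √(2 / par.lam) :=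
          mul_le_mul hr1 (hw y) (ellNorm_nonneg _ _) (by positivity)
      _ = t * e * (2 / par.lam) := by rw [mul_assoc, Real.mul_self_sqrt (by positivity)]
  have hra : r * σa ≤ _ := hrσ a
  have hrx : r * σx ≤ _ := hrσ (x t)
  rw [sub_dotProduct] at ha1 hx1
  have h1 := (abs_le.1 hea).2
  have h2 := (abs_le.1 (hex t ht le_rfl)).1
  have h3 := (abs_le.1 ha1).1
  have h4 := (abs_le.1 hx1).2
  have h5 : e * (2 + 4 * t / par.lam) = 2 * e + 2 * (t * e * (2 / par.lam)) := by ring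
  rw [h5]
  linarith

/-- A crude bound by dimension: V_t ≤ (2T + lamMax + λ) I, since each feature vector has squared
norm at most 2. Dividing by λ + lamMin only helps compared with dividing by λ. -/
theorem log_det_ucbV_le (hpar : par.Admissible) (hgood : GoodRound par Φ x η H h t)
    (hΦ : ∀ y : UnitCube d, Φ y ⬝ᵥ Φ y ≤ 2) (htT : t ≤ T) :
    Real.log ((par.lam + par.lamMin)⁻¹ • ucbV Φ par.lam x H t).det ≤
      Fintype.card n * Real.log ((2 * T + par.lamMax + par.lam) / par.lam) := by
  have hlam := hpar.lam_pos
  have hmin := hpar.lamMin_pos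
  have hmax := hpar.lamMax_nonneg
  have hV := posDef_ucbV (Φ := Φ) (x := x) hlam hgood.posDef.posSemidef
  have hc : 0 < (par.lam + par.lamMin)⁻¹ := by positivity
  have hq : ∀ a : n → ℝ, a ⬝ᵥ ucbV Φ par.lam x H t *ᵥ a ≤
      (2 * T + par.lamMax + par.lam) * (a ⬝ᵥ a) := by
    intro a
    have h1 := hgood.le_lamMax.quadForm_nonneg a
    have h2 : a ⬝ᵥ (∑ τ ∈ Finset.Ico 1 t, vecMulVec (Φ (x τ)) (Φ (x τ))) *ᵥ a ≤
        2 * T * (a ⬝ᵥ a) := by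
      rw [sum_mulVec, dotProduct_sum]
      calc ∑ τ ∈ Finset.Ico 1 t, a ⬝ᵥ vecMulVec (Φ (x τ)) (Φ (x τ)) *ᵥ a
          ≤ ∑ _τ ∈ Finset.Ico 1 t, 2 * (a ⬝ᵥ a) := by
            refine Finset.sum_le_sum fun τ _ => ?_
            have h3 := (posSemidef_dotProduct_smul_one_sub_vecMulVec (Φ (x τ))).quadForm_nonneg a
            rw [sub_mulVec, smul_mulVec, one_mulVec, dotProduct_sub, dotProduct_smul,
              smul_eq_mul] at h3
            have h4 := mul_le_mul_of_nonneg_right (hΦ (x τ)) (dotProduct_self_nonneg' a)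
            linarith
        _ = ((t - 1 : ℕ) : ℝ) * (2 * (a ⬝ᵥ a)) := by
            rw [Finset.sum_const, nsmul_eq_mul, Nat.card_Ico]
        _ ≤ T * (2 * (a ⬝ᵥ a)) := by
            have := dotProduct_self_nonneg' a
            gcongr
            omega
        _ = _ := by ring
    simp only [ucbV, sub_mulVec, add_mulVec, dotProduct_sub, dotProduct_add, smul_mulVec,
      one_mulVec, dotProduct_smul, smul_eq_mul] at h1 ⊢
    linarith
  have hpsd : (((2 * T + par.lamMax + par.lam) / par.lam) • 1 -
      (par.lam + par.lamMin)⁻¹ • ucbV Φ par.lam x H t).PosSemidef := by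
    refine posSemidef_of_quadForm_nonneg ?_ fun a => ?_
    · have h1 := hV.1
      simp only [IsHermitian, conjTranspose_eq_transpose_of_trivial] at h1
      simp [IsSymm, h1]
    · simp only [sub_mulVec, dotProduct_sub, smul_mulVec, one_mulVec, dotProduct_smul, smul_eq_mul]
      have h0 := dotProduct_self_nonneg' a
      have h1 := mul_le_mul_of_nonneg_left (hq a) hc.le
      have h2 : (par.lam + par.lamMin)⁻¹ * ((2 * T + par.lamMax + par.lam) * (a ⬝ᵥ a)) ≤
          par.lam⁻¹ * ((2 * T + par.lamMax + par.lam) * (a ⬝ᵥ a)) := by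
        gcongr
        linarith
      have h3 : (2 * T + par.lamMax + par.lam) / par.lam * (a ⬝ᵥ a) =
        par.lam⁻¹ * ((2 * T + par.lamMax + par.lam) * (a ⬝ᵥ a)) := by ring
      linarith
  have h1 := (hV.smul hc).log_det_mono hpsd
  rwa [det_smul _ ((2 * T + par.lamMax + par.lam) / par.lam), det_one, mul_one, Real.log_pow] at h1

theorem Matrix.PosDef.quadForm_inv_smul {W : Matrix n n ℝ} (hW : W.PosDef) {c : ℝ} (hc : 0 < c)
    (a : n → ℝ) : a ⬝ᵥ (c • W)⁻¹ *ᵥ a = c⁻¹ * (a ⬝ᵥ W⁻¹ *ᵥ a) := by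
  have h1 : (c • W)⁻¹ *ᵥ a = c⁻¹ • (W⁻¹ *ᵥ a) := by
    have h2 : (c • W) *ᵥ (c⁻¹ • (W⁻¹ *ᵥ a)) = a := by
      rw [smul_mulVec, mulVec_smul, smul_smul, mul_inv_cancel₀ hc.ne', one_smul,
        hW.mulVec_inv_mulVec]
    have := (hW.smul hc).inv_mulVec_mulVec (c⁻¹ • (W⁻¹ *ᵥ a))
    rwa [h2] at this
  rw [h1, dotProduct_smul, smul_eq_mul]

/-- Since λ ≤ ρ², V_t dominates λ/ρ² times the design matrix with regulariser ρ². The potential of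
that matrix is the log-determinant occurring in the information gain. -/
theorem sum_sq_ellNorm_le (hd : 0 < d) (hpar : par.Admissible)
    (hH : ∀ t ∈ Finset.Icc 1 T, (H t).PosSemidef) (hℋ : IsRKHSOf ℋ k)
    (hk1 : ∀ x y, k x y ≤ 1)
    (hkc : Continuous fun z : (Fin d → ℝ) × (Fin d → ℝ) => k z.1 z.2) {ε : ℝ} (hε : 0 ≤ ε)
    (happ : UniformlyApproximates Φ k ε) (hΦ : ∀ y : UnitCube d, Φ y ⬝ᵥ Φ y ≤ 2) :
    ∑ t ∈ Finset.Icc 1 T, ellNorm (ucbV Φ par.lam x H t)⁻¹ (Φ (x t)) ^ 2 ≤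
      (par.ρ ^ 2 / par.lam) * ((1 + 2 / par.ρ ^ 2) *
        (2 * maxInfoGain k par.ρ T + T * (T * ε / par.ρ ^ 2))) := by
  have hlam := hpar.lam_pos
  have hρ := hpar.ρ_pos
  have hρ2 : 0 < par.ρ ^ 2 := by positivity
  set φ : ℕ → n → ℝ := fun τ => Φ (x τ) with hφ
  have h1 : ∀ t ∈ Finset.Icc 1 T, ellNorm (ucbV Φ par.lam x H t)⁻¹ (Φ (x t)) ^ 2 ≤
      (par.ρ ^ 2 / par.lam) * (φ t ⬝ᵥ (designMatrix (par.ρ ^ 2) φ t)⁻¹ *ᵥ φ t) := by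
    intro t ht
    have hV := posDef_ucbV (Φ := Φ) (x := x) hlam (hH t ht)
    have hW := posDef_designMatrix hρ2 φ t
    rw [sq_ellNorm hV.inv.posSemidef]
    have h2 := (hW.smul (div_pos hlam hρ2)).quadForm_inv_antitone hV ?_ (φ t)
    · rwa [hW.quadForm_inv_smul (div_pos hlam hρ2), inv_div] at h2
    · have h3 : ucbV Φ par.lam x H t - (par.lam / par.ρ ^ 2) • designMatrix (par.ρ ^ 2) φ t =
          (1 - par.lam / par.ρ ^ 2) • (∑ τ ∈ Finset.Ico 1 t, vecMulVec (φ τ) (φ τ)) + H t := by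
        rw [ucbV, designMatrix, smul_add, smul_smul, div_mul_cancel₀ _ hρ2.ne', sub_smul, one_smul]
        abel
      rw [h3]
      refine PosSemidef.add (PosSemidef.smul (posSemidef_sum _ fun τ _ =>
        posSemidef_vecMulVec_self _) ?_) (hH t ht)
      rw [sub_nonneg, div_le_one hρ2]
      exact hpar.lam_le
  have h2 := sum_quadForm_inv_designMatrix_le (U := 2 / par.ρ ^ 2) hρ2 (φ := φ) (T := T)
    fun t _ => by rw [div_mul_cancel₀ _ hρ2.ne']; exact hΦ _
  rw [log_det_designMatrix_eq hρ2] at h2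
  have hpsd : ∀ a : Fin T → UnitCube d, (kernelMatrix k a).PosSemidef :=
    hℋ.posSemidef_kernelMatrix
  have h3 := log_det_features_le hρ hε happ (hpsd fun i => x (i + 1))
  have h4 := log_det_le_maxInfoGain hd hρ hpsd (hℋ.abs_le_one hk1) hkc fun i => x (i + 1)
  calc ∑ t ∈ Finset.Icc 1 T, ellNorm (ucbV Φ par.lam x H t)⁻¹ (Φ (x t)) ^ 2
      ≤ ∑ t ∈ Finset.Icc 1 T,
          (par.ρ ^ 2 / par.lam) * (φ t ⬝ᵥ (designMatrix (par.ρ ^ 2) φ t)⁻¹ *ᵥ φ t) :=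
        Finset.sum_le_sum h1
    _ ≤ _ := by
        rw [← Finset.mul_sum]
        refine mul_le_mul_of_nonneg_left (h2.trans ?_) (by positivity)
        refine mul_le_mul_of_nonneg_left ?_ (by positivity)
        linarith

/-- Regret on the good event, in terms of a common bound `β` for the multipliers `β_t^{1/2}`. -/
theorem regret_le_of_goodRound (hd : 0 < d) (hpar : par.Admissible)
    (hgood : ∀ t ∈ Finset.Icc 1 T, GoodRound par Φ x η H h t)
    (hℋ : IsRKHSOf ℋ k) (hk1 : ∀ x y, k x y ≤ 1)
    (hkc : Continuous fun z : (Fin d → ℝ) × (Fin d → ℝ) => k z.1 z.2)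
    {f : ℋ} (hf : ‖f‖ ≤ par.B) {ε : ℝ} (hε : 0 < ε)
    (happ : UniformlyApproximates Φ k ε) (hΦ : ∀ y : UnitCube d, Φ y ⬝ᵥ Φ y ≤ 2)
    {𝒟 : ℕ → Set (UnitCube d)} (hmem : ∀ t ∈ Finset.Icc 1 T, x t ∈ 𝒟 t)
    (hmax : ∀ t ∈ Finset.Icc 1 T,
      IsMaxOn (ucbIndex par Φ x (fun τ => f (x τ) + η τ) H h t) (𝒟 t) (x t))
    {β : ℝ} (hβ0 : 0 ≤ β) (hβ : ∀ t ∈ Finset.Icc 1 T, ucbBetaSqrt par Φ x H t ≤ β) :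
    ∑ t ∈ Finset.Icc 1 T, (sSup (f '' 𝒟 t) - f (x t)) ≤
      2 * par.ρ * β * √(T * ((par.ρ ^ 2 / par.lam) * ((1 + 2 / par.ρ ^ 2) *
        (2 * maxInfoGain k par.ρ T + T * (T * ε / par.ρ ^ 2))))) +
      T * (par.B * √((T + 1) * ε) * (2 + 4 * T / par.lam)) := by
  have hlam := hpar.lam_pos
  have hρ := hpar.ρ_pos
  have hB := hpar.B_nonneg
  set σ : ℕ → ℝ := fun t => ellNorm (ucbV Φ par.lam x H t)⁻¹ (Φ (x t)) with hσ
  have h1 : ∀ t ∈ Finset.Icc 1 T, sSup (f '' 𝒟 t) - f (x t) ≤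
      2 * par.ρ * β * σ t + par.B * √((T + 1) * ε) * (2 + 4 * T / par.lam) := by
    intro t ht
    rw [sub_le_iff_le_add]
    -- The played action shows that the decision set is nonempty.
    refine csSup_le ⟨_, _, hmem t ht, rfl⟩ ?_
    rintro _ ⟨a, ha, rfl⟩
    have h2 := instantaneous_regret_le hpar (hgood t ht) hℋ hf hε happ hΦ
      (Finset.mem_Icc.1 ht).1 (hmax t ht) ha
    have htT : (t : ℝ) ≤ T := by exact_mod_cast (Finset.mem_Icc.1 ht).2
    have h3 : par.B * √((t + 1) * ε) * (2 + 4 * t / par.lam) ≤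
        par.B * √((T + 1) * ε) * (2 + 4 * T / par.lam) := by gcongr
    have h4 : par.ρ * ucbBetaSqrt par Φ x H t * σ t ≤ par.ρ * β * σ t := by
      have := hβ t ht
      have := ellNorm_nonneg (ucbV Φ par.lam x H t)⁻¹ (Φ (x t))
      gcongr
    linarith
  have hsq := sum_sq_ellNorm_le (x := x) (T := T) hd hpar
    (fun t ht => (hgood t ht).posDef.posSemidef) hℋ hk1 hkc hε.le happ hΦ
  have hcs : ∑ t ∈ Finset.Icc 1 T, σ t ≤ √(T * ((par.ρ ^ 2 / par.lam) * ((1 + 2 / par.ρ ^ 2) *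
        (2 * maxInfoGain k par.ρ T + T * (T * ε / par.ρ ^ 2))))) := by
    refine Real.le_sqrt_of_sq_le ?_
    have h2 := sq_sum_le_card_mul_sum_sq (s := Finset.Icc 1 T) (f := σ)
    rw [Nat.card_Icc, Nat.add_sub_cancel] at h2
    exact h2.trans (by gcongr)
  calc ∑ t ∈ Finset.Icc 1 T, (sSup (f '' 𝒟 t) - f (x t))
      ≤ ∑ t ∈ Finset.Icc 1 T,
          (2 * par.ρ * β * σ t + par.B * √((T + 1) * ε) * (2 + 4 * T / par.lam)) :=
        Finset.sum_le_sum h1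
    _ = 2 * par.ρ * β * ∑ t ∈ Finset.Icc 1 T, σ t +
          T * (par.B * √((T + 1) * ε) * (2 + 4 * T / par.lam)) := by
        rw [Finset.sum_add_distrib, ← Finset.mul_sum, Finset.sum_const, Nat.card_Icc,
          Nat.add_sub_cancel, nsmul_eq_mul]
    _ ≤ _ := by gcongr

end Regret

/-! ### Horizons past which lower order terms are absorbed -/

section LargeHorizon

open Filter Topology

/-- The horizon `T` is large enough for all terms of lower order to be negligible; `c` is the
value of the kernel on the diagonal. -/
structure LargeHorizon (d : ℕ) (ρ lam B lam₀ A c : ℝ) (T : ℕ) : Prop where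
  one_le : 1 ≤ T
  error_le_one : A / (T : ℝ) ^ 6 ≤ 1
  two_le_log : 2 ≤ Real.log (1 + T * c / ρ ^ 2)
  gain_error_le : T * (T * (A / (T : ℝ) ^ 6) / ρ ^ 2) ≤ 1
  regret_error_le : T * (B * √((T + 1) * (A / (T : ℝ) ^ 6)) * (2 + 4 * T / lam)) ≤ 1
  one_le_log : 1 ≤ 6 * Real.log T
  sq_norm_le : B ^ 2 ≤ (6 * Real.log T) ^ (d + 1)
  multiplier_error_le : T * B * (A / (T : ℝ) ^ 6) / (ρ * √lam₀) ≤ 1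
  gram_le : 1 + 2 * T / lam ≤ (T : ℝ) ^ 6
  dim_le : 2 ^ (d + 1) * (6 * Real.log T) ^ d / (T : ℝ) ^ 6 ≤ 1
  dim_le' : 2 ^ (d + 1) * (6 * Real.log T) ^ d / (T : ℝ) ^ 6 ≤ lam * (B ^ 2 / ρ ^ 2)

theorem eventually_log_pow_le (d : ℕ) (a : ℝ) {b : ℝ} (hb : 0 < b) :
    ∀ᶠ T : ℕ in atTop, a * Real.log T ^ d / (T : ℝ) ^ 6 ≤ b := by
  have h1 : Tendsto (fun x : ℝ => Real.log x ^ d / x) atTop (𝓝 0) :=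
    (Real.isLittleO_pow_log_id_atTop (n := d)).tendsto_div_nhds_zero
  have h2 : Tendsto (fun T : ℕ => |a| * (Real.log T ^ d / (T : ℝ))) atTop (𝓝 (|a| * 0)) :=
    (h1.comp tendsto_natCast_atTop_atTop).const_mul |a|
  rw [mul_zero] at h2
  filter_upwards [h2.eventually (ge_mem_nhds hb), eventually_ge_atTop 1] with T hT hT1
  refine le_trans ?_ hT
  have hT1' : (1 : ℝ) ≤ T := by exact_mod_cast hT1
  have hlog : 0 ≤ Real.log T := Real.log_nonneg hT1'
  rw [← mul_div_assoc]
  have h3 : (T : ℝ) ≤ (T : ℝ) ^ 6 := le_self_pow₀ hT1' (by norm_num)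
  gcongr
  exact le_abs_self a

theorem eventually_largeHorizon (d : ℕ) {ρ lam B lam₀ A c : ℝ} (hρ : 0 < ρ) (hlam : 0 < lam)
    (hB : 0 < B) (hlam₀ : 0 < lam₀) (hA : 0 < A) (hc : 0 < c) :
    ∀ᶠ T : ℕ in atTop, LargeHorizon d ρ lam B lam₀ A c T := by
  have hge : ∀ a : ℝ, ∀ᶠ T : ℕ in atTop, a ≤ T := fun a =>
    tendsto_natCast_atTop_atTop.eventually_ge_atTop a
  have hlog : Tendsto (fun T : ℕ => 6 * Real.log T) atTop atTop :=
    (Real.tendsto_log_atTop.comp tendsto_natCast_atTop_atTop).const_mul_atTop (by norm_num)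
  have hlogpow : Tendsto (fun T : ℕ => (6 * Real.log T) ^ (d + 1)) atTop atTop :=
    (tendsto_pow_atTop d.succ_ne_zero).comp hlog
  have hdim : ∀ b : ℝ, 0 < b → ∀ᶠ T : ℕ in atTop,
      2 ^ (d + 1) * (6 * Real.log T) ^ d / (T : ℝ) ^ 6 ≤ b := fun b hb => by
    filter_upwards [eventually_log_pow_le d (2 ^ (d + 1) * 6 ^ d) hb] with T hT
    rwa [mul_pow, ← mul_assoc]
  filter_upwards [hge 1, hge A, hge (ρ ^ 2 * Real.exp 2 / c), hge (A / ρ ^ 2),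
    hge (2 * A * B ^ 2 * (2 + 4 / lam) ^ 2), hlog.eventually_ge_atTop 1,
    hlogpow.eventually_ge_atTop (B ^ 2), hge (B * A / (ρ * √lam₀)), hge (1 + 2 / lam),
    hdim 1 one_pos, hdim (lam * (B ^ 2 / ρ ^ 2)) (by positivity)]
    with T h1 hTA h2 h3 h4 h5 h6 h7 h8 h9 h10
  have hT0 : (0 : ℝ) < T := by linarith
  have hpow : ∀ j : ℕ, j ≠ 0 → (T : ℝ) ≤ (T : ℝ) ^ j := fun j hj => le_self_pow₀ h1 hj
  refine ⟨by exact_mod_cast h1, ?_, ?_, ?_, ?_, h5, h6, ?_, ?_, h9, h10⟩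
  · rw [div_le_one (by positivity)]
    exact hTA.trans (hpow 6 (by norm_num))
  · rw [Real.le_log_iff_exp_le (by positivity)]
    have : Real.exp 2 ≤ T * c / ρ ^ 2 := by
      rw [div_le_iff₀ hc] at h2
      rw [le_div_iff₀ (by positivity)]
      linarith
    linarith
  · have e1 : T * (T * (A / (T : ℝ) ^ 6) / ρ ^ 2) = (A / ρ ^ 2) / (T : ℝ) ^ 4 := by
      field_simp
    rw [e1, div_le_one (by positivity)]
    exact h3.trans (hpow 4 (by norm_num))
  · have e1 : (T + 1) * (A / (T : ℝ) ^ 6) ≤ 2 * A / (T : ℝ) ^ 5 := by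
      have : ((T : ℝ) + 1) * (A / (T : ℝ) ^ 6) ≤ (2 * T) * (A / (T : ℝ) ^ 6) := by
        gcongr; linarith
      refine this.trans (le_of_eq ?_)
      field_simp
    have e2 : 2 + 4 * T / lam ≤ (2 + 4 / lam) * T := by
      have : 4 * T / lam = 4 / lam * T := by ring
      rw [this, add_mul]
      linarith
    calc T * (B * √((T + 1) * (A / (T : ℝ) ^ 6)) * (2 + 4 * T / lam))
        ≤ T * (B * √(2 * A / (T : ℝ) ^ 5) * ((2 + 4 / lam) * T)) := by gcongr
      _ = √((B * (2 + 4 / lam) * T ^ 2) ^ 2 * (2 * A / (T : ℝ) ^ 5)) := by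
          rw [Real.sqrt_mul (by positivity), Real.sqrt_sq (by positivity)]
          ring
      _ ≤ 1 := by
          rw [Real.sqrt_le_one]
          have e3 : (B * (2 + 4 / lam) * (T : ℝ) ^ 2) ^ 2 * (2 * A / (T : ℝ) ^ 5) =
              (2 * A * B ^ 2 * (2 + 4 / lam) ^ 2) / T := by field_simp
          rw [e3, div_le_one hT0]
          exact h4
  · have e1 : T * B * (A / (T : ℝ) ^ 6) / (ρ * √lam₀) = (B * A / (ρ * √lam₀)) / (T : ℝ) ^ 5 := by
      field_simp
    rw [e1, div_le_one (by positivity)]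
    exact h7.trans (hpow 5 (by norm_num))
  · calc 1 + 2 * T / lam ≤ T * (1 + 2 / lam) := by
          have : 2 * T / lam = T * (2 / lam) := by ring
          rw [this, mul_add]
          linarith
      _ ≤ T * T := by gcongr
      _ = (T : ℝ) ^ 2 := by ring
      _ ≤ (T : ℝ) ^ 6 := pow_le_pow_right₀ h1 (by norm_num)

end LargeHorizon

/-! ### The regret bound -/

section RegretBound

open Matrix

variable {d : ℕ} {n : Type} [Fintype n] {Φ : (Fin d → ℝ) → n → ℝ} {T : ℕ}

theorem card_le_of_eq_numNodes (hT : 1 ≤ 6 * Real.log T)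
    (hcard : Fintype.card n = 2 * numNodes T ^ d) :
    (Fintype.card n : ℝ) ≤ 2 ^ (d + 1) * (6 * Real.log T) ^ d := by
  have h1 : (numNodes T : ℝ) ≤ 2 * (6 * Real.log T) := by
    have := (Nat.ceil_lt_add_one (by linarith : 0 ≤ 6 * Real.log T)).le
    rw [numNodes]
    linarith
  rw [hcard]
  push_cast
  calc 2 * (numNodes T : ℝ) ^ d ≤ 2 * (2 * (6 * Real.log T)) ^ d := by gcongr
    _ = _ := by rw [mul_pow]; ring

theorem UniformlyApproximates.mono {k : (Fin d → ℝ) → (Fin d → ℝ) → ℝ} {ε ε' : ℝ}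
    (h : UniformlyApproximates Φ k ε) (hε : ε ≤ ε') : UniformlyApproximates Φ k ε' :=
  fun x y => (h x y).trans hε

theorem UniformlyApproximates.dotProduct_self_le {k : (Fin d → ℝ) → (Fin d → ℝ) → ℝ} {ε : ℝ}
    (h : UniformlyApproximates Φ k ε) (hε : ε ≤ 1) (hk1 : ∀ x y, k x y ≤ 1) (y : UnitCube d) :
    Φ y ⬝ᵥ Φ y ≤ 2 := by
  have h1 := (abs_le.1 (h y y)).1
  have h2 := hk1 y y
  linarith

variable [DecidableEq n] {x : ℕ → UnitCube d} {η : ℕ → ℝ} {H : ℕ → Matrix n n ℝ} {h : ℕ → n → ℝ}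
  {t : ℕ} {par : UCBParams} {lam₀ A c : ℝ}

/-- With L = log T⁶ there are at most 2^(d+1) L^d features, each contributing at most about 2 L to
the log-determinant. Adding the estimates `b1`, `b2`, `b3` gives 2 Q + (2^(d+2) + 5) Y + κ/ρ. -/
theorem ucbBetaSqrt_le (hpar : par.Admissible) (hgood : GoodRound par Φ x η H h t)
    (hlarge : LargeHorizon d par.ρ par.lam par.B lam₀ A c T) (hlam₀ : 0 < lam₀)
    (hmin : lam₀ ≤ par.lamMin) (hA : par.ε ≤ A / (T : ℝ) ^ 6) (hζ0 : 0 < par.ζ) (hζ1 : par.ζ < 1)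
    (hcard : Fintype.card n = 2 * numNodes T ^ d)
    (hΦ : ∀ y : UnitCube d, Φ y ⬝ᵥ Φ y ≤ 2) (htT : t ≤ T) :
    ucbBetaSqrt par Φ x H t ≤ (2 ^ (d + 2) + 5) * (par.B * √par.lamMax / par.ρ +
      √(Real.log (1 / par.ζ) + (6 * Real.log T) ^ (d + 1)) + par.κ / par.ρ) := by
  have hρ := hpar.ρ_pos
  have hlam := hpar.lam_pos
  have hB := hpar.B_nonneg
  have hmax := hpar.lamMax_nonneg
  have hε := hpar.ε_nonneg
  set L := 6 * Real.log T with hL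
  have hL1 : 1 ≤ L := hlarge.one_le_log
  have hT1 : (1 : ℝ) ≤ T := by exact_mod_cast hlarge.one_le
  set Q := par.B * √par.lamMax / par.ρ with hQ
  have hQ0 : 0 ≤ Q := by positivity
  have hQ2 : Q ^ 2 = par.B ^ 2 / par.ρ ^ 2 * par.lamMax := by
    rw [hQ, div_pow, mul_pow, Real.sq_sqrt hmax]; ring
  have hlogζ : 0 ≤ Real.log (1 / par.ζ) := Real.log_nonneg (by rw [le_div_iff₀ hζ0]; linarith)
  have hLd : 1 ≤ L ^ (d + 1) := one_le_pow₀ hL1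
  set Y := √(Real.log (1 / par.ζ) + L ^ (d + 1)) with hY
  have hY2 : Y ^ 2 = Real.log (1 / par.ζ) + L ^ (d + 1) := Real.sq_sqrt (by positivity)
  have hY1 : 1 ≤ Y := Real.one_le_sqrt.2 (by linarith)
  have hκ : 0 ≤ par.κ := (ellNorm_nonneg _ _).trans hgood.ellNorm_le
  have hκρ : 0 ≤ par.κ / par.ρ := by positivity
  have hlogT : Real.log ((T : ℝ) ^ 6) = L := by rw [Real.log_pow]; norm_num [hL]
  have b1 : par.B * √(par.lamMax / par.ρ ^ 2 + 1) ≤ Q + Y := by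
    have h1 : √(par.lamMax / par.ρ ^ 2 + 1) ≤ √par.lamMax / par.ρ + 1 := by
      refine Real.sqrt_le_iff.2 ⟨by positivity, ?_⟩
      have : (√par.lamMax / par.ρ) ^ 2 = par.lamMax / par.ρ ^ 2 := by
        rw [div_pow, Real.sq_sqrt hmax]
      have h0 : 0 ≤ √par.lamMax / par.ρ := by positivity
      nlinarith
    have h2 : par.B ≤ Y := by
      refine abs_le_of_sq_le_sq' ?_ (by positivity) |>.2
      rw [hY2]
      linarith [hlarge.sq_norm_le]
    calc par.B * √(par.lamMax / par.ρ ^ 2 + 1) ≤ par.B * (√par.lamMax / par.ρ + 1) := by gcongr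
      _ = Q + par.B := by rw [hQ]; ring
      _ ≤ Q + Y := by linarith
  have b2 : t * par.B * par.ε / (par.ρ * √par.lamMin) ≤ Y := by
    refine le_trans ?_ (hlarge.multiplier_error_le.trans hY1)
    have hA' : 0 ≤ A / (T : ℝ) ^ 6 := hε.trans hA
    have hTBA : 0 ≤ T * par.B * (A / (T : ℝ) ^ 6) := by positivity
    gcongr
  have b3 : √(Real.log ((par.lam + par.lamMin)⁻¹ • ucbV Φ par.lam x H t).det +
      2 * Real.log (2 / par.ζ)) ≤ Q + (2 ^ (d + 2) + 3) * Y := by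
    have hm := card_le_of_eq_numNodes (n := n) hL1 hcard
    rw [← hL] at hm
    have h1 := log_det_ucbV_le hpar hgood hΦ htT
    have h2 : Real.log ((2 * T + par.lamMax + par.lam) / par.lam) ≤
        2 * L + (1 + par.lamMax / par.lam) / (T : ℝ) ^ 6 := by
      have e1 : (2 * T + par.lamMax + par.lam) / par.lam ≤
          (1 + 2 * T / par.lam) * (1 + par.lamMax / par.lam) := by
        have e2 : (1 + 2 * T / par.lam) * (1 + par.lamMax / par.lam) =
            (2 * T + par.lamMax + par.lam) / par.lam +
              2 * T / par.lam * (par.lamMax / par.lam) := by field_simp; ring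
        rw [e2]
        have : 0 ≤ 2 * T / par.lam * (par.lamMax / par.lam) := by positivity
        linarith
      have e3 : Real.log (1 + 2 * T / par.lam) ≤ L := by
        rw [← hlogT]
        exact Real.log_le_log (by positivity) hlarge.gram_le
      -- The horizon must not depend on lamMax, so its logarithm cannot be bounded by a multiple of
      -- L alone. Splitting off T⁶ and using log r ≤ r leaves a remainder linear in lamMax with the
      -- tiny factor T⁻⁶.
      have e4 : Real.log (1 + par.lamMax / par.lam) ≤
          L + (1 + par.lamMax / par.lam) / (T : ℝ) ^ 6 := by
        have e5 : 1 + par.lamMax / par.lam =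
            (T : ℝ) ^ 6 * ((1 + par.lamMax / par.lam) / (T : ℝ) ^ 6) := by field_simp
        conv_lhs => rw [e5]
        rw [Real.log_mul (by positivity) (by positivity), hlogT]
        gcongr
        exact Real.log_le_self (by positivity)
      calc Real.log ((2 * T + par.lamMax + par.lam) / par.lam)
          ≤ Real.log ((1 + 2 * T / par.lam) * (1 + par.lamMax / par.lam)) :=
            Real.log_le_log (by positivity) e1
        _ = Real.log (1 + 2 * T / par.lam) + Real.log (1 + par.lamMax / par.lam) :=
            Real.log_mul (by positivity) (by positivity)
        _ ≤ _ := by linarith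
    have h3 : (Fintype.card n : ℝ) * Real.log ((2 * T + par.lamMax + par.lam) / par.lam) ≤
        2 ^ (d + 2) * L ^ (d + 1) + 1 + Q ^ 2 := by
      set m := 2 ^ (d + 1) * L ^ d with hmdef
      have hm0 : 0 ≤ m := by positivity
      have e0 : 0 ≤ 2 * L + (1 + par.lamMax / par.lam) / (T : ℝ) ^ 6 := by positivity
      -- That remainder, multiplied by the number of features, is absorbed by Q² = B² lamMax / ρ²;
      -- this is the purpose of `dim_le'`.
      have e2 : m / (T : ℝ) ^ 6 * (par.lamMax / par.lam) ≤ Q ^ 2 := by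
        calc m / (T : ℝ) ^ 6 * (par.lamMax / par.lam)
            ≤ par.lam * (par.B ^ 2 / par.ρ ^ 2) * (par.lamMax / par.lam) := by
              gcongr; exact hlarge.dim_le'
          _ = Q ^ 2 := by rw [hQ2]; field_simp
      calc (Fintype.card n : ℝ) * Real.log ((2 * T + par.lamMax + par.lam) / par.lam)
          ≤ Fintype.card n * (2 * L + (1 + par.lamMax / par.lam) / (T : ℝ) ^ 6) := by gcongr
        _ ≤ m * (2 * L + (1 + par.lamMax / par.lam) / (T : ℝ) ^ 6) := by gcongr
        _ = 2 ^ (d + 2) * L ^ (d + 1) + m / (T : ℝ) ^ 6 +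
              m / (T : ℝ) ^ 6 * (par.lamMax / par.lam) := by rw [hmdef]; ring
        _ ≤ _ := by linarith [hlarge.dim_le]
    have h4 : 2 * Real.log (2 / par.ζ) ≤ 2 + 2 * Real.log (1 / par.ζ) := by
      have e1 : 2 / par.ζ = 2 * (1 / par.ζ) := by ring
      rw [e1, Real.log_mul two_ne_zero (by positivity)]
      have := Real.log_two_lt_d9
      linarith
    refine Real.sqrt_le_iff.2 ⟨by positivity, ?_⟩
    have h5 : (Q + (2 ^ (d + 2) + 3) * Y) ^ 2 ≥ Q ^ 2 + (2 ^ (d + 2) + 3) * Y ^ 2 := by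
      have e1 : (1 : ℝ) ≤ 2 ^ (d + 2) + 3 := by
        have : (0 : ℝ) < 2 ^ (d + 2) := by positivity
        linarith
      have e2 : 0 ≤ Q * ((2 ^ (d + 2) + 3) * Y) := by positivity
      have e3 : (2 ^ (d + 2) + 3) * Y ^ 2 ≤ (2 ^ (d + 2) + 3) ^ 2 * Y ^ 2 := by
        gcongr
        exact le_self_pow₀ e1 two_ne_zero
      nlinarith
    refine le_trans ?_ h5
    rw [hY2]
    have e4 : (2 : ℝ) ≤ 2 ^ (d + 2) + 3 := by
      have : (0 : ℝ) < 2 ^ (d + 2) := by positivity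
      linarith
    have e5 := mul_le_mul_of_nonneg_right e4 hlogζ
    linarith
  rw [ucbBetaSqrt]
  have h2d : (0 : ℝ) < 2 ^ (d + 2) := by positivity
  have e1 : 0 ≤ (2 ^ (d + 2) + 3) * Q := by positivity
  have e2 : 0 ≤ (2 ^ (d + 2) + 4) * (par.κ / par.ρ) := by positivity
  linarith

/-- The constant of the regret bound. -/
noncomputable def regretConst (d : ℕ) (ρ lam : ℝ) : ℝ :=
  2 * ρ * (2 ^ (d + 2) + 5) * √((ρ ^ 2 / lam) * ((1 + 2 / ρ ^ 2) * 3)) + 1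

theorem regretConst_pos (d : ℕ) {ρ lam : ℝ} (hρ : 0 < ρ) : 0 < regretConst d ρ lam := by
  unfold regretConst; positivity

/-- In the constant, 2ρ is from optimism, 2^(d+2) + 5 from the multiplier, and 3 from 2 γ + 1 ≤ 3 γ.
The final 1 pays for the additive interpolation error, as √(Tγ) and the bracket are both at least 1.
-/
theorem regret_le_regretConst_mul (hd : 0 < d) (hpar : par.Admissible)
    {k : (Fin d → ℝ) → (Fin d → ℝ) → ℝ}
    {ℋ : Type v} [NormedAddCommGroup ℋ] [InnerProductSpace ℝ ℋ] [CompleteSpace ℋ]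
    [RKHS ℝ ℋ (UnitCube d) ℝ]
    (hlarge : LargeHorizon d par.ρ par.lam par.B lam₀ A (k 0 0) T) (hlam₀ : 0 < lam₀) (hA0 : 0 < A)
    (hmin : lam₀ ≤ par.lamMin) (hA : par.ε ≤ A / (T : ℝ) ^ 6) (hζ0 : 0 < par.ζ) (hζ1 : par.ζ < 1)
    (hcard : Fintype.card n = 2 * numNodes T ^ d)
    (hgood : ∀ t ∈ Finset.Icc 1 T, GoodRound par Φ x η H h t)
    (hℋ : IsRKHSOf ℋ k) (hk1 : ∀ x y, k x y ≤ 1)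
    (hkc : Continuous fun z : (Fin d → ℝ) × (Fin d → ℝ) => k z.1 z.2)
    {f : ℋ} (hf : ‖f‖ ≤ par.B) (happ : UniformlyApproximates Φ k par.ε)
    {𝒟 : ℕ → Set (UnitCube d)} (hmem : ∀ t ∈ Finset.Icc 1 T, x t ∈ 𝒟 t)
    (hmax : ∀ t ∈ Finset.Icc 1 T,
      IsMaxOn (ucbIndex par Φ x (fun τ => f (x τ) + η τ) H h t) (𝒟 t) (x t)) :
    ∑ t ∈ Finset.Icc 1 T, (sSup (f '' 𝒟 t) - f (x t)) ≤
      regretConst d par.ρ par.lam * (√(T * maxInfoGain k par.ρ T) *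
        (par.B * √par.lamMax / par.ρ +
          √(Real.log (1 / par.ζ) + Real.log ((T : ℝ) ^ 6) ^ (d + 1)) + par.κ / par.ρ)) := by
  have hρ := hpar.ρ_pos
  have hlam := hpar.lam_pos
  have hB := hpar.B_nonneg
  have hT1 : (1 : ℝ) ≤ T := by exact_mod_cast hlarge.one_le
  have happ' := happ.mono hA
  have hΦ := happ'.dotProduct_self_le hlarge.error_le_one hk1
  have hlogT : Real.log ((T : ℝ) ^ 6) = 6 * Real.log T := by rw [Real.log_pow]; norm_num
  rw [hlogT]
  set R := par.B * √par.lamMax / par.ρ +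
    √(Real.log (1 / par.ζ) + (6 * Real.log T) ^ (d + 1)) + par.κ / par.ρ with hR
  have hκ : 0 ≤ par.κ := (ellNorm_nonneg _ _).trans
    (hgood 1 (Finset.mem_Icc.2 ⟨le_rfl, hlarge.one_le⟩)).ellNorm_le
  have hR1 : 1 ≤ R := by
    have e1 : 1 ≤ √(Real.log (1 / par.ζ) + (6 * Real.log T) ^ (d + 1)) := by
      refine Real.one_le_sqrt.2 ?_
      have h1 : 0 ≤ Real.log (1 / par.ζ) := Real.log_nonneg (by rw [le_div_iff₀ hζ0]; linarith)
      have h2 : 1 ≤ (6 * Real.log T) ^ (d + 1) := one_le_pow₀ hlarge.one_le_log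
      linarith
    have e2 : 0 ≤ par.B * √par.lamMax / par.ρ := by positivity
    have e3 : 0 ≤ par.κ / par.ρ := by positivity
    linarith
  have hpsd : ∀ a : Fin T → UnitCube d, (kernelMatrix k a).PosSemidef :=
    hℋ.posSemidef_kernelMatrix
  have hγ : 1 ≤ maxInfoGain k par.ρ T := by
    have := log_one_add_le_maxInfoGain hd hlarge.one_le hρ hpsd (hℋ.abs_le_one hk1) hkc
    linarith [hlarge.two_le_log]
  set γ := maxInfoGain k par.ρ T
  set C₁ := par.ρ ^ 2 / par.lam * ((1 + 2 / par.ρ ^ 2) * 3) with hC₁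
  have hC₁0 : 0 ≤ C₁ := by positivity
  have hmain := regret_le_of_goodRound hd hpar hgood hℋ hk1 hkc hf (by positivity) happ' hΦ hmem
    hmax (β := (2 ^ (d + 2) + 5) * R) (by positivity) fun t ht =>
      ucbBetaSqrt_le hpar (hgood t ht) hlarge hlam₀ hmin hA hζ0 hζ1 hcard hΦ (Finset.mem_Icc.1 ht).2
  refine hmain.trans ?_
  have h1 : √(T * (par.ρ ^ 2 / par.lam * ((1 + 2 / par.ρ ^ 2) *
      (2 * γ + T * (T * (A / (T : ℝ) ^ 6) / par.ρ ^ 2))))) ≤ √C₁ * √(T * γ) := by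
    rw [← Real.sqrt_mul hC₁0]
    refine Real.sqrt_le_sqrt ?_
    have e1 : C₁ * (T * γ) =
        T * (par.ρ ^ 2 / par.lam * ((1 + 2 / par.ρ ^ 2) * (3 * γ))) := by rw [hC₁]; ring
    rw [e1]
    have := hlarge.gain_error_le
    gcongr
    linarith
  have h2 : 1 ≤ √(T * γ) := Real.one_le_sqrt.2 (one_le_mul_of_one_le_of_one_le hT1 hγ)
  have h3 : 1 ≤ √(T * γ) * R := one_le_mul_of_one_le_of_one_le h2 hR1
  have h4 := mul_le_mul_of_nonneg_left h1
    (by positivity : 0 ≤ 2 * par.ρ * ((2 ^ (d + 2) + 5) * R))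
  have h5 := hlarge.regret_error_le
  have h6 : regretConst d par.ρ par.lam * (√(T * γ) * R) =
      2 * par.ρ * ((2 ^ (d + 2) + 5) * R) * (√C₁ * √(T * γ)) + √(T * γ) * R := by
    rw [regretConst, ← hC₁]; ring
  rw [h6]
  linarith

end RegretBound

/-! ### The regret guarantee -/

section Guarantee

open Matrix Filter

variable {d : ℕ} {k : (Fin d → ℝ) → (Fin d → ℝ) → ℝ} {p : Fin d → ℝ → ℝ}

theorem HasProductSpectralDensity.apply_zero_nonneg (hk : HasProductSpectralDensity k p) :
    0 ≤ k 0 0 := by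
  rw [hk.eq_integral]
  refine integral_nonneg fun ω => ?_
  simpa using Finset.prod_nonneg fun j _ => hk.nonneg j (ω j)

theorem UniformlyApproximates.nonneg {n : Type} [Fintype n] {Φ : (Fin d → ℝ) → n → ℝ} {ε : ℝ}
    (h : UniformlyApproximates Φ k ε) : 0 ≤ ε :=
  (abs_nonneg _).trans (h 0 0)

variable {n : Type} [Fintype n] [DecidableEq n] {Φ : (Fin d → ℝ) → n → ℝ}

theorem GoodRound.of_accurate {par : UCBParams} (hmin : 0 < par.lamMin) {x : ℕ → UnitCube d}
    {η : ℕ → ℝ} {H : ℕ → Matrix n n ℝ} {h : ℕ → n → ℝ} {t : ℕ} (hH : (H t).PosSemidef)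
    (hacc : IsUnit (H t).det ∧ ‖toEuclideanCLM (𝕜 := ℝ) (H t)‖ ≤ par.lamMax ∧
      ‖toEuclideanCLM (𝕜 := ℝ) (H t)⁻¹‖ ≤ 1 / par.lamMin ∧ ellNorm (H t)⁻¹ (h t) ≤ par.κ)
    (hnoise : (∑ τ ∈ Finset.Ico 1 t, η τ • Φ (x τ)) ⬝ᵥ
        (designMatrix (par.lam + par.lamMin) (fun τ => Φ (x τ)) t)⁻¹ *ᵥ
          (∑ τ ∈ Finset.Ico 1 t, η τ • Φ (x τ)) ≤
      par.ρ ^ 2 * (Real.log ((designMatrix (par.lam + par.lamMin) (fun τ => Φ (x τ)) t).det /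
        (par.lam + par.lamMin) ^ Fintype.card n) + 2 * Real.log (2 / par.ζ))) :
    GoodRound par Φ x η H h t := by
  have hpd : (H t).PosDef := by
    rw [hH.posDef_iff_isUnit, isUnit_iff_isUnit_det]
    exact hacc.1
  exact ⟨hpd, posSemidef_sub_smul_one hpd hmin hacc.2.2.1,
    posSemidef_smul_one_sub hH.1 hacc.2.1, hacc.2.2.2, hnoise⟩

/-- A regret bound valid whenever all rounds are good holds with probability at least `1 - ζ`. -/
theorem regretGuarantee_of_forall {C ρ lam B lam₀ ε : ℝ} {T : ℕ} (hρ : 0 < ρ) (hlam : 0 < lam)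
    (hT : 1 ≤ T) (hΦ : Measurable fun y : UnitCube d => Φ y)
    (hmain : ∀ (ℋ : Type v) [NormedAddCommGroup ℋ] [InnerProductSpace ℝ ℋ] [CompleteSpace ℋ]
      [RKHS ℝ ℋ (UnitCube d) ℝ], IsRKHSOf ℋ k → ∀ f : ℋ, ‖f‖ ≤ B →
      ∀ (lamMin lamMax κ ζ : ℝ) (𝒟 : ℕ → Set (UnitCube d)) (x : ℕ → UnitCube d) (η : ℕ → ℝ)
        (H : ℕ → Matrix n n ℝ) (h : ℕ → n → ℝ), 0 < ζ → ζ < 1 → lam₀ ≤ lamMin → 0 < lamMin →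
        lamMin ≤ lamMax →
        (∀ t ∈ Finset.Icc 1 T, GoodRound ⟨ρ, lam, B, ε, lamMin, lamMax, κ, ζ⟩ Φ x η H h t) →
        (∀ t ∈ Finset.Icc 1 T, x t ∈ 𝒟 t) →
        (∀ t ∈ Finset.Icc 1 T, IsMaxOn (ucbIndex ⟨ρ, lam, B, ε, lamMin, lamMax, κ, ζ⟩ Φ x
          (fun τ => f (x τ) + η τ) H h t) (𝒟 t) (x t)) →
        ∑ t ∈ Finset.Icc 1 T, (sSup (f '' 𝒟 t) - f (x t)) ≤ C * (√(T * maxInfoGain k ρ T) *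
          (B * √lamMax / ρ + √(Real.log (1 / ζ) + Real.log ((T : ℝ) ^ 6) ^ (d + 1)) + κ / ρ))) :
    RegretGuarantee.{u, v} C ρ lam B lam₀ ε k T Φ := by
  intro ℋ _ _ _ _ hℋ f hf Ω mΩ P _ ℱ lamMin lamMax κ ζ 𝒟 x η H h hζ0 hζ1 hlam₀ hacc hrun
  obtain ⟨hmin, hmax, hbad⟩ := hacc
  have hnoise := measure_not_selfNormalized_le (P := P) (ℱ := ℱ) (q := ρ ^ 2) (c := lam + lamMin)
    (φ := fun t ω => Φ (x t ω)) (η := η) (T := T) (δ := ζ / 2) (by positivity) (by positivity)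
    (fun t ht => hΦ.comp (hrun.measurable_action t ht)) hrun.measurable_noise
    hrun.integrable_exp_noise hrun.subgaussian_noise (by positivity)
  rw [one_div_div] at hnoise
  have hT' : (1 : ℝ) ≤ T := by exact_mod_cast hT
  set E₁ := {ω | ¬ ∀ t ∈ Finset.Icc 1 T, (∑ τ ∈ Finset.Ico 1 t, η τ ω • Φ (x τ ω)) ⬝ᵥ
        (designMatrix (lam + lamMin) (fun τ => Φ (x τ ω)) t)⁻¹ *ᵥ
          (∑ τ ∈ Finset.Ico 1 t, η τ ω • Φ (x τ ω)) ≤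
      ρ ^ 2 * (Real.log ((designMatrix (lam + lamMin) (fun τ => Φ (x τ ω)) t).det /
        (lam + lamMin) ^ Fintype.card n) + 2 * Real.log (2 / ζ))} with hE₁
  set E₂ := {ω | ¬ ∀ t ∈ Finset.Icc 1 T, IsUnit (H t ω).det ∧
      ‖Matrix.toEuclideanCLM (𝕜 := ℝ) (H t ω)‖ ≤ lamMax ∧
      ‖Matrix.toEuclideanCLM (𝕜 := ℝ) (H t ω)⁻¹‖ ≤ 1 / lamMin ∧
      ellNorm (H t ω)⁻¹ (h t ω) ≤ κ} with hE₂
  refine (measure_mono_ae (t := E₁ ∪ E₂) ?_).trans ((measure_union_le _ _).trans ?_)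
  · filter_upwards [hrun.posSemidef_H, hrun.action_mem, hrun.action_argmax]
      with ω hpsd hmem hargmax hω
    by_contra hgood
    obtain ⟨h1, h2⟩ := not_or.1 hgood
    rw [hE₁, Set.mem_ofPred_eq, not_not] at h1
    rw [hE₂, Set.mem_ofPred_eq, not_not] at h2
    exact hω (hmain ℋ hℋ f hf lamMin lamMax κ ζ (fun t => 𝒟 t ω) (fun t => x t ω)
      (fun t => η t ω) (fun t => H t ω) (fun t => h t ω) hζ0 hζ1 hlam₀ hmin hmax
      (fun t ht => GoodRound.of_accurate hmin (hpsd t ht) (h2 t ht) (h1 t ht)) hmem hargmax)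
  -- The noise event was taken at level δ = ζ/2, which is where log(2/ζ) comes from; the
  -- perturbations fail with probability at most ζ/(2T) ≤ ζ/2.
  · calc P E₁ + P E₂ ≤ ENNReal.ofReal (ζ / 2) + ENNReal.ofReal (ζ / (2 * T)) :=
          add_le_add hnoise hbad
      _ ≤ ENNReal.ofReal (ζ / 2) + ENNReal.ofReal (ζ / 2) := by
          gcongr
          linarith
      _ = ENNReal.ofReal ζ := by
          rw [← ENNReal.ofReal_add (by positivity) (by positivity), add_halves]

/-- By stationarity k(x,x) = k(0,0). If it is positive, a large horizon exists; if it is zero, f = 0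
and the regret vanishes. -/
theorem exists_forall_regretGuarantee (hd : 0 < d) {ρ lam B lam₀ A : ℝ} (hρ : 0 < ρ)
    (hlam : 0 < lam) (hlamρ : lam ≤ ρ ^ 2) (hk : HasProductSpectralDensity k p) (hB : 0 < B)
    (hlam₀ : 0 < lam₀) (hA : 0 < A) :
    ∃ T₀ : ℕ, ∀ T : ℕ, T₀ ≤ T → ∀ (n : Type) [Fintype n] [DecidableEq n]
      (Φ : (Fin d → ℝ) → n → ℝ), Measurable (fun y : UnitCube d => Φ y) →
      Fintype.card n = 2 * numNodes T ^ d → ∀ ε : ℝ, ε ≤ A / (T : ℝ) ^ 6 →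
      UniformlyApproximates Φ k ε →
      RegretGuarantee.{u, v} (regretConst d ρ lam) ρ lam B lam₀ ε k T Φ := by
  rcases hk.apply_zero_nonneg.lt_or_eq with hc | hc
  · obtain ⟨T₀, hT₀⟩ := eventually_atTop.1 (eventually_largeHorizon d hρ hlam hB hlam₀ hA hc)
    refine ⟨T₀, fun T hT n _ _ Φ hΦ hcard ε hε happ => ?_⟩
    have hlarge := hT₀ T hT
    refine regretGuarantee_of_forall hρ hlam hlarge.one_le hΦ ?_
    intro ℋ _ _ _ _ hℋ f hf lamMin lamMax κ ζ 𝒟 x η H h hζ0 hζ1 hmin₀ hmin hmax hgood hmem hargmax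
    exact regret_le_regretConst_mul (par := ⟨ρ, lam, B, ε, lamMin, lamMax, κ, ζ⟩) hd
      ⟨hρ, hlam, hlamρ, hB.le, happ.nonneg, hmin, hmin.le.trans hmax⟩ hlarge hlam₀ hA hmin₀ hε
      hζ0 hζ1 hcard hgood hℋ hk.le_one hk.continuous hf happ hmem hargmax
  · refine ⟨1, fun T hT n _ _ Φ hΦ hcard ε hε happ => ?_⟩
    refine regretGuarantee_of_forall hρ hlam hT hΦ ?_
    intro ℋ _ _ _ _ hℋ f hf lamMin lamMax κ ζ 𝒟 x η H h hζ0 hζ1 hmin₀ hmin hmax hgood hmem hargmax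
    have hf0 : ∀ y, f y = 0 := fun y => hℋ.apply_eq_zero f ((hk.apply_self _).trans hc.symm)
    have hκ : 0 ≤ κ := (ellNorm_nonneg _ _).trans
      (hgood 1 (Finset.mem_Icc.2 ⟨le_rfl, hT⟩)).ellNorm_le
    have hC := regretConst_pos d (lam := lam) hρ
    refine le_trans (le_of_eq (Finset.sum_eq_zero fun t ht => ?_)) (by positivity)
    have h1 : f '' 𝒟 t = {0} := by
      ext z
      simp only [Set.mem_image, hf0, Set.mem_singleton_iff]
      exact ⟨fun ⟨_, _, h⟩ => h.symm, fun h => ⟨x t, hmem t ht, h.symm⟩⟩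
    rw [h1, hf0, csSup_singleton, sub_zero]

theorem continuous_quadratureFeatures {M : ℕ} (node weight : Fin d → Fin M → ℝ) :
    Continuous (quadratureFeatures node weight) := by
  refine continuous_pi fun i => ?_
  rcases i with i | i <;> simp only [quadratureFeatures, Sum.elim_inl, Sum.elim_inr] <;> fun_prop

theorem card_QFFIndex (d M : ℕ) : Fintype.card (QFFIndex d M) = 2 * M ^ d := by
  simp [two_mul]

end Guarantee

/-! ### Hermite polynomials and moments of the standard normal law -/

section Hermite

open Polynomial

/-- The moments of the standard normal law. -/
noncomputable def normalMoment : ℕ → ℝ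
  | 0 => 1
  | 1 => 0
  | n + 2 => (n + 1) * normalMoment n

theorem normalMoment_succ (n : ℕ) : normalMoment (n + 1) = n * normalMoment (n - 1) := by
  cases n with
  | zero => simp [normalMoment]
  | succ n => simp [normalMoment]

theorem normalMoment_odd (n : ℕ) : normalMoment (2 * n + 1) = 0 := by
  induction n with
  | zero => rfl
  | succ n ih => rw [show 2 * (n + 1) + 1 = (2 * n + 1) + 2 by ring, normalMoment, ih, mul_zero]

theorem normalMoment_even (n : ℕ) :
    normalMoment (2 * n) = (2 * n).factorial / (2 ^ n * n.factorial) := by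
  induction n with
  | zero => simp [normalMoment]
  | succ n ih =>
    rw [show 2 * (n + 1) = 2 * n + 2 by ring, normalMoment, ih, Nat.factorial_succ,
      Nat.factorial_succ, Nat.factorial_succ]
    push_cast
    field_simp
    ring

/-- The expectation of a polynomial in a standard normal variable. -/
noncomputable def normalExpect : ℝ[X] →ₗ[ℝ] ℝ :=
  (Polynomial.basisMonomials ℝ).constr ℝ normalMoment

theorem normalExpect_X_pow (n : ℕ) : normalExpect (X ^ n) = normalMoment n := by
  rw [normalExpect, ← monomial_one_right_eq_X_pow]
  have h := (Polynomial.basisMonomials ℝ).constr_basis ℝ normalMoment n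
  rwa [coe_basisMonomials] at h

theorem normalExpect_one : normalExpect 1 = 1 := by
  simpa [normalMoment] using normalExpect_X_pow 0

theorem normalExpect_C (a : ℝ) : normalExpect (C a) = a := by
  rw [← mul_one (C a), ← smul_eq_C_mul, map_smul, normalExpect_one, smul_eq_mul, mul_one]

/-- Gaussian integration by parts, in algebraic form; on monomials it is the moment recursion. -/
theorem normalExpect_X_mul (p : ℝ[X]) : normalExpect (X * p) = normalExpect (derivative p) := by
  induction p using Polynomial.induction_on' with
  | add p q hp hq => rw [mul_add, map_add, hp, hq, derivative_add, map_add]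
  | monomial n a =>
    rw [← C_mul_X_pow_eq_monomial, mul_left_comm, ← pow_succ', ← smul_eq_C_mul, ← smul_eq_C_mul,
      derivative_smul, map_smul, map_smul, derivative_X_pow, ← smul_eq_C_mul, map_smul,
      normalExpect_X_pow, normalExpect_X_pow, normalMoment_succ, smul_eq_mul (a := (n : ℝ))]

/-- Hermite polynomials over the reals. -/
noncomputable def realHermite (n : ℕ) : ℝ[X] := (hermite n).map (Int.castRingHom ℝ)

theorem realHermite_zero : realHermite 0 = 1 := by simp [realHermite]

theorem realHermite_succ (n : ℕ) :
    realHermite (n + 1) = X * realHermite n - derivative (realHermite n) := by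
  simp [realHermite, hermite_succ, derivative_map]

theorem realHermite_monic (n : ℕ) : (realHermite n).Monic := (hermite_monic n).map _

theorem natDegree_realHermite (n : ℕ) : (realHermite n).natDegree = n := by
  rw [realHermite, (hermite_monic n).natDegree_map, natDegree_hermite]

theorem derivative_realHermite (n : ℕ) :
    derivative (realHermite (n + 1)) = (n + 1 : ℝ) • realHermite n := by
  induction n with
  | zero => simp [realHermite_succ, realHermite_zero]
  | succ n ih =>
    rw [realHermite_succ (n + 1), derivative_sub, derivative_mul, derivative_X, one_mul, ih,
      derivative_smul, mul_smul_comm, add_sub_assoc, ← smul_sub, ← realHermite_succ]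
    push_cast
    module

/-- Multiplication by X minus differentiation is adjoint to differentiation, so He_n acts as the
n-th derivative. Orthogonality to lower degrees and the norm n! both follow. -/
theorem normalExpect_realHermite_mul (n : ℕ) (q : ℝ[X]) :
    normalExpect (realHermite n * q) = normalExpect (derivative^[n] q) := by
  induction n generalizing q with
  | zero => simp [realHermite_zero]
  | succ n ih =>
    rw [realHermite_succ, sub_mul, mul_assoc, map_sub, normalExpect_X_mul, derivative_mul, map_add,
      add_sub_cancel_left, ih, Function.iterate_succ_apply]

theorem normalExpect_realHermite_mul_eq_zero {n : ℕ} {q : ℝ[X]} (hq : q.natDegree < n) :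
    normalExpect (realHermite n * q) = 0 := by
  rw [normalExpect_realHermite_mul, iterate_derivative_eq_zero hq, map_zero]

theorem normalExpect_realHermite_mul_of_monic {n : ℕ} {q : ℝ[X]} (hq : q.Monic)
    (hn : q.natDegree = n) : normalExpect (realHermite n * q) = n.factorial := by
  have h1 : derivative^[n] q = C (n.factorial : ℝ) := by
    have h2 : (derivative^[n] q).natDegree = 0 := by
      have := natDegree_iterate_derivative q n
      omega
    rw [eq_C_of_natDegree_eq_zero h2, coeff_iterate_derivative, zero_add, ← hn,
      hq.coeff_natDegree, Nat.descFactorial_self, nsmul_eq_mul, mul_one]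
  rw [normalExpect_realHermite_mul, h1, normalExpect_C]

/-- Induction on the degree: q = c He_n + r with r of lower degree and orthogonal to He_n, so the
expectation of q² is c² n! plus that of r². -/
theorem normalExpect_sq_pos {q : ℝ[X]} (hq : q ≠ 0) : 0 < normalExpect (q * q) := by
  induction hn : q.natDegree using Nat.strong_induction_on generalizing q with
  | _ n ih =>
    subst hn
    set H := realHermite q.natDegree with hH
    have hHm : H.Monic := realHermite_monic _
    set c := q.leadingCoeff with hc
    have hc0 : c ≠ 0 := leadingCoeff_ne_zero.2 hq
    set r := q - c • H with hr
    have hr0 : 0 ≤ normalExpect (r * r) ∧ normalExpect (H * r) = 0 := by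
      by_cases h0 : r = 0
      · simp [h0]
      have hdeg : r.natDegree < q.natDegree := by
        refine natDegree_lt_natDegree h0 (degree_sub_lt_left ?_ hq ?_)
        · rw [degree_smul_of_smul_regular _ (IsSMulRegular.of_ne_zero hc0),
            degree_eq_natDegree hHm.ne_zero, natDegree_realHermite, degree_eq_natDegree hq]
        · rw [leadingCoeff_smul_of_smul_regular _ (IsSMulRegular.of_ne_zero hc0), hHm.leadingCoeff,
            smul_eq_mul, mul_one]
      exact ⟨(ih _ hdeg h0 rfl).le, normalExpect_realHermite_mul_eq_zero hdeg⟩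
    have h1 : q * q = c ^ 2 • (H * H) + (2 * c) • (H * r) + r * r := by
      rw [hr]
      simp only [smul_eq_C_mul, map_pow, map_mul, map_ofNat]
      ring
    rw [h1, map_add, map_add, map_smul, map_smul, hr0.2,
      normalExpect_realHermite_mul_of_monic hHm (natDegree_realHermite _), smul_zero, add_zero,
      smul_eq_mul]
    have := hr0.1
    positivity

theorem normalExpect_sq_nonneg (q : ℝ[X]) : 0 ≤ normalExpect (q * q) := by
  by_cases h : q = 0
  · simp [h]
  · exact (normalExpect_sq_pos h).le

/-- If He_n = ((X - a)² + b²) g, orthogonality makes the expectation of He_n g zero, yet He_n g is a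
sum of squares with positive expectation. Taking b ≠ 0 excludes nonreal roots, b = 0 double roots.
-/
theorem not_sq_add_sq_dvd_realHermite (n : ℕ) (a b : ℝ) :
    ¬ (X - C a) ^ 2 + C (b ^ 2) ∣ realHermite n := by
  rintro ⟨g, hg⟩
  have hs : ((X - C a) ^ 2 + C (b ^ 2)).natDegree = 2 := by
    rw [natDegree_add_C, natDegree_pow, natDegree_X_sub_C]
  have hg0 : g ≠ 0 := by
    rintro rfl
    exact (realHermite_monic n).ne_zero (by rw [hg, mul_zero])
  have hdeg : g.natDegree < n := by
    have h1 := congrArg natDegree hg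
    rw [natDegree_mul (ne_zero_of_natDegree_gt (n := 1) (by omega)) hg0, hs, natDegree_realHermite] at h1
    omega
  have h1 := normalExpect_realHermite_mul_eq_zero hdeg
  have h2 : realHermite n * g = ((X - C a) * g) * ((X - C a) * g) + b ^ 2 • (g * g) := by
    rw [hg, smul_eq_C_mul]; ring
  rw [h2, map_add, map_smul, smul_eq_mul] at h1
  have h3 := normalExpect_sq_pos (mul_ne_zero (X_sub_C_ne_zero a) hg0)
  have h4 := mul_nonneg (sq_nonneg b) (normalExpect_sq_nonneg g)
  linarith

theorem splits_realHermite (n : ℕ) : (realHermite n).Splits := by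
  refine Splits.of_splits_map Complex.ofRealHom (IsAlgClosed.splits _) fun z hz => ?_
  have hz' : aeval z (realHermite n) = 0 := by
    rw [aeval_def, ← eval_map]
    exact (mem_roots'.1 hz).2
  by_cases him : z.im = 0
  · exact ⟨z.re, Complex.ext rfl (by simpa using him.symm)⟩
  · exfalso
    refine not_sq_add_sq_dvd_realHermite n z.re z.im
      (dvd_trans ?_ (quadratic_dvd_of_aeval_eq_zero_im_ne_zero _ hz' him))
    refine dvd_of_eq ?_
    rw [Complex.sq_norm, Complex.normSq_apply]
    simp only [map_add, map_mul, map_pow, map_ofNat]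
    ring

theorem nodup_roots_realHermite (n : ℕ) : (realHermite n).roots.Nodup := by
  rw [Multiset.nodup_iff_count_le_one]
  intro a
  rw [count_roots]
  by_contra h
  refine not_sq_add_sq_dvd_realHermite n a 0 ?_
  have h2 : 2 ≤ rootMultiplicity a (realHermite n) := by omega
  rw [zero_pow two_ne_zero, C_0, add_zero]
  exact (le_rootMultiplicity_iff (realHermite_monic n).ne_zero).1 h2

theorem card_roots_realHermite (n : ℕ) : (realHermite n).roots.card = n := by
  rw [splits_iff_card_roots.1 (splits_realHermite n), natDegree_realHermite]

end Hermite

/-! ### Gauss-Hermite quadrature -/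

section Quadrature

open Polynomial

theorem length_sort_roots_realHermite (M : ℕ) :
    ((realHermite M).roots.sort (· ≤ ·)).length = M := by
  rw [Multiset.length_sort, card_roots_realHermite]

/-- There are exactly M roots with multiplicity, so the default value of `getD` is never used. -/
theorem hermiteNode_eq_getElem (M : ℕ) (i : Fin M) : hermiteNode M i =
    ((realHermite M).roots.sort (· ≤ ·))[i]'(by
      rw [length_sort_roots_realHermite]; exact i.2) :=
  List.getD_eq_getElem _ _ _

theorem hermiteNode_injective (M : ℕ) : Function.Injective (hermiteNode M) := by
  intro i j hij
  rw [hermiteNode_eq_getElem, hermiteNode_eq_getElem] at hij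
  have hnd : ((realHermite M).roots.sort (· ≤ ·)).Nodup := by
    rw [← Multiset.coe_nodup, Multiset.sort_eq]
    exact nodup_roots_realHermite M
  exact Fin.ext ((hnd.getElem_inj_iff).1 hij)

theorem eval_hermiteNode (M : ℕ) (i : Fin M) : (realHermite M).eval (hermiteNode M i) = 0 := by
  have h1 : hermiteNode M i ∈ (realHermite M).roots.sort (· ≤ ·) := by
    rw [hermiteNode_eq_getElem]
    exact List.getElem_mem _
  rw [Multiset.mem_sort] at h1
  exact (mem_roots'.1 h1).2

/-- Divide q by He_M. The quotient has degree below M, so its product with He_M has expectation zero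
and vanishes at the nodes; the remainder is recovered by Lagrange interpolation. -/
theorem exists_normalExpect_eq_sum (M : ℕ) : ∃ w : Fin M → ℝ, ∀ q : ℝ[X], q.natDegree < 2 * M →
    normalExpect q = ∑ i, w i * q.eval (hermiteNode M i) := by
  refine ⟨fun i => normalExpect (Lagrange.basis Finset.univ (hermiteNode M) i), fun q hq => ?_⟩
  have hm := realHermite_monic M
  have hinj : Set.InjOn (hermiteNode M) (Finset.univ : Finset (Fin M)) :=
    (hermiteNode_injective M).injOn
  set r := q %ₘ realHermite M with hr
  have hrdeg : r.degree < (Finset.univ : Finset (Fin M)).card := by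
    rw [Finset.card_univ, Fintype.card_fin]
    have := degree_modByMonic_lt q hm
    rwa [degree_eq_natDegree hm.ne_zero, natDegree_realHermite] at this
  have hqdeg : (q /ₘ realHermite M).natDegree < M := by
    rw [natDegree_divByMonic q hm, natDegree_realHermite]
    omega
  have hsplit := modByMonic_add_div q (realHermite M)
  have h1 : ∀ i, r.eval (hermiteNode M i) = q.eval (hermiteNode M i) := fun i => by
    conv_rhs => rw [← hsplit]
    rw [eval_add, eval_mul, eval_hermiteNode, zero_mul, add_zero]
  conv_lhs => rw [← hsplit]
  rw [map_add, normalExpect_realHermite_mul_eq_zero hqdeg, add_zero, ← hr,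
    Lagrange.eq_interpolate hinj hrdeg, Lagrange.interpolate_apply, map_sum]
  refine Finset.sum_congr rfl fun i _ => ?_
  rw [← smul_eq_C_mul, map_smul, smul_eq_mul, h1, mul_comm]

/-- With He_{N+1} = (X - z) g, test exactness on He_N g. Only the node z contributes, where g(z) =
He_{N+1}'(z) = (N+1) He_N(z), and the expectation is N!. -/
theorem eq_hermiteWeight {M : ℕ} {w : Fin M → ℝ} (hw : ∀ q : ℝ[X], q.natDegree < 2 * M →
    normalExpect q = ∑ i, w i * q.eval (hermiteNode M i)) (i : Fin M) :
    w i = hermiteWeight M i := by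
  obtain ⟨N, rfl⟩ : ∃ N, M = N + 1 := ⟨M - 1, by have := i.2; omega⟩
  set z := hermiteNode (N + 1) i with hz
  obtain ⟨g, hg⟩ := dvd_iff_isRoot.2 (eval_hermiteNode (N + 1) i)
  have hgm : g.Monic := (monic_X_sub_C z).of_mul_monic_left (hg ▸ realHermite_monic (N + 1))
  have hgdeg : g.natDegree = N := by
    have h1 := congrArg natDegree hg
    rw [(monic_X_sub_C z).natDegree_mul hgm, natDegree_X_sub_C, natDegree_realHermite] at h1
    omega
  have hgz : g.eval z = (N + 1) * (realHermite N).eval z := by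
    have h1 := congrArg (fun p => (derivative p).eval z) hg
    simp only [derivative_realHermite, derivative_mul, derivative_sub, derivative_X, derivative_C,
      eval_add, eval_mul, eval_sub, eval_X, eval_C, sub_zero, one_mul, eval_smul, smul_eq_mul,
      ← hz, sub_self, zero_mul, add_zero] at h1
    exact h1.symm
  have hgj : ∀ j, j ≠ i → g.eval (hermiteNode (N + 1) j) = 0 := fun j hj => by
    have h1 := eval_hermiteNode (N + 1) j
    rw [hg, eval_mul, eval_sub, eval_X, eval_C, mul_eq_zero] at h1
    exact h1.resolve_left (sub_ne_zero.2 fun h => hj (hermiteNode_injective _ h))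
  have h1 := hw (realHermite N * g) (by
    rw [(realHermite_monic N).natDegree_mul hgm, natDegree_realHermite]; omega)
  rw [normalExpect_realHermite_mul_of_monic hgm hgdeg, Finset.sum_eq_single i
    (fun j _ hj => by rw [eval_mul, hgj j hj, mul_zero, mul_zero]) (by simp), eval_mul, ← hz,
    hgz] at h1
  have hN : (N.factorial : ℝ) ≠ 0 := by positivity
  have h2 : (realHermite N).eval z ≠ 0 := fun h => hN (by rw [h1, h]; ring)
  have h3 : aeval z (hermite N) = (realHermite N).eval z := by
    rw [realHermite, eval_map, aeval_def]
    rfl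
  rw [hermiteWeight, Nat.add_sub_cancel, ← hz, h3, Nat.factorial_succ, eq_div_iff (by positivity)]
  push_cast
  rw [h1]
  ring

/-- Gauss-Hermite quadrature is exact up to degree `2 * M - 1`. -/
theorem normalExpect_eq_sum_hermiteWeight {M : ℕ} {q : ℝ[X]} (hq : q.natDegree < 2 * M) :
    normalExpect q = ∑ i, hermiteWeight M i * q.eval (hermiteNode M i) := by
  obtain ⟨w, hw⟩ := exists_normalExpect_eq_sum M
  rw [hw q hq]
  exact Finset.sum_congr rfl fun i _ => by rw [eq_hermiteWeight hw]

theorem hermiteWeight_nonneg (M : ℕ) (i : Fin M) : 0 ≤ hermiteWeight M i := by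
  unfold hermiteWeight; positivity

theorem sum_hermiteWeight {M : ℕ} (hM : 0 < M) : ∑ i, hermiteWeight M i = 1 := by
  simpa [normalExpect_one] using
    (normalExpect_eq_sum_hermiteWeight (M := M) (q := 1) (by simpa using hM)).symm

theorem sum_hermiteWeight_mul_pow {M j : ℕ} (hj : j < 2 * M) :
    ∑ i, hermiteWeight M i * hermiteNode M i ^ j = normalMoment j := by
  simpa [normalExpect_X_pow] using
    (normalExpect_eq_sum_hermiteWeight (M := M) (q := X ^ j) (by simpa using hj)).symm

/-- The degree 2M is one too high for exactness, but X^(2M) - He_M² has lower degree, He_M² vanishes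
at the nodes, and its expectation is nonnegative. -/
theorem sum_hermiteWeight_mul_pow_le {M : ℕ} (hM : 0 < M) :
    ∑ i, hermiteWeight M i * hermiteNode M i ^ (2 * M) ≤ normalMoment (2 * M) := by
  set q := X ^ (2 * M) - realHermite M * realHermite M with hq
  have hm := realHermite_monic M
  have hdeg : q.natDegree < 2 * M := by
    by_cases h0 : q = 0
    · rw [h0, natDegree_zero]; omega
    have h1 := natDegree_lt_natDegree h0 (degree_sub_lt_left ?_ (pow_ne_zero _ X_ne_zero) ?_)
    · rwa [natDegree_X_pow] at h1
    · rw [degree_X_pow, degree_eq_natDegree (hm.mul hm).ne_zero, hm.natDegree_mul hm,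
        natDegree_realHermite, two_mul]
    · rw [(monic_X_pow _).leadingCoeff, (hm.mul hm).leadingCoeff]
  have h1 := normalExpect_eq_sum_hermiteWeight hdeg
  have h2 := normalExpect_sq_nonneg (realHermite M)
  rw [hq, map_sub, normalExpect_X_pow] at h1
  simp only [eval_sub, eval_pow, eval_X, eval_mul, eval_hermiteNode, mul_zero, sub_zero] at h1
  linarith

end Quadrature

/-! ### Accuracy of Gauss-Hermite Fourier features -/

section Taylor

/-- Taylor's formula for the exponential function on the left half plane. -/
theorem norm_exp_sub_sum_le {a : ℂ} (ha : a.re ≤ 0) (n : ℕ) :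
    ‖Complex.exp a - ∑ j ∈ Finset.range n, a ^ j / j.factorial‖ ≤ ‖a‖ ^ n / n.factorial := by
  -- Induction along the segment from 0 to a: the derivative in t of each remainder is a times the
  -- previous one, and the real bounds satisfy the same relation.
  have key : ∀ t ∈ Set.Icc (0 : ℝ) 1, ‖Complex.exp (t * a) -
      ∑ j ∈ Finset.range n, (t * a) ^ j / j.factorial‖ ≤ (t * ‖a‖) ^ n / n.factorial := by
    induction n with
    | zero =>
      intro t ht
      simpa [Complex.norm_exp] using mul_nonpos_of_nonneg_of_nonpos ht.1 ha
    | succ n ih =>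
      have hder : ∀ t : ℝ, HasDerivAt (fun t : ℝ => Complex.exp (t * a) -
          ∑ j ∈ Finset.range (n + 1), (t * a) ^ j / (j.factorial : ℂ))
          (a * (Complex.exp (t * a) - ∑ j ∈ Finset.range n, (t * a) ^ j / j.factorial)) t := by
        intro t
        have h0 : HasDerivAt (fun t : ℝ => (t : ℂ) * a) a t := by
          simpa using (Complex.ofRealCLM.hasDerivAt (x := t)).mul_const a
        have h1 : HasDerivAt (fun t : ℝ => ∑ j ∈ Finset.range n,
            (t * a) ^ (j + 1) / ((j + 1).factorial : ℂ))
            (∑ j ∈ Finset.range n, (t * a) ^ j / j.factorial * a) t := by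
          refine HasDerivAt.fun_sum fun j _ => ?_
          refine ((h0.pow (j + 1)).div_const _).congr_deriv ?_
          have hj : (j.factorial : ℂ) ≠ 0 := by exact_mod_cast j.factorial_ne_zero
          have hj' : (j + 1 : ℂ) ≠ 0 := by exact_mod_cast j.succ_ne_zero
          rw [Nat.factorial_succ]
          push_cast
          field_simp
        simp_rw [Finset.sum_range_succ', pow_zero]
        refine (h0.cexp.fun_sub (h1.add_const _)).congr_deriv ?_
        rw [mul_sub, Finset.mul_sum, mul_comm a]
        congr 1
        exact Finset.sum_congr rfl fun j _ => mul_comm _ _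
      have hB : ∀ t : ℝ, HasDerivAt (fun t : ℝ => (t * ‖a‖) ^ (n + 1) / ((n + 1).factorial : ℝ))
          (‖a‖ * ((t * ‖a‖) ^ n / n.factorial)) t := by
        intro t
        refine ((((hasDerivAt_id t).mul_const ‖a‖).pow (n + 1)).div_const _).congr_deriv ?_
        rw [Nat.factorial_succ]
        push_cast
        simp only [id]
        field_simp
      refine image_norm_le_of_norm_deriv_right_le_deriv_boundary
        (fun t _ => (hder t).continuousAt.continuousWithinAt)
        (fun t _ => (hder t).hasDerivWithinAt) ?_ hB fun t ht => ?_
      · simp [Finset.sum_range_succ']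
      · rw [norm_mul]
        exact mul_le_mul_of_nonneg_left (ih t (Set.Ico_subset_Icc_self ht)) (norm_nonneg _)
  simpa using key 1 (by simp)

theorem norm_prod_sub_prod_le_sum {ι : Type*} (s : Finset ι) {a b : ι → ℂ}
    (ha : ∀ i ∈ s, ‖a i‖ ≤ 1) (hb : ∀ i ∈ s, ‖b i‖ ≤ 1) :
    ‖∏ i ∈ s, a i - ∏ i ∈ s, b i‖ ≤ ∑ i ∈ s, ‖a i - b i‖ := by
  classical
  induction s using Finset.induction_on with
  | empty => simp
  | insert i s hi ih =>
    rw [Finset.prod_insert hi, Finset.prod_insert hi, Finset.sum_insert hi]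
    have h1 := ih (fun j hj => ha j (Finset.mem_insert_of_mem hj))
      fun j hj => hb j (Finset.mem_insert_of_mem hj)
    have h2 : ‖∏ j ∈ s, a j‖ ≤ 1 := by
      rw [norm_prod]
      exact Finset.prod_le_one (fun _ _ => norm_nonneg _)
        fun j hj => ha j (Finset.mem_insert_of_mem hj)
    calc ‖a i * ∏ j ∈ s, a j - b i * ∏ j ∈ s, b j‖
        = ‖(a i - b i) * ∏ j ∈ s, a j + b i * (∏ j ∈ s, a j - ∏ j ∈ s, b j)‖ := by
          congr 1; ring
      _ ≤ ‖a i - b i‖ * ‖∏ j ∈ s, a j‖ + ‖b i‖ * ‖∏ j ∈ s, a j - ∏ j ∈ s, b j‖ := by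
          rw [← norm_mul, ← norm_mul]; exact norm_add_le _ _
      _ ≤ ‖a i - b i‖ * 1 + 1 * ∑ j ∈ s, ‖a j - b j‖ := by
          gcongr
          exact hb i (Finset.mem_insert_self i s)
      _ = _ := by ring

end Taylor

/-! ### Characteristic functions of the quadrature rule and of the spectral density -/

section QFF

open Complex

theorem sum_normalMoment (δ : ℝ) (M : ℕ) :
    ∑ j ∈ Finset.range (2 * M), (δ * I) ^ j * normalMoment j / j.factorial =
      ∑ j ∈ Finset.range M, (-(δ ^ 2 / 2 : ℝ) : ℂ) ^ j / j.factorial := by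
  induction M with
  | zero => simp
  | succ M ih =>
    rw [show 2 * (M + 1) = 2 * M + 1 + 1 by ring, Finset.sum_range_succ, Finset.sum_range_succ, ih,
      Finset.sum_range_succ, normalMoment_odd, normalMoment_even, pow_mul, mul_pow, I_sq]
    have h1 : ((2 * M).factorial : ℂ) ≠ 0 := by exact_mod_cast (2 * M).factorial_ne_zero
    have h2 : (M.factorial : ℂ) ≠ 0 := by exact_mod_cast M.factorial_ne_zero
    push_cast
    rw [mul_zero, zero_div, add_zero, show (-((δ : ℂ) ^ 2 / 2)) = ((δ : ℂ) ^ 2 * -1) / 2 by ring,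
      div_pow]
    field_simp

/-- The characteristic function of the Gauss-Hermite quadrature rule. -/
noncomputable def hermiteCharFun (M : ℕ) (δ : ℝ) : ℂ :=
  ∑ i, (hermiteWeight M i : ℂ) * cexp (δ * hermiteNode M i * I)

theorem norm_hermiteCharFun_le {M : ℕ} (hM : 0 < M) (δ : ℝ) : ‖hermiteCharFun M δ‖ ≤ 1 := by
  refine (norm_sum_le _ _).trans (le_of_eq ?_)
  rw [← sum_hermiteWeight hM]
  refine Finset.sum_congr rfl fun i _ => ?_
  rw [norm_mul, norm_real, Real.norm_of_nonneg (hermiteWeight_nonneg M i), ← ofReal_mul,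
    norm_exp_ofReal_mul_I, mul_one]

/-- Exact moments up to degree 2M - 1 give both functions the common Taylor sum `S`. Each remainder
is at most (δ²/2)^M / M!: for the quadrature because its moment of order 2M does not exceed (2M)! /
(2^M M!). -/
theorem norm_hermiteCharFun_sub_le {M : ℕ} (hM : 0 < M) (δ : ℝ) :
    ‖hermiteCharFun M δ - cexp (-(δ ^ 2 / 2 : ℝ))‖ ≤ 2 * ((δ ^ 2 / 2) ^ M / M.factorial) := by
  set S := ∑ j ∈ Finset.range M, (-(δ ^ 2 / 2 : ℝ) : ℂ) ^ j / j.factorial with hS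
  have h1 : ‖cexp (-(δ ^ 2 / 2 : ℝ)) - S‖ ≤ (δ ^ 2 / 2) ^ M / M.factorial := by
    have h := norm_exp_sub_sum_le (a := (-(δ ^ 2 / 2 : ℝ) : ℂ))
      (by rw [neg_re, ofReal_re]; have := sq_nonneg δ; linarith) M
    rwa [norm_neg, norm_real, Real.norm_of_nonneg (by positivity)] at h
  have h2 : ‖hermiteCharFun M δ - S‖ ≤ (δ ^ 2 / 2) ^ M / M.factorial := by
    have e1 : S = ∑ i, (hermiteWeight M i : ℂ) *
        ∑ j ∈ Finset.range (2 * M), (δ * hermiteNode M i * I) ^ j / j.factorial := by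
      simp_rw [Finset.mul_sum]
      rw [hS, ← sum_normalMoment, Finset.sum_comm]
      refine Finset.sum_congr rfl fun j hj => ?_
      rw [← sum_hermiteWeight_mul_pow (Finset.mem_range.1 hj)]
      push_cast
      rw [Finset.mul_sum, Finset.sum_div]
      exact Finset.sum_congr rfl fun i _ => by ring
    rw [e1, hermiteCharFun, ← Finset.sum_sub_distrib]
    calc ‖∑ i, ((hermiteWeight M i : ℂ) * cexp (δ * hermiteNode M i * I) - hermiteWeight M i *
          ∑ j ∈ Finset.range (2 * M), (δ * hermiteNode M i * I) ^ j / j.factorial)‖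
        ≤ ∑ i, hermiteWeight M i * ((δ * hermiteNode M i) ^ (2 * M) / (2 * M).factorial) := by
          refine (norm_sum_le _ _).trans (Finset.sum_le_sum fun i _ => ?_)
          rw [← mul_sub, norm_mul, norm_real, Real.norm_of_nonneg (hermiteWeight_nonneg M i)]
          refine mul_le_mul_of_nonneg_left ?_ (hermiteWeight_nonneg M i)
          have h := norm_exp_sub_sum_le (a := (δ * hermiteNode M i * I : ℂ)) (by simp) (2 * M)
          rwa [norm_mul, norm_I, mul_one, ← ofReal_mul, norm_real, Real.norm_eq_abs,
            (even_two_mul M).pow_abs, ofReal_mul] at h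
      _ = δ ^ (2 * M) / (2 * M).factorial *
            ∑ i, hermiteWeight M i * hermiteNode M i ^ (2 * M) := by
          rw [Finset.mul_sum]
          exact Finset.sum_congr rfl fun i _ => by ring
      _ ≤ δ ^ (2 * M) / (2 * M).factorial * normalMoment (2 * M) := by
          have : 0 ≤ δ ^ (2 * M) := (even_two_mul M).pow_nonneg δ
          gcongr
          exact sum_hermiteWeight_mul_pow_le hM
      _ = (δ ^ 2 / 2) ^ M / M.factorial := by
          rw [normalMoment_even, pow_mul, div_pow]
          field_simp
  calc ‖hermiteCharFun M δ - cexp (-(δ ^ 2 / 2 : ℝ))‖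
      = ‖(hermiteCharFun M δ - S) - (cexp (-(δ ^ 2 / 2 : ℝ)) - S)‖ := by rw [sub_sub_sub_cancel_right]
    _ ≤ _ := (norm_sub_le _ _).trans (by linarith)

variable {d : ℕ}

/-- Pairing sines with cosines gives the cosine of a difference, the real part of an exponential
that factors over coordinates; expanding the product of sums recovers the grid. -/
theorem quadratureFeatures_dotProduct {M : ℕ} {node weight : Fin d → Fin M → ℝ}
    (hw : ∀ j i, 0 ≤ weight j i) (x y : Fin d → ℝ) :
    quadratureFeatures node weight x ⬝ᵥ quadratureFeatures node weight y =
      (∏ j, ∑ i, (weight j i : ℂ) * cexp (node j i * (x j - y j) * I)).re := by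
  rw [Finset.prod_univ_sum, re_sum, Fintype.piFinset_univ, dotProduct, Fintype.sum_sum_type,
    ← Finset.sum_add_distrib]
  refine Finset.sum_congr rfl fun i _ => ?_
  simp only [quadratureFeatures, Sum.elim_inl, Sum.elim_inr]
  have h0 : 0 ≤ ∏ j, weight j (i j) := Finset.prod_nonneg fun j _ => hw j _
  have h1 : ∏ j, ((weight j (i j) : ℂ) * cexp (node j (i j) * (x j - y j) * I)) =
      ((∏ j, weight j (i j) : ℝ) : ℂ) *
        cexp ((∑ j, node j (i j) * x j - ∑ j, node j (i j) * y j : ℝ) * I) := by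
    rw [Finset.prod_mul_distrib, ← exp_sum, ← Finset.sum_mul, ← Finset.sum_sub_distrib]
    push_cast
    simp_rw [mul_sub]
  rw [h1, re_ofReal_mul, exp_ofReal_mul_I_re, Real.cos_sub]
  have h2 := Real.mul_self_sqrt h0
  linear_combination (Real.cos (∑ j, node j (i j) * x j) * Real.cos (∑ j, node j (i j) * y j) +
    Real.sin (∑ j, node j (i j) * x j) * Real.sin (∑ j, node j (i j) * y j)) * h2

theorem HasProductSpectralDensity.eq_prod_integral {k : (Fin d → ℝ) → (Fin d → ℝ) → ℝ}
    {p : Fin d → ℝ → ℝ} (h : HasProductSpectralDensity k p) (x y : Fin d → ℝ) :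
    k x y = (∏ j, ∫ ω : ℝ, cexp ((x j - y j : ℝ) * ω * I) * p j ω).re := by
  have hint : Integrable fun ω : Fin d → ℝ =>
      ∏ j, (cexp ((x j - y j : ℝ) * ω j * I) * p j (ω j)) := by
    refine Integrable.fintype_prod (f := fun j (ω : ℝ) => cexp ((x j - y j : ℝ) * ω * I) * p j ω)
      fun j => ?_
    refine (h.integrable j).ofReal.bdd_mul (c := 1) (Continuous.aestronglyMeasurable (by fun_prop))
      (ae_of_all _ fun ω => ?_)
    rw [← ofReal_mul, norm_exp_ofReal_mul_I]
  rw [← integral_fintype_prod_volume_eq_prod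
    (f := fun j (ω : ℝ) => cexp ((x j - y j : ℝ) * ω * I) * p j ω), h.eq_integral]
  rw [show ∀ z : ℂ, z.re = RCLike.re z from fun _ => rfl, ← integral_re hint]
  refine integral_congr_ae (ae_of_all _ fun ω => ?_)
  have h1 : ∏ j, (cexp ((x j - y j : ℝ) * ω j * I) * p j (ω j)) =
      cexp ((∑ j, ω j * (x j - y j) : ℝ) * I) * ((∏ j, p j (ω j) : ℝ) : ℂ) := by
    rw [Finset.prod_mul_distrib, ← exp_sum, ← Finset.sum_mul]
    push_cast
    simp_rw [mul_comm]
  change _ = (_ : ℂ).re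
  rw [h1, re_mul_ofReal, exp_ofReal_mul_I_re]

theorem integral_exp_mul_gaussianSpectralDensity {ν : Fin d → ℝ} {j : Fin d} (hν : 0 < ν j)
    (δ : ℝ) : ∫ ω : ℝ, cexp (δ * ω * I) * gaussianSpectralDensity ν j ω =
      cexp (-((δ / ν j) ^ 2 / 2 : ℝ)) := by
  set s : NNReal := ⟨(ν j ^ 2)⁻¹, by positivity⟩ with hs
  have hs' : (s : ℝ) = (ν j ^ 2)⁻¹ := rfl
  have hs0 : s ≠ 0 := by
    rw [← NNReal.coe_ne_zero, hs']
    positivity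
  have h1 : ∀ ω, gaussianSpectralDensity ν j ω = gaussianPDFReal 0 s ω := fun ω => by
    rw [gaussianSpectralDensity, gaussianPDFReal, hs', sub_zero, Real.sqrt_mul (x := 2 * Real.pi)
      (by positivity), Real.sqrt_inv, Real.sqrt_sq hν.le]
    congr 1
    · field_simp
    · congr 1; field_simp
  have h2 := charFun_gaussianReal (μ := 0) (v := s) δ
  rw [charFun_apply_real, integral_gaussianReal_eq_integral_smul hs0, hs'] at h2
  simp only [real_smul] at h2
  simp_rw [h1, mul_comm (cexp _)]
  rw [h2]
  congr 1
  push_cast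
  field_simp
  ring

/-- Both sides are real parts of products over the coordinates of numbers in the closed unit disc,
so the error is at most the sum of the one-dimensional errors. -/
theorem abs_kernel_sub_qff_le {ν : Fin d → ℝ} {k : (Fin d → ℝ) → (Fin d → ℝ) → ℝ}
    (hν : ∀ j, 0 < ν j) (hk : HasProductSpectralDensity k (gaussianSpectralDensity ν)) {M : ℕ}
    (hM : 0 < M) (x y : UnitCube d) :
    |k x y - qff ν M x ⬝ᵥ qff ν M y| ≤
      2 * d * ((∑ j, (ν j ^ 2)⁻¹) ^ M / M.factorial) := by
  set δ : Fin d → ℝ := fun j => (x.1 j - y.1 j) / ν j with hδ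
  have h1 : k x y = (∏ j, cexp (-(δ j ^ 2 / 2 : ℝ))).re := by
    rw [hk.eq_prod_integral]
    congr 1
    exact Finset.prod_congr rfl fun j _ => integral_exp_mul_gaussianSpectralDensity (hν j) _
  have h2 : qff ν M x ⬝ᵥ qff ν M y = (∏ j, hermiteCharFun M (δ j)).re := by
    rw [qff, quadratureFeatures_dotProduct fun _ i => hermiteWeight_nonneg M i]
    congr 1
    refine Finset.prod_congr rfl fun j _ => Finset.sum_congr rfl fun i _ => ?_
    rw [hδ]
    congr 2
    push_cast
    ring
  have h3 : ∀ j, δ j ^ 2 / 2 ≤ ∑ j, (ν j ^ 2)⁻¹ := fun j => by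
    have hxy : (x.1 j - y.1 j) ^ 2 ≤ 1 := by
      have hx := x.2.1 j; have hx' := x.2.2 j
      have hy := y.2.1 j; have hy' := y.2.2 j
      simp only [Pi.zero_apply, Pi.one_apply] at hx hx' hy hy'
      rw [sq_le_one_iff_abs_le_one, abs_le]
      constructor <;> linarith
    refine le_trans ?_ (Finset.single_le_sum (f := fun j => (ν j ^ 2)⁻¹)
      (fun j _ => by positivity) (Finset.mem_univ j))
    have h0 := sq_nonneg (δ j)
    have h4 : δ j ^ 2 ≤ (ν j ^ 2)⁻¹ := by
      rw [hδ, div_pow, div_eq_mul_inv]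
      exact mul_le_of_le_one_left (by positivity) hxy
    linarith
  rw [h1, h2, ← sub_re]
  refine (abs_re_le_norm _).trans ((norm_prod_sub_prod_le_sum _ (fun j _ => ?_)
    fun j _ => norm_hermiteCharFun_le hM _).trans ?_)
  · rw [← ofReal_neg, norm_exp_ofReal, Real.exp_le_one_iff]
    have := sq_nonneg (δ j)
    linarith
  · calc ∑ j, ‖cexp (-(δ j ^ 2 / 2 : ℝ)) - hermiteCharFun M (δ j)‖
        ≤ ∑ _j : Fin d, 2 * ((∑ j, (ν j ^ 2)⁻¹) ^ M / M.factorial) := by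
          refine Finset.sum_le_sum fun j _ => ?_
          rw [norm_sub_rev]
          refine (norm_hermiteCharFun_sub_le hM _).trans ?_
          gcongr
          exact h3 j
      _ = _ := by
          rw [Finset.sum_const, Finset.card_univ, Fintype.card_fin, nsmul_eq_mul]
          ring

open Filter Topology in
theorem eventually_uniformlyApproximates_qff {ν : Fin d → ℝ}
    {k : (Fin d → ℝ) → (Fin d → ℝ) → ℝ} (hν : ∀ j, 0 < ν j)
    (hk : HasProductSpectralDensity k (gaussianSpectralDensity ν)) {A : ℝ} (hA : 0 < A) :
    ∀ᶠ T : ℕ in atTop, UniformlyApproximates (qff ν (numNodes T)) k (A / (T : ℝ) ^ 6) := by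
  set c := ∑ j, (ν j ^ 2)⁻¹ with hc
  have hc0 : 0 ≤ c := Finset.sum_nonneg fun j _ => by positivity
  have hnum : Tendsto numNodes atTop atTop := by
    refine tendsto_nat_ceil_atTop.comp ?_
    exact (Real.tendsto_log_atTop.comp tendsto_natCast_atTop_atTop).const_mul_atTop (by norm_num)
  -- The extra factor e^M is kept in reserve to pay for T⁶ ≤ e^M, valid because M ≥ 6 log T.
  have h1 : Tendsto (fun M : ℕ => 2 * d * ((c * Real.exp 1) ^ M / M.factorial)) atTop (𝓝 0) := by
    simpa using (FloorSemiring.tendsto_pow_div_factorial_atTop (c * Real.exp 1)).const_mul (2 * d : ℝ)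
  filter_upwards [(h1.comp hnum).eventually (ge_mem_nhds hA), hnum.eventually_ge_atTop 1,
    eventually_ge_atTop 1] with T hT hM hT1 x y
  refine (abs_kernel_sub_qff_le hν hk hM x y).trans ?_
  have hT0 : (0 : ℝ) < T := by exact_mod_cast hT1
  have h2 : (T : ℝ) ^ 6 ≤ Real.exp 1 ^ numNodes T := by
    rw [← Real.exp_nat_mul, mul_one, ← Real.log_le_iff_le_exp (by positivity), Real.log_pow]
    exact Nat.le_ceil _
  rw [le_div_iff₀ (by positivity)]
  refine le_trans ?_ hT
  simp only [Function.comp_apply]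
  rw [mul_pow, mul_assoc, div_mul_eq_mul_div]
  gcongr

end QFF

/-! ### Assembly of the two statements -/

theorem mainTheorem5 (d : ℕ) (hd : 0 < d) (ρ lam : ℝ) (hρ : 0 < ρ) (hlam : 0 < lam)
    (hlamρ : lam ≤ ρ ^ 2) :
    ∃ C : ℝ, 0 < C ∧
      -- quadrature Fourier features of a kernel with Gaussian spectral density
      (∀ (ν : Fin d → ℝ) (k : (Fin d → ℝ) → (Fin d → ℝ) → ℝ), (∀ j, 0 < ν j) →
        HasProductSpectralDensity k (gaussianSpectralDensity ν) →
        ∀ B lam₀ A : ℝ, 0 < B → 0 < lam₀ → 0 < A →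
        ∃ T₀ : ℕ, ∀ T : ℕ, T₀ ≤ T →
          UniformlyApproximates (qff ν (numNodes T)) k (A / (T : ℝ) ^ 6) ∧
          ∀ ε : ℝ, ε ≤ A / (T : ℝ) ^ 6 → UniformlyApproximates (qff ν (numNodes T)) k ε →
            RegretGuarantee.{u, v} C ρ lam B lam₀ ε k T (qff ν (numNodes T))) ∧
      -- product quadrature features of an arbitrary decomposable kernel
      (∀ (p : Fin d → ℝ → ℝ) (k : (Fin d → ℝ) → (Fin d → ℝ) → ℝ),
        HasProductSpectralDensity k p →
        ∀ B lam₀ A : ℝ, 0 < B → 0 < lam₀ → 0 < A →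
        ∃ T₀ : ℕ, ∀ T : ℕ, T₀ ≤ T →
          ∀ node weight : Fin d → Fin (numNodes T) → ℝ, (∀ j i, 0 ≤ weight j i) →
          ∀ ε : ℝ, ε ≤ A / (T : ℝ) ^ 6 →
            UniformlyApproximates (quadratureFeatures node weight) k ε →
            RegretGuarantee.{u, v} C ρ lam B lam₀ ε k T (quadratureFeatures node weight)) := by
  refine ⟨regretConst d ρ lam, regretConst_pos d hρ, ?_, ?_⟩
  · intro ν k hν hk B lam₀ A hB hlam₀ hA
    obtain ⟨T₁, hT₁⟩ := Filter.eventually_atTop.1 (eventually_uniformlyApproximates_qff hν hk hA)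
    obtain ⟨T₂, hT₂⟩ := exists_forall_regretGuarantee hd hρ hlam hlamρ hk hB hlam₀ hA
    refine ⟨max T₁ T₂, fun T hT => ⟨hT₁ T (le_trans (le_max_left _ _) hT), fun ε hε happ => ?_⟩⟩
    exact hT₂ T (le_trans (le_max_right _ _) hT) _ _
      ((continuous_quadratureFeatures _ _).measurable.comp measurable_subtype_coe)
      (card_QFFIndex d _) ε hε happ
  · intro p k hk B lam₀ A hB hlam₀ hA
    obtain ⟨T₀, hT₀⟩ := exists_forall_regretGuarantee hd hρ hlam hlamρ hk hB hlam₀ hA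
    exact ⟨T₀, fun T hT node weight _ ε hε happ => hT₀ T hT _ _
      ((continuous_quadratureFeatures _ _).measurable.comp measurable_subtype_coe)
      (card_QFFIndex d _) ε hε happ⟩
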